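/- **Setting.** A Markov chain $\mathcal M$ consists of a finite set $S$ of states, a labelling $\lambda\colon S\to 2^{\mathrm{AP}}$ by atomic propositions, natural-number rewards $\mathit{rew}(s)$, and rational transition probabilities $\delta(s,t)\ge 0$ with $\sum_t\delta(s,t)=1$; $\Pr_s$ denotes the induced probability measure on infinite paths starting in $s$. A path $s_0s_1\ldots$ satisfies $a\,\mathsf U_{\le r}\,b$ if there is $k\in\mathbb N$ with $b\in\lambda(s_k)$, $a\in\lambda(s_i)$ for all $i<k$, and $\sum_{i<k}\mathit{rew}(s_i)\le r$. For $\rhd\in\{\ge,>\}$, a rational $p\in[0,1]$ and $a,b\in\mathrm{AP}$, the value of a state $s$ with respect to the query $\phi=\mathsf P_{\rhd p}(a\,\mathsf U_{\le ?}\,b)$ is $$\mathrm{val}_\phi(s)=\inf\{r\in\mathbb R:\ \Pr\nolimits_s(a\,\mathsf U_{\le r}\,b)\rhd p\}\in[-\infty,\infty]\qquad(\inf\emptyset=\infty).$$ Let $\|x\|$ be the length of the binary representation of $x$ (for a rational number, the sum of the lengths of numerator and denominator in lowest terms), $|\mathcal M|=\sum_{s}\|\mathit{rew}(s)\|+\sum_{\delta(s,t)>0}\|\delta(s,t)\|$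 the size of $\mathcal M$, and $c$ the largest reward in $\mathcal M$. Running time is measured in the arithmetic model of computation: a random access machine over the rational numbers in which each addition, subtraction, multiplication, division, comparison and memory access takes one unit of time (there is no rounding and there are no bit operations). **Theorem.** Queries of the form $\mathsf P_{\ge p}(a\,\mathsf U_{\le ?}\,b)$ or $\mathsf P_{>p}(a\,\mathsf U_{\le ?}\,b)$ can be evaluated on Markov chains in pseudo-polynomial time. That is, for each $\rhd\in\{\ge,>\}$ there are a program and a polynomial $f$ such that, for every Markov chain $\mathcal M$, all $a,b\in\mathrm{AP}$ and every rational $p\in[0,1]$, the program, given $\mathcal M$ (number of states, rewards, matrix of transition probabilities), the sets of states labelled with $a$ and with $b$, and $p$ as input, halts after at most $f\bigl(\max(1,c)\cdot|\mathcal M|\cdot\|p\|\bigr)$ time units and outputs $\mathrm{val}_\phi(s)$, for $\phi=\mathsf P_{\rhd p}(a\,\mathsf U_{\le ?}\,b)$, for all states $s$ of $\mathcal M$. -/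

import Mathlib

open MeasureTheory ProbabilityTheory

noncomputable section

/-! ## Markov chains with natural rewards -/

/-- Atomic propositions: a fixed countably infinite set. -/
abbrev AP : Type := ℕ

/-- A finite Markov chain with state set `Fin n`, rational transition probabilities, natural
numbers as state rewards, and a labelling of the states by sets of atomic propositions. -/
structure MarkovChain (n : ℕ) where
  label : Fin n → Set AP
  rew : Fin n → ℕ
  prob : Fin n → Fin n → ℚ
  prob_nonneg : ∀ s t, 0 ≤ prob s t
  sum_prob : ∀ s, ∑ t, prob s t = 1

namespace MarkovChain

variable {n : ℕ}

/-- The distribution of the successor state of `s`. -/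
def stepPMF (M : MarkovChain n) (s : Fin n) : PMF (Fin n) :=
  PMF.ofFintype (fun t => ENNReal.ofReal (M.prob s t : ℝ)) (by
    rw [← ENNReal.ofReal_sum_of_nonneg
      (fun t _ => by exact_mod_cast M.prob_nonneg s t)]
    have h : ∑ t, (M.prob s t : ℝ) = 1 := by exact_mod_cast M.sum_prob s
    rw [h, ENNReal.ofReal_one])

/-- The transition kernel of the chain. -/
def stepKernel (M : MarkovChain n) : Kernel (Fin n) (Fin n) :=
  ⟨fun s => (M.stepPMF s).toMeasure, measurable_of_countable _⟩

instance (M : MarkovChain n) : IsMarkovKernel M.stepKernel :=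
  ⟨fun s => PMF.toMeasure.isProbabilityMeasure (M.stepPMF s)⟩

/-- The kernel giving the state at time `k + 1` from the history up to time `k`:
it depends on the state at time `k` only. -/
def historyKernel (M : MarkovChain n) (k : ℕ) :
    Kernel (Finset.Iic k → Fin n) (Fin n) :=
  M.stepKernel.comap (fun h => h ⟨k, Finset.mem_Iic.2 le_rfl⟩) (measurable_pi_apply _)

instance (M : MarkovChain n) (k : ℕ) : IsMarkovKernel (M.historyKernel k) := by
  unfold historyKernel; infer_instance

/-- The probability measure `Pr_s` on the infinite paths, for the initial state `s`. -/
def pathMeasure (M : MarkovChain n) (s : Fin n) : Measure (ℕ → Fin n) :=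
  Kernel.traj (X := fun _ => Fin n) M.historyKernel 0 (fun _ => s)

/-- The paths satisfying the reward-bounded until formula `a U_{≤ r} b`. The reward of a state is
earned upon leaving it, so the reward of the `b`-state that is reached does not count. -/
def untilLE (M : MarkovChain n) (a b : AP) (r : ℝ) : Set (ℕ → Fin n) :=
  {π | ∃ k : ℕ, b ∈ M.label (π k) ∧ (∀ i < k, a ∈ M.label (π i)) ∧
    ((∑ i ∈ Finset.range k, M.rew (π i) : ℕ) : ℝ) ≤ r}

end MarkovChain

/-! ## Quantile queries -/

/-- The comparison operators `≥` and `>` of the minimising queries. -/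
inductive Comparison
  | ge
  | gt

/-- `x ≥ y` or `x > y`. -/
def Comparison.Holds : Comparison → ℝ → ℝ → Prop
  | ge, x, y => x ≥ y
  | gt, x, y => x > y

namespace MarkovChain

variable {n : ℕ}

/-- `s ⊨ P_{▷ p}(a U_{≤ r} b)`. -/
def Satisfies (M : MarkovChain n) (cmp : Comparison) (p : ℚ) (a b : AP) (r : ℝ) (s : Fin n) :
    Prop :=
  cmp.Holds ((M.pathMeasure s).real (M.untilLE a b r)) (p : ℝ)

/-- The value of the state `s` for the query `P_{▷ p}(a U_{≤ ?} b)`: the infimum, in the extended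
reals, of all real `r` such that `s ⊨ P_{▷ p}(a U_{≤ r} b)`; it is `⊤` if there is none. -/
def queryValue (M : MarkovChain n) (cmp : Comparison) (p : ℚ) (a b : AP) (s : Fin n) : EReal :=
  sInf ((fun r : ℝ => (r : EReal)) '' {r : ℝ | M.Satisfies cmp p a b r s})

end MarkovChain

/-! ## Sizes -/

/-- The length of the binary representation of a natural number (`0` has length `1`). -/
def natSize (x : ℕ) : ℕ := max 1 (Nat.size x)

/-- The length of the binary representation of a nonnegative rational number,
given by numerator and denominator in lowest terms. -/
def ratSize (x : ℚ) : ℕ := natSize x.num.natAbs + natSize x.den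

namespace MarkovChain

variable {n : ℕ}

/-- The size `|M|`: the lengths of all rewards and of all nonzero transition probabilities. -/
def size (M : MarkovChain n) : ℕ :=
  (∑ s, natSize (M.rew s)) +
    ∑ st : Fin n × Fin n with 0 < M.prob st.1 st.2, ratSize (M.prob st.1 st.2)

/-- The largest reward in the chain. -/
def maxReward (M : MarkovChain n) : ℕ := Finset.univ.sup M.rew

end MarkovChain

/-! ## Arithmetic random access machines

While-programs over a memory of rational numbers. The memory consists of arrays, numbered by the
natural numbers; each array has a cell for every natural number. The name of an array is written
in the program (so a program uses finitely many of them), whereas indices are computed.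
Every constant, memory access, field operation, comparison and assignment costs one time unit.
There is no rounding and there are no bit operations. -/

/-- Arithmetic expressions. -/
inductive RamExpr
  | const (q : ℚ)
  | read (k : ℕ) (i : RamExpr)
  | add (e f : RamExpr)
  | sub (e f : RamExpr)
  | mul (e f : RamExpr)
  | div (e f : RamExpr)

/-- The contents of the memory: `m k i` is cell `i` of array `k`. -/
abbrev RamMemory : Type := ℕ → ℕ → ℚ

/-- The index denoted by a rational number, defined if it is a natural number. -/
def toIndex (x : ℚ) : Option ℕ := if x.den = 1 ∧ 0 ≤ x.num then some x.num.toNat else none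

namespace RamExpr

/-- The value of an expression. It is undefined if a division by zero occurs, or an access to an
array at an index that is not a natural number. -/
def eval (m : RamMemory) : RamExpr → Option ℚ
  | const q => some q
  | read k i => (i.eval m).bind fun x => (toIndex x).map (m k)
  | add e f => (e.eval m).bind fun x => (f.eval m).map fun y => x + y
  | sub e f => (e.eval m).bind fun x => (f.eval m).map fun y => x - y
  | mul e f => (e.eval m).bind fun x => (f.eval m).map fun y => x * y
  | div e f => (e.eval m).bind fun x => (f.eval m).bind fun y =>
      if y = 0 then none else some (x / y)

/-- The time needed to evaluate an expression. -/
def cost : RamExpr → ℕ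
  | const _ => 1
  | read _ i => i.cost + 1
  | add e f => e.cost + f.cost + 1
  | sub e f => e.cost + f.cost + 1
  | mul e f => e.cost + f.cost + 1
  | div e f => e.cost + f.cost + 1

end RamExpr

/-- Programs; the tests are of the form `e < f`. -/
inductive RamProg
  | skip
  | assign (k : ℕ) (i e : RamExpr)
  | seq (P Q : RamProg)
  | ite (e f : RamExpr) (P Q : RamProg)
  | loop (e f : RamExpr) (P : RamProg)

/-- The memory after writing `x` into cell `i` of array `k`. -/
def RamMemory.write (m : RamMemory) (k i : ℕ) (x : ℚ) : RamMemory :=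
  Function.update m k (Function.update (m k) i x)

/-- `RamExec P m t m'`: started with memory `m`, the program `P` halts after exactly `t` time units
with memory `m'`. A program that evaluates an undefined expression does not halt. -/
inductive RamExec : RamProg → RamMemory → ℕ → RamMemory → Prop
  | skip (m : RamMemory) : RamExec .skip m 1 m
  | assign (k : ℕ) (i e : RamExpr) (m : RamMemory) (x y : ℚ) (j : ℕ)
      (hi : i.eval m = some x) (hj : toIndex x = some j) (he : e.eval m = some y) :
      RamExec (.assign k i e) m (i.cost + e.cost + 1) (m.write k j y)
  | seq (P Q : RamProg) (m m' m'' : RamMemory) (t u : ℕ)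
      (hP : RamExec P m t m') (hQ : RamExec Q m' u m'') :
      RamExec (.seq P Q) m (t + u) m''
  | ite_true (e f : RamExpr) (P Q : RamProg) (m m' : RamMemory) (x y : ℚ) (t : ℕ)
      (he : e.eval m = some x) (hf : f.eval m = some y) (hlt : x < y)
      (hP : RamExec P m t m') :
      RamExec (.ite e f P Q) m (e.cost + f.cost + 1 + t) m'
  | ite_false (e f : RamExpr) (P Q : RamProg) (m m' : RamMemory) (x y : ℚ) (t : ℕ)
      (he : e.eval m = some x) (hf : f.eval m = some y) (hge : ¬ x < y)
      (hQ : RamExec Q m t m') :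
      RamExec (.ite e f P Q) m (e.cost + f.cost + 1 + t) m'
  | loop_true (e f : RamExpr) (P : RamProg) (m m' m'' : RamMemory) (x y : ℚ) (t u : ℕ)
      (he : e.eval m = some x) (hf : f.eval m = some y) (hlt : x < y)
      (hP : RamExec P m t m') (hloop : RamExec (.loop e f P) m' u m'') :
      RamExec (.loop e f P) m (e.cost + f.cost + 1 + t + u) m''
  | loop_false (e f : RamExpr) (P : RamProg) (m : RamMemory) (x y : ℚ)
      (he : e.eval m = some x) (hf : f.eval m = some y) (hge : ¬ x < y) :
      RamExec (.loop e f P) m (e.cost + f.cost + 1) m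

/-! ## Input and output of the evaluation problem -/

open Classical in
/-- The initial memory for a chain, atomic propositions `a`, `b` and a threshold `p`.
Array 0 holds the number of states and `p`, array 1 the rewards, arrays 2 and 3 the indicators of
the states labelled with `a` and with `b`, and array 4 the transition probabilities, row by row.
All other cells are zero. -/
def inputMemory {n : ℕ} (M : MarkovChain n) (a b : AP) (p : ℚ) : RamMemory
  | 0, i => if i = 0 then (n : ℚ) else if i = 1 then p else 0
  | 1, i => if h : i < n then (M.rew ⟨i, h⟩ : ℚ) else 0
  | 2, i => if h : i < n then (if a ∈ M.label ⟨i, h⟩ then 1 else 0) else 0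
  | 3, i => if h : i < n then (if b ∈ M.label ⟨i, h⟩ then 1 else 0) else 0
  | 4, i => if h : i < n * n then
      M.prob (finProdFinEquiv.symm ⟨i, h⟩).1 (finProdFinEquiv.symm ⟨i, h⟩).2 else 0
  | _, _ => 0

/-- The extended real number that the memory `m` gives as the result for state `i`: cell `i` of
array 5 tells whether it is finite (`0`), `+∞` (positive) or `-∞` (negative), and cell `i` of
array 6 holds the number if it is finite. -/
def outputValue (m : RamMemory) (i : ℕ) : EReal :=
  if 0 < m 5 i then ⊤ else if m 5 i < 0 then ⊥ else ((m 6 i : ℝ) : EReal)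

end

noncomputable section

/-! ## Reasoning about programs -/

/-! Let `c` be positive and bound the rewards. Split every state `s` into `c` copies, copy `i`
having `i` units of reward still to earn before `s` is entered; then every transition earns 0 or 1.
Let x_k be the vector of the probabilities of `a U b` within the reward bound k - 1. Given x_k and
the constant 1, the vector x_{k+1} is the least nonnegative solution of a linear system. Leastness
is essential, since cycles without reward can make the system degenerate. State elimination
(Gaussian elimination in which an unknown whose coefficient in its own equation is 1 is set to 0)
computes least solutions: `IsLeastSolution.elimStep`. The result is one fixed matrix W with x_{k+1}
= W x_k, the goal being an extra absorbing coordinate, so the last column of W^k contains x_k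
(`pow_apply`).

Rewards are integers, so a finite value is the number k for which x_k misses the threshold and
x_{k+1} meets it (`queryValue_eq_natCast`). It can be exponentially large. Hence W is squared
repeatedly until the threshold is met, and k is then found by binary search, with one matrix product
per step. The growth of the entries is harmless in the arithmetic model.

It remains to see when to stop squaring. Let x be the probability of `a U b` without bound, computed
by a second elimination, applied to W. If p < x, then Cramer's rule shows that x - p is at least the
inverse of a number with polynomially many bits, and a similar determinant bounds a vector g for
which the probability of needing at least k steps to succeed is at most g / k. So polynomially many
squarings suffice (`exists_lt_reachStep`, `lt_unitProb`). If x ≤ p, the threshold can be met only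
for `≥`, with x = p attained at some finite bound. The set of states at which the limit is not yet
attained evolves by the zero pattern of W alone and only shrinks, so it is constant after n * c
levels (`unitProb_eq_unitReach`); a single power with exponent at least n * c decides the question.

For the running time, `Ensures Z` combines correctness with the bound `timeBound Z`, in which every
entry into a loop costs at most `Z` rounds. This is a polynomial in `Z` for each fixed program, so
it is enough to bound the rounds of each single loop. -/

@[simp] theorem toIndex_natCast (k : ℕ) : toIndex (k : ℚ) = some k := by
  simp [toIndex]

@[simp] theorem toIndex_zero : toIndex 0 = some 0 := by simpa using toIndex_natCast 0

@[simp] theorem toIndex_one : toIndex 1 = some 1 := by simpa using toIndex_natCast 1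

namespace RamMemory

theorem write_self (m : RamMemory) (k i : ℕ) (x : ℚ) :
    m.write k i x k = Function.update (m k) i x := by simp [write]

theorem write_of_ne (m : RamMemory) {k l : ℕ} (h : l ≠ k) (i : ℕ) (x : ℚ) :
    m.write k i x l = m l := by simp [write, h]

theorem write_apply (m : RamMemory) (k i : ℕ) (x : ℚ) (l j : ℕ) :
    m.write k i x l j = if l = k ∧ j = i then x else m l j := by
  by_cases h : l = k
  · subst h
    by_cases h' : j = i <;> simp [write, h']
  · simp [write, h]

end RamMemory

namespace RamProg

/-- A bound for the running time of a program all of whose loops are run through at most `Z`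
times whenever they are entered. -/
def timeBound (Z : ℕ) : RamProg → ℕ
  | skip => 1
  | assign _ i e => i.cost + e.cost + 1
  | seq P Q => P.timeBound Z + Q.timeBound Z
  | ite e f P Q => e.cost + f.cost + 1 + (P.timeBound Z + Q.timeBound Z)
  | loop e f P => Z * (e.cost + f.cost + 1 + P.timeBound Z) + (e.cost + f.cost + 1)

/-- Only loops involve `Z`, each contributing one factor, and the nesting depth is fixed by the
program. So a polynomial bound on the rounds of each loop gives a polynomial bound on the total
time. -/
theorem exists_polynomial_timeBound (P : RamProg) :
    ∃ f : Polynomial ℕ, ∀ Z, P.timeBound Z = f.eval Z := by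
  induction P with
  | skip => exact ⟨1, by simp [timeBound]⟩
  | assign k i e => exact ⟨(i.cost + e.cost + 1 : ℕ), by simp [timeBound]⟩
  | seq P Q hP hQ =>
    obtain ⟨f, hf⟩ := hP
    obtain ⟨g, hg⟩ := hQ
    exact ⟨f + g, by simp [timeBound, hf, hg]⟩
  | ite e e' P Q hP hQ =>
    obtain ⟨f, hf⟩ := hP
    obtain ⟨g, hg⟩ := hQ
    exact ⟨(e.cost + e'.cost + 1 : ℕ) + (f + g), by simp [timeBound, hf, hg]⟩
  | loop e e' P hP =>
    obtain ⟨f, hf⟩ := hP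
    exact ⟨Polynomial.X * (.C (e.cost + e'.cost + 1) + f) + .C (e.cost + e'.cost + 1),
      by simp [timeBound, hf]⟩

/-- The arrays that a program writes to. -/
def Writes : RamProg → ℕ → Bool
  | skip, _ => false
  | assign k _ _, l => l == k
  | seq P Q, l => P.Writes l || Q.Writes l
  | ite _ _ P Q, l => P.Writes l || Q.Writes l
  | loop _ _ P, l => P.Writes l

/-- Two memories agree on the arrays that `P` does not write to. -/
def Frame (P : RamProg) (m m' : RamMemory) : Prop := ∀ l, P.Writes l = false → m' l = m l

/-- Array names are part of the program text; only indices are computed. Hence the arrays that can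
change are known syntactically, and preservation of all the others reduces to `decide`. -/
theorem frame_of_exec {P : RamProg} {m m' : RamMemory} {t : ℕ} (h : RamExec P m t m') :
    P.Frame m m' := by
  induction h with
  | skip => intro l _; rfl
  | assign k i e m x y j =>
    intro l hl
    exact RamMemory.write_of_ne _ (by simpa [Writes] using hl) _ _
  | seq P Q m m' m'' t u _ _ hP hQ =>
    intro l hl
    simp only [Writes, Bool.or_eq_false_iff] at hl
    rw [hQ l hl.2, hP l hl.1]
  | ite_true _ _ P Q _ _ _ _ _ _ _ _ _ hP =>
    intro l hl
    simp only [Writes, Bool.or_eq_false_iff] at hl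
    exact hP l hl.1
  | ite_false _ _ P Q _ _ _ _ _ _ _ _ _ hQ =>
    intro l hl
    simp only [Writes, Bool.or_eq_false_iff] at hl
    exact hQ l hl.2
  | loop_true _ _ P _ _ _ _ _ _ _ _ _ _ _ _ hP hQ =>
    intro l hl
    rw [hQ l hl, hP l hl]
  | loop_false => intro l _; rfl

/-- Started with memory `m`, the program `P` halts in time `P.timeBound Z` with a memory that
satisfies `Q`. -/
def Ensures (Z : ℕ) (P : RamProg) (m : RamMemory) (Q : RamMemory → Prop) : Prop :=
  ∃ t m', RamExec P m t m' ∧ t ≤ P.timeBound Z ∧ Q m'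

variable {Z : ℕ} {P P' : RamProg} {m : RamMemory} {Q R : RamMemory → Prop} {e f i : RamExpr}

/-- The frame condition is supplied for free here, so postconditions need to mention only the arrays
that change. -/
theorem Ensures.mono (h : P.Ensures Z m Q) (hQR : ∀ m', P.Frame m m' → Q m' → R m') :
    P.Ensures Z m R := by
  obtain ⟨t, m', h1, h2, h3⟩ := h
  exact ⟨t, m', h1, h2, hQR m' (frame_of_exec h1) h3⟩

theorem Ensures.skip (h : Q m) : skip.Ensures Z m Q := ⟨1, m, .skip m, le_rfl, h⟩

theorem Ensures.assign {k j : ℕ} {x y : ℚ} (hi : i.eval m = some x) (hj : x = j)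
    (he : e.eval m = some y) (h : Q (m.write k j y)) : (assign k i e).Ensures Z m Q :=
  ⟨_, _, .assign k i e m x y j hi (by rw [hj, toIndex_natCast]) he, le_rfl, h⟩

theorem Ensures.seq (h : P.Ensures Z m fun m' => P'.Ensures Z m' Q) :
    (seq P P').Ensures Z m Q := by
  obtain ⟨t, m', h1, h2, u, m'', h3, h4, h5⟩ := h
  exact ⟨_, _, .seq _ _ _ _ _ _ _ h1 h3, Nat.add_le_add h2 h4, h5⟩

theorem Ensures.seq' (h : P.Ensures Z m R)
    (h' : ∀ m', P.Frame m m' → R m' → P'.Ensures Z m' Q) : (RamProg.seq P P').Ensures Z m Q :=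
  Ensures.seq (h.mono h')

theorem Ensures.ite {x y : ℚ} (he : e.eval m = some x) (hf : f.eval m = some y)
    (h : x < y → P.Ensures Z m Q) (h' : ¬ x < y → P'.Ensures Z m Q) :
    (ite e f P P').Ensures Z m Q := by
  by_cases hxy : x < y
  · obtain ⟨t, m', h1, h2, h3⟩ := h hxy
    exact ⟨_, _, .ite_true _ _ _ _ _ _ _ _ _ he hf hxy h1, by simp only [timeBound]; omega, h3⟩
  · obtain ⟨t, m', h1, h2, h3⟩ := h' hxy
    exact ⟨_, _, .ite_false _ _ _ _ _ _ _ _ _ he hf hxy h1, by simp only [timeBound]; omega, h3⟩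

/-- Rule for loops with an invariant and a variant. -/
theorem Ensures.loop (I : RamMemory → Prop) (v : RamMemory → ℕ) (hI : I m) (hv : v m ≤ Z)
    (hstep : ∀ m', P.Frame m m' → I m' → ∃ x y, e.eval m' = some x ∧ f.eval m' = some y ∧
      (x < y → P.Ensures Z m' fun m'' => I m'' ∧ v m'' < v m') ∧ (¬ x < y → Q m')) :
    (loop e f P).Ensures Z m Q := by
  -- The variant bounds the number of remaining rounds, so the time is linear in it; strong
  -- induction, as it may drop by more than one.
  suffices H : ∀ k m', v m' = k → P.Frame m m' → I m' → ∃ t m'', RamExec (.loop e f P) m' t m'' ∧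
      t ≤ k * (e.cost + f.cost + 1 + P.timeBound Z) + (e.cost + f.cost + 1) ∧ Q m'' by
    obtain ⟨t, m'', h1, h2, h3⟩ := H _ m rfl (fun _ _ => rfl) hI
    refine ⟨t, m'', h1, h2.trans ?_, h3⟩
    simp only [timeBound]
    gcongr
  intro k
  induction k using Nat.strong_induction_on with
  | _ k ih =>
    intro m' hk hfr hI'
    obtain ⟨x, y, hx, hy, h1, h2⟩ := hstep m' hfr hI'
    by_cases hxy : x < y
    · obtain ⟨t, m1, g1, g2, g3, g4⟩ := h1 hxy
      obtain ⟨u, m2, f1, f2, f3⟩ := ih (v m1) (hk ▸ g4) m1 rfl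
        (fun l hl => (frame_of_exec g1 l hl).trans (hfr l hl)) g3
      refine ⟨_, _, .loop_true _ _ _ _ _ _ _ _ _ _ hx hy hxy g1 f1, ?_, f3⟩
      have : v m1 + 1 ≤ k := by omega
      calc _ ≤ (v m1 + 1) * (e.cost + f.cost + 1 + P.timeBound Z) + (e.cost + f.cost + 1) := by
            rw [add_mul, one_mul]; omega
        _ ≤ _ := by gcongr
    · exact ⟨_, _, .loop_false _ _ _ _ _ _ hx hy hxy, by omega, h2 hxy⟩

/-- Cell `0` of array `v`, used as a variable. -/
abbrev var (v : ℕ) : RamExpr := .read v (.const 0)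

/-- Assignment to a variable. -/
abbrev set (v : ℕ) (e : RamExpr) : RamProg := .assign v (.const 0) e

/-- The loop `for v = 0, …, e - 1 do P`. -/
def forTo (v : ℕ) (e : RamExpr) (P : RamProg) : RamProg :=
  .seq (set v (.const 0)) (.loop (var v) e (.seq P (set v (.add (var v) (.const 1)))))

theorem eval_var (m : RamMemory) (v : ℕ) : (var v).eval m = some (m v 0) := by
  simp [RamExpr.eval]

theorem Ensures.set {v : ℕ} {x : ℚ} (he : e.eval m = some x) (h : Q (m.write v 0 x)) :
    (RamProg.set v e).Ensures Z m Q :=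
  Ensures.assign (x := 0) (j := 0) rfl (by simp) he h

/-- Rule for bounded loops. -/
theorem Ensures.forTo {v n : ℕ} (I : ℕ → RamMemory → Prop) (hn : n ≤ Z)
    (hPv : P.Writes v = false) (h0 : I 0 (m.write v 0 0))
    (he : ∀ m' j, (RamProg.forTo v e P).Frame m m' → I j m' → e.eval m' = some (n : ℚ))
    (hstep : ∀ m' j, j < n → (RamProg.forTo v e P).Frame m m' → m' v 0 = j → I j m' →
      P.Ensures Z m' fun m'' => I (j + 1) (m''.write v 0 ((j + 1 : ℕ) : ℚ))) :
    (RamProg.forTo v e P).Ensures Z m (I n) := by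
  refine Ensures.seq (Ensures.set rfl ?_)
  -- The counter initialization and the loop together write only what `forTo` writes, so frames
  -- relative to the loop entry become frames relative to `m`.
  have hfr : ∀ m', (RamProg.seq P (.set v (.add (var v) (.const 1)))).Frame (m.write v 0 0) m' →
      (RamProg.forTo v e P).Frame m m' := by
    intro m' h l hl
    simp only [RamProg.forTo, Writes, RamProg.set, Bool.or_eq_false_iff] at hl
    rw [h l (by simp [Writes, hl]), RamMemory.write_of_ne _ (by simpa using hl.1)]
  -- The variant must be a natural number, while the counter is stored as a rational; on the
  -- invariant its numerator is the counter.
  refine Ensures.loop (fun m' => ∃ j, j ≤ n ∧ m' v 0 = j ∧ I j m')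
    (fun m' => n - (m' v 0).num.toNat) ⟨0, by simp, by simp [RamMemory.write_apply], h0⟩
    ((Nat.sub_le _ _).trans hn) ?_
  rintro m' hm' ⟨j, hj, hjv, hI⟩
  refine ⟨j, n, by rw [eval_var, hjv], he _ j (hfr _ hm') hI, fun h => ?_, fun h => ?_⟩
  · have hjn : j < n := by exact_mod_cast h
    refine Ensures.seq ((hstep m' j hjn (hfr _ hm') hjv hI).mono fun m1 hf1 h1 => ?_)
    have hm1 : m1 v 0 = j := by rw [hf1 v hPv, hjv]
    refine Ensures.set (x := ((j + 1 : ℕ) : ℚ)) ?_ ⟨⟨j + 1, hjn, ?_, h1⟩, ?_⟩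
    · simp only [RamExpr.eval, toIndex_zero, Option.map_some, Option.bind_some, hm1]
      push_cast
      rfl
    · simp [RamMemory.write_apply]
    · rw [RamMemory.write_apply, if_pos ⟨rfl, rfl⟩, hjv, Rat.num_natCast, Rat.num_natCast]
      simp only [Int.toNat_natCast]
      omega
  · have : j = n := le_antisymm hj (by exact_mod_cast not_lt.1 h)
    exact this ▸ hI

end RamProg

/-! ## State elimination -/

set_option linter.unusedSectionVars false

section Elimination

variable {F : Type*} [Field F] [LinearOrder F] [IsStrictOrderedRing F]

/-- The row `k` of `A`, solved for the unknown `k`. -/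
def pivotRow (A : ℕ → ℕ → F) (k j : ℕ) : F :=
  if j = k then 0 else if A k k < 1 then A k j / (1 - A k k) else A k j

/-- Elimination of the unknown `k` from the equations `x = A x`. -/
def elimStep (A : ℕ → ℕ → F) (k s j : ℕ) : F :=
  if s = k then pivotRow A k j else if j = k then 0 else A s j + A s k * pivotRow A k j

/-- Elimination of the unknowns `0, …, k - 1`. -/
def elim (A : ℕ → ℕ → F) : ℕ → ℕ → ℕ → F
  | 0 => A
  | k + 1 => elimStep (elim A k) k

/-- Only field operations and one comparison are involved, all compatible with the cast. The machine
computes over ℚ, whereas leastness is used for real probabilities. -/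
theorem elimStep_ratCast (A : ℕ → ℕ → ℚ) (k s j : ℕ) :
    ((elimStep A k s j : ℚ) : ℝ) = elimStep (fun s j => (A s j : ℝ)) k s j := by
  have h : ((A k k : ℝ) < 1) ↔ A k k < 1 := by exact_mod_cast Iff.rfl
  unfold elimStep pivotRow
  simp only [h]
  split_ifs <;> push_cast <;> rfl

theorem elim_ratCast (A : ℕ → ℕ → ℚ) (k s j : ℕ) :
    ((elim A k s j : ℚ) : ℝ) = elim (fun s j => (A s j : ℝ)) k s j := by
  induction k generalizing s j with
  | zero => rfl
  | succ k ih =>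
    simp only [elim, elimStep_ratCast]
    congr 1
    funext s j
    exact ih s j

/-- The first `C` rows and columns of `A` form a substochastic matrix. -/
structure Substochastic (C : ℕ) (A : ℕ → ℕ → F) : Prop where
  nonneg : ∀ s < C, ∀ j < C, 0 ≤ A s j
  sum_le : ∀ s < C, ∑ j ∈ Finset.range C, A s j ≤ 1

variable {C N k : ℕ} {A : ℕ → ℕ → F}

theorem sum_pivotRow (x : ℕ → F) :
    ∑ j ∈ Finset.range C, pivotRow A k j * x j =
      (∑ j ∈ (Finset.range C).erase k, A k j * x j) / (if A k k < 1 then 1 - A k k else 1) := by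
  rw [Finset.sum_div, ← Finset.sum_subset (Finset.erase_subset k _)]
  · refine Finset.sum_congr rfl fun j hj => ?_
    rw [pivotRow, if_neg (Finset.ne_of_mem_erase hj)]
    split_ifs <;> ring
  · intro j hj hj'
    have : j = k := by
      by_contra h
      exact hj' (Finset.mem_erase.2 ⟨h, hj⟩)
    simp [pivotRow, this]

theorem sum_erase_mul (hk : k < C) (s : ℕ) (x : ℕ → F) :
    ∑ j ∈ (Finset.range C).erase k, A s j * x j =
      (∑ j ∈ Finset.range C, A s j * x j) - A s k * x k := by
  rw [← Finset.add_sum_erase _ _ (Finset.mem_range.2 hk)]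
  ring

theorem sum_elimStep_self (x : ℕ → F) :
    ∑ j ∈ Finset.range C, elimStep A k k j * x j =
      ∑ j ∈ Finset.range C, pivotRow A k j * x j := by
  simp [elimStep]

theorem sum_elimStep_of_ne (hk : k < C) {s : ℕ} (hs : s ≠ k) (x : ℕ → F) :
    ∑ j ∈ Finset.range C, elimStep A k s j * x j =
      (∑ j ∈ Finset.range C, A s j * x j) - A s k * x k +
        A s k * ∑ j ∈ Finset.range C, pivotRow A k j * x j := by
  rw [← sum_erase_mul hk, Finset.mul_sum, ← Finset.add_sum_erase _ _ (Finset.mem_range.2 hk),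
    ← Finset.add_sum_erase (Finset.range C) (fun j => A s k * _) (Finset.mem_range.2 hk)]
  simp only [elimStep, if_neg hs, if_pos, pivotRow, zero_mul, mul_zero, zero_add]
  rw [← Finset.sum_add_distrib]
  refine Finset.sum_congr rfl fun j hj => ?_
  rw [if_neg (Finset.ne_of_mem_erase hj), if_neg (Finset.ne_of_mem_erase hj)]
  ring

/-! ### Substochastic matrices under elimination -/

namespace Substochastic

theorem le_one (h : Substochastic C A) {s j : ℕ} (hs : s < C) (hj : j < C) : A s j ≤ 1 :=
  (Finset.single_le_sum (f := fun j => A s j) (fun i hi => h.nonneg s hs i (Finset.mem_range.1 hi))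
    (Finset.mem_range.2 hj)).trans (h.sum_le s hs)

/-- A diagonal entry of at least 1 uses up the whole row sum. This is the degenerate pivot, where
division is impossible. -/
theorem eq_zero (h : Substochastic C A) (hk : k < C) (h1 : ¬ A k k < 1) {j : ℕ} (hj : j < C)
    (hjk : j ≠ k) : A k j = 0 := by
  have h2 := h.sum_le k hk
  rw [← Finset.add_sum_erase _ _ (Finset.mem_range.2 hk)] at h2
  have h3 : A k j ≤ ∑ j ∈ (Finset.range C).erase k, A k j :=
    Finset.single_le_sum (f := fun j => A k j)
      (fun i hi => h.nonneg k hk i (Finset.mem_range.1 (Finset.mem_of_mem_erase hi)))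
      (Finset.mem_erase.2 ⟨hjk, Finset.mem_range.2 hj⟩)
  have := h.nonneg k hk j hj
  linarith [not_lt.1 h1]

/-- Multiplying by `1 - A k k` gives one identity for both kinds of pivot: in the degenerate case
both sides vanish. -/
theorem sum_pivotRow_mul (h : Substochastic C A) (hk : k < C) (x : ℕ → F) :
    (∑ j ∈ Finset.range C, pivotRow A k j * x j) * (1 - A k k) =
      (∑ j ∈ Finset.range C, A k j * x j) - A k k * x k := by
  rw [sum_pivotRow, ← sum_erase_mul hk]
  split_ifs with h1
  · rw [div_mul_cancel₀]
    exact (sub_pos.2 h1).ne'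
  · rw [Finset.sum_eq_zero]
    · simp
    · intro j hj
      rw [h.eq_zero hk h1 (Finset.mem_range.1 (Finset.mem_of_mem_erase hj))
        (Finset.ne_of_mem_erase hj), zero_mul]

theorem pivotRow_nonneg (h : Substochastic C A) (hk : k < C) {j : ℕ} (hj : j < C) :
    0 ≤ pivotRow A k j := by
  unfold pivotRow
  split_ifs with h1 h2
  · exact le_rfl
  · exact div_nonneg (h.nonneg k hk j hj) (sub_pos.2 h2).le
  · exact h.nonneg k hk j hj

theorem sum_pivotRow_le (h : Substochastic C A) (hk : k < C) :
    ∑ j ∈ Finset.range C, pivotRow A k j ≤ 1 := by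
  have h1 := sum_pivotRow (C := C) (A := A) (k := k) fun _ => 1
  have h2 := sum_erase_mul (A := A) hk k fun _ => 1
  have h3 := h.sum_le k hk
  simp only [mul_one] at h1 h2
  rw [h1, h2]
  split_ifs with h4
  · rw [div_le_one (sub_pos.2 h4)]
    linarith
  · rw [div_one]
    linarith [h.nonneg k hk k hk]

/-- Elimination replaces the weight `A s k` by that weight times the pivot row, whose sum is at most
1, so row sums cannot grow. -/
theorem elimStep (h : Substochastic C A) (hk : k < C) : Substochastic C (elimStep A k) := by
  refine ⟨fun s hs j hj => ?_, fun s hs => ?_⟩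
  · unfold _root_.elimStep
    split_ifs
    · exact h.pivotRow_nonneg hk hj
    · exact le_rfl
    · exact add_nonneg (h.nonneg s hs j hj) (mul_nonneg (h.nonneg s hs k hk)
        (h.pivotRow_nonneg hk hj))
  · by_cases hsk : s = k
    · subst hsk
      have := sum_elimStep_self (C := C) (A := A) (k := s) fun _ => 1
      simp only [mul_one] at this
      exact this ▸ h.sum_pivotRow_le hs
    · have := sum_elimStep_of_ne (A := A) hk hsk fun _ => 1
      simp only [mul_one] at this
      rw [this]
      have h1 := h.sum_le s hs
      have h2 := h.nonneg s hs k hk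
      nlinarith [mul_le_mul_of_nonneg_left (h.sum_pivotRow_le hk) h2]

theorem elim (h : Substochastic C A) (hk : k ≤ C) : Substochastic C (elim A k) := by
  induction k with
  | zero => exact h
  | succ k ih => exact (ih (Nat.le_of_succ_le hk)).elimStep hk

end Substochastic

/-- `x` is the least nonnegative solution of the equations `x s = ∑ j < C, A s j * x j` for
`s < N`, where the values `x j` with `N ≤ j` are given. -/
structure IsLeastSolution (N C : ℕ) (A : ℕ → ℕ → F) (x : ℕ → F) : Prop where
  nonneg : ∀ s < C, 0 ≤ x s
  eq : ∀ s < N, x s = ∑ j ∈ Finset.range C, A s j * x j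
  least : ∀ y : ℕ → F, (∀ s < C, 0 ≤ y s) → (∀ j, N ≤ j → y j = x j) →
    (∀ s < N, ∑ j ∈ Finset.range C, A s j * y j ≤ y s) → ∀ s < N, x s ≤ y s

/-- Leastness is always exploited by changing a single coordinate of a candidate solution; this is
the effect on one equation. -/
theorem sum_mul_update (hk : k < C) (s : ℕ) (y : ℕ → F) (p : F) :
    ∑ j ∈ Finset.range C, A s j * Function.update y k p j =
      (∑ j ∈ Finset.range C, A s j * y j) - A s k * y k + A s k * p := by
  rw [← sum_erase_mul hk, ← Finset.add_sum_erase _ _ (Finset.mem_range.2 hk), add_comm]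
  congr 1
  · refine Finset.sum_congr rfl fun j hj => ?_
    rw [Function.update_of_ne (Finset.ne_of_mem_erase hj)]
  · simp

/-! ### Least solutions under elimination -/

namespace IsLeastSolution

variable {x : ℕ → F}

/-- For a pivot below 1 this is the equation for `k`, solved for `x k`. For the pivot 1 the equation
only says `x k = x k`, and leastness forces `x k = 0`, which is also the value of the then vanishing
pivot row. -/
theorem sum_pivotRow_eq (h : IsLeastSolution N C A x) (hA : Substochastic C A) (hN : N ≤ C)
    (hk : k < N) : ∑ j ∈ Finset.range C, pivotRow A k j * x j = x k := by
  have hkC := hk.trans_le hN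
  have h1 := hA.sum_pivotRow_mul hkC x
  rw [← h.eq k hk] at h1
  by_cases h2 : A k k < 1
  · have h3 : x k - A k k * x k = x k * (1 - A k k) := by ring
    rw [h3] at h1
    exact mul_right_cancel₀ (sub_pos.2 h2).ne' h1
  · have hkk : A k k = 1 := le_antisymm (hA.le_one hkC hkC) (not_lt.1 h2)
    have hx0 : x k = 0 := by
      refine le_antisymm ?_ (h.nonneg k hkC)
      -- Resetting the coordinate `k` to 0 only decreases the right-hand sides and respects the
      -- equation for `k`, so the result is still a supersolution.
      have h3 := h.least (Function.update x k 0) (fun s hs => ?_) (fun j hj => ?_)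
        (fun s hs => ?_) k hk
      · simpa using h3
      · by_cases hsk : s = k
        · simp [hsk]
        · simpa [hsk] using h.nonneg s hs
      · exact Function.update_of_ne (by omega) _ _
      · rw [sum_mul_update hkC, ← h.eq s hs]
        by_cases hsk : s = k
        · subst hsk
          simp [hkk]
        · rw [Function.update_of_ne hsk]
          nlinarith [mul_nonneg (hA.nonneg s (hs.trans_le hN) k hkC) (h.nonneg k hkC)]
    rw [hx0]
    refine Finset.sum_eq_zero fun j hj => ?_
    by_cases hjk : j = k
    · simp [hjk, hx0]
    · rw [pivotRow, if_neg hjk, if_neg h2, hA.eq_zero hkC h2 (Finset.mem_range.1 hj) hjk, zero_mul]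

/-- That `x` solves the new system follows by substitution. For leastness, a supersolution of the
new system becomes one of the old system after lowering its coordinate `k` to the value that the
pivot row prescribes. -/
theorem elimStep (h : IsLeastSolution N C A x) (hA : Substochastic C A) (hN : N ≤ C)
    (hk : k < N) : IsLeastSolution N C (elimStep A k) x := by
  have hkC := hk.trans_le hN
  have hpx := h.sum_pivotRow_eq hA hN hk
  refine ⟨h.nonneg, fun s hs => ?_, fun y hy hyx hyA => ?_⟩
  · by_cases hsk : s = k
    · rw [hsk, sum_elimStep_self, hpx]
    · rw [sum_elimStep_of_ne hkC hsk, hpx, ← h.eq s hs]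
      ring
  · set p := ∑ j ∈ Finset.range C, pivotRow A k j * y j with hp
    have hp0 : 0 ≤ p := Finset.sum_nonneg fun j hj =>
      mul_nonneg (hA.pivotRow_nonneg hkC (Finset.mem_range.1 hj)) (hy j (Finset.mem_range.1 hj))
    have hpy : p ≤ y k := by
      have := hyA k hk
      rwa [sum_elimStep_self] at this
    -- With `p` in place of `y k`, the old equation for `k` holds exactly and every other row takes
    -- its eliminated form.
    have key := h.least (Function.update y k p) (fun s hs => ?_) (fun j hj => ?_) (fun s hs => ?_)
    · intro s hs
      refine (key s hs).trans ?_
      by_cases hsk : s = k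
      · simpa [hsk] using hpy
      · simp [hsk]
    · by_cases hsk : s = k
      · simpa [hsk] using hp0
      · simpa [hsk] using hy s hs
    · rw [Function.update_of_ne (by omega), hyx j hj]
    · rw [sum_mul_update hkC]
      by_cases hsk : s = k
      · subst hsk
        have := hA.sum_pivotRow_mul hkC y
        rw [← hp] at this
        rw [Function.update_self]
        linarith
      · have := hyA s hs
        rw [sum_elimStep_of_ne hkC hsk, ← hp] at this
        rwa [Function.update_of_ne hsk]

theorem elim (h : IsLeastSolution N C A x) (hA : Substochastic C A) (hN : N ≤ C) (hk : k ≤ N) :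
    IsLeastSolution N C (elim A k) x := by
  induction k with
  | zero => exact h
  | succ k ih =>
    exact (ih (Nat.le_of_succ_le hk)).elimStep (hA.elim ((Nat.le_of_succ_le hk).trans hN)) hN hk

end IsLeastSolution

/-- Step `k` clears column `k`, and later steps only add multiples of pivot rows whose entry there
is already 0. -/
theorem elim_eq_zero {s j : ℕ} (hj : j < k) : elim A k s j = 0 := by
  induction k generalizing s with
  | zero => exact absurd hj (Nat.not_lt_zero _)
  | succ k ih =>
    simp only [elim, elimStep, pivotRow]
    rcases Nat.lt_succ_iff_lt_or_eq.1 hj with h | h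
    · simp [ih h]
    · simp [h]

/-- A row that mentions no eliminated unknown receives only zero multiples of pivot rows. This keeps
the row of the absorbing goal intact. -/
theorem elim_row_eq {s : ℕ} (hs : N ≤ s) (h : ∀ j < N, A s j = 0) (hk : k ≤ N) (j : ℕ) :
    elim A k s j = A s j := by
  induction k generalizing j with
  | zero => rfl
  | succ k ih =>
    have ih' := ih (Nat.le_of_succ_le hk)
    simp only [elim, elimStep, if_neg (show s ≠ k by omega), ih', h k hk]
    split_ifs with hjk
    · rw [hjk, h k hk]
    · ring

/-- The least solution, after all unknowns have been eliminated. -/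
theorem IsLeastSolution.eq_sum_elim {x : ℕ → F} {R : ℕ} (h : IsLeastSolution N (N + R) A x)
    (hA : Substochastic (N + R) A) {s : ℕ} (hs : s < N) :
    x s = ∑ j ∈ Finset.range R, _root_.elim A N s (N + j) * x (N + j) := by
  rw [(h.elim hA (Nat.le_add_right _ _) le_rfl).eq s hs, Finset.sum_range_add,
    Finset.sum_eq_zero, zero_add]
  intro j hj
  rw [elim_eq_zero (Finset.mem_range.1 hj), zero_mul]

end Elimination

/-! ## Probabilities of bounded reachability -/

namespace MarkovChain

variable {n : ℕ} (M : MarkovChain n) (a b : AP)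

open Classical in
/-- The probability that, from state `s`, the formula `a U_{≤ r} b` is fulfilled within fewer
than `k` steps. -/
def stepProb : ℕ → Fin n → ℝ → ℝ
  | 0, _, _ => 0
  | k + 1, s, r =>
    if r < 0 then 0 else if b ∈ M.label s then 1 else
      if a ∈ M.label s then ∑ t, (M.prob s t : ℝ) * stepProb k t (r - M.rew s) else 0

/-- The paths that, from time `j` on, fulfil `a U_{≤ r} b` within fewer than `k` steps. -/
def untilFrom (j k : ℕ) (r : ℝ) : Set (ℕ → Fin n) :=
  {π | ∃ l < k, b ∈ M.label (π (j + l)) ∧ (∀ i < l, a ∈ M.label (π (j + i))) ∧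
    ((∑ i ∈ Finset.range l, M.rew (π (j + i)) : ℕ) : ℝ) ≤ r}

variable {M a b}

theorem measurableSet_untilFrom (j k : ℕ) (r : ℝ) : MeasurableSet (M.untilFrom a b j k r) := by
  have h : M.untilFrom a b j k r = ⋃ l ∈ Finset.range k, ({π | b ∈ M.label (π (j + l))} ∩
      ((⋂ i ∈ Finset.range l, {π | a ∈ M.label (π (j + i))}) ∩
        {π | ((∑ i ∈ Finset.range l, M.rew (π (j + i)) : ℕ) : ℝ) ≤ r})) := by
    ext π
    simp only [untilFrom, Set.mem_ofPred_eq, Set.mem_iUnion, Set.mem_inter_iff, Set.mem_iInter,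
      Finset.mem_range, exists_prop]
  rw [h]
  refine Finset.measurableSet_biUnion _ fun l _ => MeasurableSet.inter ?_ (MeasurableSet.inter
    (Finset.measurableSet_biInter _ fun i _ => ?_) ?_)
  · exact measurableSet_preimage (f := fun π : ℕ → Fin n => π (j + l))
      (measurable_pi_apply (j + l))
      (MeasurableSet.of_discrete (s := {s | b ∈ M.label s}))
  · exact measurableSet_preimage (f := fun π : ℕ → Fin n => π (j + i))
      (measurable_pi_apply (j + i))
      (MeasurableSet.of_discrete (s := {s | a ∈ M.label s}))
  · refine measurableSet_le ?_ measurable_const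
    push_cast
    refine Finset.measurable_sum _ fun i _ => ?_
    exact (Measurable.of_discrete (f := fun s => (M.rew s : ℝ))).comp (measurable_pi_apply (j + i))

theorem prob_nonneg' (s t : Fin n) : (0 : ℝ) ≤ M.prob s t := by exact_mod_cast M.prob_nonneg s t

theorem sum_prob' (s : Fin n) : ∑ t, (M.prob s t : ℝ) = 1 := by exact_mod_cast M.sum_prob s

theorem stepProb_nonneg (k : ℕ) (s : Fin n) (r : ℝ) : 0 ≤ M.stepProb a b k s r := by
  induction k generalizing s r with
  | zero => exact le_rfl
  | succ k ih =>
    unfold stepProb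
    split_ifs
    · exact le_rfl
    · exact zero_le_one
    · exact Finset.sum_nonneg fun t _ => mul_nonneg (prob_nonneg' s t) (ih t _)
    · exact le_rfl

theorem mem_untilFrom_succ {j k : ℕ} {r : ℝ} {π : ℕ → Fin n}
    (hb : b ∉ M.label (π j)) (ha : a ∈ M.label (π j)) :
    π ∈ M.untilFrom a b j (k + 1) r ↔ π ∈ M.untilFrom a b (j + 1) k (r - M.rew (π j)) := by
  constructor
  · rintro ⟨l, hl, h1, h2, h3⟩
    cases l with
    | zero => exact absurd h1 hb
    | succ l =>
      refine ⟨l, by omega, by rwa [show j + 1 + l = j + (l + 1) by ring], fun i hi => ?_, ?_⟩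
      · rw [show j + 1 + i = j + (i + 1) by ring]
        exact h2 _ (by omega)
      · rw [Finset.sum_range_succ'] at h3
        push_cast at h3 ⊢
        simp only [show ∀ i, j + 1 + i = j + (i + 1) by intro i; ring]
        simp only [add_zero] at h3
        linarith
  · rintro ⟨l, hl, h1, h2, h3⟩
    refine ⟨l + 1, by omega, by rwa [show j + (l + 1) = j + 1 + l by ring], fun i hi => ?_, ?_⟩
    · cases i with
      | zero => exact ha
      | succ i =>
        rw [show j + (i + 1) = j + 1 + i by ring]
        exact h2 _ (by omega)
    · rw [Finset.sum_range_succ']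
      push_cast at h3 ⊢
      simp only [show ∀ i, j + 1 + i = j + (i + 1) by intro i; ring] at h3
      simp only [add_zero]
      linarith

/-- The trajectory kernel restricted to the times up to `j` is the Dirac measure at the given
history. -/
theorem traj_ae_eq (j : ℕ) (h : (i : Finset.Iic j) → Fin n) :
    ∀ᵐ π ∂(Kernel.traj (X := fun _ => Fin n) M.historyKernel j h),
      π j = h ⟨j, Finset.mem_Iic.2 le_rfl⟩ := by
  have h1 := Kernel.traj_map_frestrictLe_of_le (X := fun _ => Fin n) (κ := M.historyKernel)
    (le_refl j)
  have h2 : (Kernel.traj (X := fun _ => Fin n) M.historyKernel j h).map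
      (Preorder.frestrictLe j) = Measure.dirac h := by
    rw [← Kernel.map_apply _ (Preorder.measurable_frestrictLe j), h1, Kernel.deterministic_apply]
    rfl
  have h3 : ∀ᵐ g ∂((Kernel.traj (X := fun _ => Fin n) M.historyKernel j h).map
      (Preorder.frestrictLe j)), g = h := by
    rw [h2, ae_dirac_eq]
    rfl
  filter_upwards [ae_of_ae_map (Preorder.measurable_frestrictLe j).aemeasurable h3] with π hπ
  rw [← hπ]
  rfl

/-- First-step analysis. The start time and the whole history are general, because after one step
the induction continues with the kernel started at time `j + 1`. -/
theorem traj_untilFrom (k j : ℕ) (h : (i : Finset.Iic j) → Fin n) (r : ℝ) :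
    Kernel.traj (X := fun _ => Fin n) M.historyKernel j h (M.untilFrom a b j k r) =
      ENNReal.ofReal (M.stepProb a b k (h ⟨j, Finset.mem_Iic.2 le_rfl⟩) r) := by
  induction k generalizing j h r with
  | zero => simp [untilFrom, stepProb]
  | succ k ih =>
    set s := h ⟨j, Finset.mem_Iic.2 le_rfl⟩ with hs
    have hae := traj_ae_eq (M := M) j h
    rw [← hs] at hae
    unfold stepProb
    split_ifs with hr hb ha
    · have : M.untilFrom a b j (k + 1) r = ∅ := by
        ext π
        simp only [untilFrom, Set.mem_ofPred_eq, Set.mem_empty_iff_false, iff_false]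
        rintro ⟨l, -, -, -, h3⟩
        exact absurd (h3.trans_lt hr) (not_lt.2 (Nat.cast_nonneg _))
      simp [this]
    · rw [ENNReal.ofReal_one, prob_compl_eq_zero_iff (measurableSet_untilFrom _ _ _) |>.1]
      refine measure_mono_null (fun π hπ => ?_) hae
      intro hπs
      refine hπ ⟨0, by omega, ?_, by simp, by simpa using not_lt.1 hr⟩
      have : π j = s := hπs
      simpa [this] using hb
    · have h1 : M.untilFrom a b j (k + 1) r =ᵐ[Kernel.traj (X := fun _ => Fin n)
          M.historyKernel j h] M.untilFrom a b (j + 1) k (r - M.rew s) := by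
        filter_upwards [hae] with π hπ
        refine propext ?_
        have := mem_untilFrom_succ (k := k) (π := π) (j := j) (r := r) (by rwa [hπ])
          (by rwa [hπ])
        rwa [hπ] at this
      -- The Markov property: the kernel from time `j` is one step followed by the kernel from time
      -- `j + 1`, to which the induction hypothesis applies.
      rw [measure_congr h1, ← Kernel.traj_comp_partialTraj (Nat.le_succ j),
        Kernel.comp_apply' _ _ _ (measurableSet_untilFrom _ _ _)]
      simp only [Nat.succ_eq_add_one, ih]
      have h2 := Kernel.map_partialTraj_succ_self (X := fun _ => Fin n) (κ := M.historyKernel) j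
      have h3 : ∫⁻ g, ENNReal.ofReal (M.stepProb a b k (g ⟨j + 1, Finset.mem_Iic.2 le_rfl⟩)
          (r - M.rew s)) ∂(Kernel.partialTraj (X := fun _ => Fin n) M.historyKernel j (j + 1) h) =
          ∫⁻ t, ENNReal.ofReal (M.stepProb a b k t (r - M.rew s)) ∂(M.historyKernel j h) := by
        rw [← h2, Kernel.map_apply _ (measurable_pi_apply _),
          lintegral_map Measurable.of_discrete (measurable_pi_apply _)]
      rw [h3, lintegral_fintype, ENNReal.ofReal_sum_of_nonneg
        fun t _ => mul_nonneg (prob_nonneg' s t) (stepProb_nonneg k t _)]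
      refine Finset.sum_congr rfl fun t _ => ?_
      rw [ENNReal.ofReal_mul (prob_nonneg' s t), mul_comm]
      congr 1
      change (M.stepPMF s).toMeasure {t} = _
      rw [PMF.toMeasure_apply_singleton _ _ (measurableSet_singleton t)]
      rfl
    · rw [ENNReal.ofReal_zero]
      refine measure_mono_null (fun π hπ => ?_) hae
      rintro (hπs : π j = s)
      obtain ⟨l, -, h1, h2, -⟩ := hπ
      cases l with
      | zero => exact hb (by simpa [hπs] using h1)
      | succ l => exact ha (by simpa [hπs] using h2 0 (by omega))

variable (M a b)

/-- The probability of `a U_{≤ r} b` from state `s`. -/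
def untilProb (s : Fin n) (r : ℝ) : ℝ := (M.pathMeasure s).real (M.untilLE a b r)

variable {M a b}

/-- Continuity of the measure from below: the formula is the increasing union, over the number of
steps, of its step-bounded versions. -/
theorem tendsto_stepProb (s : Fin n) (r : ℝ) :
    Filter.Tendsto (fun k => M.stepProb a b k s r) Filter.atTop (nhds (M.untilProb a b s r)) := by
  have hU : M.untilLE a b r = ⋃ k, M.untilFrom a b 0 k r := by
    ext π
    simp only [untilLE, untilFrom, Set.mem_ofPred_eq, Set.mem_iUnion, zero_add]
    exact ⟨fun ⟨l, h⟩ => ⟨l + 1, l, Nat.lt_succ_self l, h⟩, fun ⟨_, l, _, h⟩ => ⟨l, h⟩⟩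
  have hmono : Monotone fun k => M.untilFrom a b 0 k r :=
    fun k k' hk π ⟨l, hl, h⟩ => ⟨l, hl.trans_le hk, h⟩
  have : IsProbabilityMeasure (M.pathMeasure s) := by
    unfold pathMeasure
    infer_instance
  have h1 := tendsto_measure_iUnion_atTop (μ := M.pathMeasure s) hmono
  rw [← hU] at h1
  have h2 := (ENNReal.tendsto_toReal (measure_ne_top _ _)).comp h1
  refine h2.congr fun k => ?_
  change ((M.pathMeasure s) (M.untilFrom a b 0 k r)).toReal = _
  rw [pathMeasure, traj_untilFrom, ENNReal.toReal_ofReal (stepProb_nonneg _ _ _)]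

end MarkovChain

open Filter Topology

namespace MarkovChain

variable {n : ℕ} {M : MarkovChain n} {a b : AP}

/-! ## Monotonicity and fixed point equations -/

theorem sum_prob_mul_le {f : Fin n → ℝ} {z : ℝ} (s : Fin n) (h : ∀ t, f t ≤ z) :
    ∑ t, (M.prob s t : ℝ) * f t ≤ z := by
  calc ∑ t, (M.prob s t : ℝ) * f t ≤ ∑ t, (M.prob s t : ℝ) * z :=
        Finset.sum_le_sum fun t _ => mul_le_mul_of_nonneg_left (h t) (prob_nonneg' s t)
    _ = z := by rw [← Finset.sum_mul, sum_prob', one_mul]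

theorem sum_prob_mul_mono {f g : Fin n → ℝ} (s : Fin n) (h : ∀ t, f t ≤ g t) :
    ∑ t, (M.prob s t : ℝ) * f t ≤ ∑ t, (M.prob s t : ℝ) * g t :=
  Finset.sum_le_sum fun t _ => mul_le_mul_of_nonneg_left (h t) (prob_nonneg' s t)

theorem stepProb_le_succ (k : ℕ) (s : Fin n) (r : ℝ) :
    M.stepProb a b k s r ≤ M.stepProb a b (k + 1) s r := by
  induction k generalizing s r with
  | zero => exact stepProb_nonneg _ _ _
  | succ k ih =>
    rw [stepProb, stepProb]
    split_ifs
    · exact le_rfl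
    · exact le_rfl
    · exact sum_prob_mul_mono s fun t => ih t _
    · exact le_rfl

theorem stepProb_mono_right (k : ℕ) (s : Fin n) {r r' : ℝ} (h : r ≤ r') :
    M.stepProb a b k s r ≤ M.stepProb a b k s r' := by
  induction k generalizing s r r' with
  | zero => exact le_rfl
  | succ k ih =>
    rw [stepProb, stepProb]
    split_ifs with h1
    · exact le_rfl
    · exact zero_le_one
    · exact Finset.sum_nonneg fun t _ => mul_nonneg (prob_nonneg' s t) (stepProb_nonneg k t _)
    · exact le_rfl
    · exact absurd (h.trans_lt (by assumption)) h1
    · exact le_rfl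
    · exact absurd (h.trans_lt (by assumption)) h1
    · exact sum_prob_mul_mono s fun t => ih t (by linarith)
    · exact absurd (h.trans_lt (by assumption)) h1
    · exact le_rfl

theorem stepProb_le_untilProb (k : ℕ) (s : Fin n) (r : ℝ) :
    M.stepProb a b k s r ≤ M.untilProb a b s r :=
  (monotone_nat_of_le_succ fun k => stepProb_le_succ k s r).ge_of_tendsto
    (tendsto_stepProb s r) k

theorem untilProb_nonneg (s : Fin n) (r : ℝ) : 0 ≤ M.untilProb a b s r := measureReal_nonneg

theorem untilProb_mono (s : Fin n) {r r' : ℝ} (h : r ≤ r') :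
    M.untilProb a b s r ≤ M.untilProb a b s r' :=
  le_of_tendsto_of_tendsto' (tendsto_stepProb s r) (tendsto_stepProb s r')
    fun k => stepProb_mono_right k s h

open Classical in
theorem untilProb_eq (s : Fin n) (r : ℝ) : M.untilProb a b s r =
    if r < 0 then 0 else if b ∈ M.label s then 1 else
      if a ∈ M.label s then ∑ t, (M.prob s t : ℝ) * M.untilProb a b t (r - M.rew s) else 0 := by
  refine tendsto_nhds_unique ((tendsto_stepProb s r).comp (tendsto_add_atTop_nat 1)) ?_
  simp only [Function.comp_def, stepProb]
  split_ifs
  · exact tendsto_const_nhds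
  · exact tendsto_const_nhds
  · exact tendsto_finsetSum _ fun t _ => (tendsto_stepProb t _).const_mul _
  · exact tendsto_const_nhds

theorem untilProb_of_neg (s : Fin n) {r : ℝ} (h : r < 0) : M.untilProb a b s r = 0 := by
  rw [untilProb_eq, if_pos h]

/-- Accumulated rewards are natural numbers, so only the integer part of the bound matters; this
makes finite values integers. -/
theorem untilProb_floor (s : Fin n) {r : ℝ} (h : 0 ≤ r) :
    M.untilProb a b s r = M.untilProb a b s (⌊r⌋₊ : ℝ) := by
  unfold untilProb
  congr 1
  ext π
  simp only [untilLE, Set.mem_ofPred_eq, Nat.cast_le, ← Nat.le_floor_iff h]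

/-! ## Unbounded reachability -/

variable (M a b) in
open Classical in
/-- The probability to fulfil `a U b` from state `s` within fewer than `k` steps. -/
def reachStep : ℕ → Fin n → ℝ
  | 0, _ => 0
  | k + 1, s => if b ∈ M.label s then 1 else
      if a ∈ M.label s then ∑ t, (M.prob s t : ℝ) * reachStep k t else 0

theorem reachStep_nonneg (k : ℕ) (s : Fin n) : 0 ≤ M.reachStep a b k s := by
  induction k generalizing s with
  | zero => exact le_rfl
  | succ k ih =>
    unfold reachStep
    split_ifs
    · exact zero_le_one
    · exact Finset.sum_nonneg fun t _ => mul_nonneg (prob_nonneg' s t) (ih t)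
    · exact le_rfl

theorem reachStep_le_one (k : ℕ) (s : Fin n) : M.reachStep a b k s ≤ 1 := by
  induction k generalizing s with
  | zero => exact zero_le_one
  | succ k ih =>
    unfold reachStep
    split_ifs
    · exact le_rfl
    · exact sum_prob_mul_le s ih
    · exact zero_le_one

theorem reachStep_le_succ (k : ℕ) (s : Fin n) :
    M.reachStep a b k s ≤ M.reachStep a b (k + 1) s := by
  induction k generalizing s with
  | zero => exact reachStep_nonneg _ _
  | succ k ih =>
    rw [reachStep, reachStep]
    split_ifs
    · exact le_rfl
    · exact sum_prob_mul_mono s ih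
    · exact le_rfl

theorem stepProb_le_reachStep (k : ℕ) (s : Fin n) (r : ℝ) :
    M.stepProb a b k s r ≤ M.reachStep a b k s := by
  induction k generalizing s r with
  | zero => exact le_rfl
  | succ k ih =>
    rw [stepProb]
    split_ifs with h1 h2 h3
    · exact reachStep_nonneg _ _
    · rw [reachStep, if_pos h2]
    · rw [reachStep, if_neg h2, if_pos h3]
      exact sum_prob_mul_mono s fun t => ih t _
    · exact reachStep_nonneg _ _

/-- Within `k` steps at most `c * k` is earned, so such a reward bound is no restriction. A bound on
steps thus becomes a bound on rewards. -/
theorem reachStep_le_stepProb {c : ℕ} (hc : ∀ s, M.rew s ≤ c) (k : ℕ) (s : Fin n) {r : ℝ}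
    (hr : (c * k : ℕ) ≤ r) : M.reachStep a b k s ≤ M.stepProb a b k s r := by
  induction k generalizing s r with
  | zero => exact le_rfl
  | succ k ih =>
    have hr0 : ¬ r < 0 := not_lt.2 ((Nat.cast_nonneg _).trans hr)
    rw [stepProb, reachStep, if_neg hr0]
    split_ifs
    · exact le_rfl
    · refine sum_prob_mul_mono s fun t => ih t ?_
      have h1 : (M.rew s : ℝ) ≤ c := by exact_mod_cast hc s
      push_cast at hr ⊢
      linarith
    · exact le_rfl

variable (M a b) in
/-- The probability of `a U b` from state `s`. -/
def reachProb (s : Fin n) : ℝ := ⨆ k, M.reachStep a b k s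

theorem tendsto_reachStep (s : Fin n) :
    Tendsto (fun k => M.reachStep a b k s) atTop (𝓝 (M.reachProb a b s)) :=
  tendsto_atTop_ciSup (monotone_nat_of_le_succ fun k => reachStep_le_succ k s)
    ⟨1, by rintro _ ⟨k, rfl⟩; exact reachStep_le_one k s⟩

theorem reachStep_le_reachProb (k : ℕ) (s : Fin n) : M.reachStep a b k s ≤ M.reachProb a b s :=
  (monotone_nat_of_le_succ fun k => reachStep_le_succ k s).ge_of_tendsto (tendsto_reachStep s) k

theorem reachProb_nonneg (s : Fin n) : 0 ≤ M.reachProb a b s :=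
  (reachStep_nonneg 0 s).trans (reachStep_le_reachProb 0 s)

theorem reachProb_le_one (s : Fin n) : M.reachProb a b s ≤ 1 :=
  le_of_tendsto' (tendsto_reachStep s) fun k => reachStep_le_one k s

open Classical in
theorem reachProb_eq (s : Fin n) : M.reachProb a b s =
    if b ∈ M.label s then 1 else
      if a ∈ M.label s then ∑ t, (M.prob s t : ℝ) * M.reachProb a b t else 0 := by
  refine tendsto_nhds_unique ((tendsto_reachStep s).comp (tendsto_add_atTop_nat 1)) ?_
  simp only [Function.comp_def, reachStep]
  split_ifs
  · exact tendsto_const_nhds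
  · exact tendsto_finsetSum _ fun t _ => (tendsto_reachStep t).const_mul _
  · exact tendsto_const_nhds

theorem untilProb_le_reachProb (s : Fin n) (r : ℝ) : M.untilProb a b s r ≤ M.reachProb a b s :=
  le_of_tendsto' (tendsto_stepProb s r) fun k =>
    (stepProb_le_reachStep k s r).trans (reachStep_le_reachProb k s)

theorem reachStep_le_untilProb {c : ℕ} (hc : ∀ s, M.rew s ≤ c) (k : ℕ) (s : Fin n) {r : ℝ}
    (hr : (c * k : ℕ) ≤ r) : M.reachStep a b k s ≤ M.untilProb a b s r :=
  (reachStep_le_stepProb hc k s hr).trans (stepProb_le_untilProb k s r)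

theorem tendsto_untilProb (s : Fin n) :
    Tendsto (fun r : ℝ => M.untilProb a b s r) atTop (𝓝 (M.reachProb a b s)) := by
  refine tendsto_order.2 ⟨fun z hz => ?_, fun z hz => Eventually.of_forall fun r =>
    (untilProb_le_reachProb s r).trans_lt hz⟩
  obtain ⟨k, hk⟩ := ((tendsto_order.1 (tendsto_reachStep s)).1 z hz).exists
  filter_upwards [eventually_ge_atTop (((M.maxReward * k : ℕ) : ℝ))] with r hr
  exact hk.trans_le
    (reachStep_le_untilProb (fun s => Finset.le_sup (f := M.rew) (Finset.mem_univ s)) k s hr)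

/-! ## The chain with unit rewards

State `s * c + i`, where `i < c`, stands for state `s`, with reward `i` still to be earned before
it is entered. -/

section Expanded

variable (M a b) in
/-- The probability of `a U_{≤ k - 1} b` from state `q` of the chain with unit rewards. -/
def unitProb (c k q : ℕ) : ℝ :=
  if h : q / c < n then M.untilProb a b ⟨q / c, h⟩ ((k : ℝ) - 1 - (q % c : ℕ)) else 0

variable (M a b) in
/-- The probability of `a U b` from state `q` of the chain with unit rewards. -/
def unitReach (c q : ℕ) : ℝ := if h : q / c < n then M.reachProb a b ⟨q / c, h⟩ else 0

variable {c : ℕ}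

theorem unitProb_mul_add (k : ℕ) (s : Fin n) {i : ℕ} (hi : i < c) :
    M.unitProb a b c k (s * c + i) = M.untilProb a b s ((k : ℝ) - 1 - i) := by
  have hc : 0 < c := by omega
  have h1 : ((s : ℕ) * c + i) / c = s := by
    rw [mul_comm, Nat.mul_add_div hc, Nat.div_eq_of_lt hi, add_zero]
  have h2 : ((s : ℕ) * c + i) % c = i := by
    rw [mul_comm, Nat.mul_add_mod, Nat.mod_eq_of_lt hi]
  rw [unitProb, dif_pos (by rw [h1]; exact s.2)]
  simp only [h1, h2]

theorem unitReach_mul_add (s : Fin n) {i : ℕ} (hi : i < c) :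
    M.unitReach a b c (s * c + i) = M.reachProb a b s := by
  have hc : 0 < c := by omega
  have h1 : ((s : ℕ) * c + i) / c = s := by
    rw [mul_comm, Nat.mul_add_div hc, Nat.div_eq_of_lt hi, add_zero]
  rw [unitReach, dif_pos (by rw [h1]; exact s.2)]
  simp only [h1]

/-- The bound is shifted by one in `unitProb` precisely so that level 0 is the zero vector, which
matches the zeroth power of the reduced matrix. -/
theorem unitProb_zero (q : ℕ) : M.unitProb a b c 0 q = 0 := by
  unfold unitProb
  split_ifs
  · exact untilProb_of_neg _ (by
      have : (0 : ℝ) ≤ (q % c : ℕ) := Nat.cast_nonneg _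
      push_cast
      linarith)
  · rfl

theorem unitProb_nonneg (k q : ℕ) : 0 ≤ M.unitProb a b c k q := by
  unfold unitProb
  split_ifs
  · exact untilProb_nonneg _ _
  · exact le_rfl

theorem unitProb_mono (q : ℕ) : Monotone fun k => M.unitProb a b c k q := by
  intro k k' h
  dsimp only [unitProb]
  split_ifs
  · refine untilProb_mono _ ?_
    have : (k : ℝ) ≤ k' := by exact_mod_cast h
    linarith
  · exact le_rfl

theorem tendsto_unitProb (q : ℕ) :
    Tendsto (fun k => M.unitProb a b c k q) atTop (𝓝 (M.unitReach a b c q)) := by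
  unfold unitProb unitReach
  split_ifs with h
  · refine (tendsto_untilProb _).comp ?_
    simp only [sub_eq_add_neg, add_assoc]
    exact tendsto_atTop_add_const_right _ _ tendsto_natCast_atTop_atTop
  · exact tendsto_const_nhds

theorem exists_eq_mul_add {q : ℕ} (hq : q < n * c) :
    ∃ (s : Fin n) (i : ℕ), i < c ∧ q = s * c + i := by
  have hc : 0 < c := Nat.pos_of_ne_zero fun h => by simp [h] at hq
  exact ⟨⟨q / c, (Nat.div_lt_iff_lt_mul hc).2 hq⟩, q % c, Nat.mod_lt _ hc,
    by rw [mul_comm]; exact (Nat.div_add_mod q c).symm⟩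

theorem mul_add_lt (s : Fin n) {i : ℕ} (hi : i < c) : (s : ℕ) * c + i < n * c := by
  calc (s : ℕ) * c + i < s * c + c := by omega
    _ = (s + 1) * c := by ring
    _ ≤ n * c := Nat.mul_le_mul_right _ s.2

variable (M a b c) in
open Classical in
/-- The equation for state `s * c + i`; the unknowns for the same reward, the values for the
reward smaller by one, and the constant `1` are at the positions `0 ≤ j < n * c`,
`n * c ≤ j < 2 * n * c` and `j = 2 * n * c` of `x`. -/
def unitRow (s : Fin n) (i : ℕ) (x : ℕ → ℝ) : ℝ :=
  if 0 < i then x (n * c + (s * c + (i - 1)))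
  else if b ∈ M.label s then x (n * c + n * c)
  else if a ∈ M.label s then
    if M.rew s = 0 then ∑ t : Fin n, (M.prob s t : ℝ) * x (t * c)
    else ∑ t : Fin n, (M.prob s t : ℝ) * x (n * c + (t * c + (M.rew s - 1)))
  else 0

variable (M a b c) in
/-- `A` is the coefficient matrix of the equations `unitRow`. -/
structure IsUnitMatrix (A : ℕ → ℕ → ℚ) : Prop where
  nonneg : ∀ s < n * c + (n * c + 1), ∀ j < n * c + (n * c + 1), 0 ≤ A s j
  row : ∀ (s : Fin n), ∀ i < c, ∀ x : ℕ → ℝ,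
    ∑ j ∈ Finset.range (n * c + (n * c + 1)), (A (s * c + i) j : ℝ) * x j = M.unitRow a b c s i x
  last : ∀ j < n * c + (n * c + 1), A (n * c) j = if j = n * c + n * c then 1 else 0
  zero : ∀ s, n * c < s → s < n * c + (n * c + 1) → ∀ j < n * c + (n * c + 1), A s j = 0

variable (M a b c) in
/-- The values of `unitRow`, for the reward `k`. -/
def unitVec (k j : ℕ) : ℝ :=
  if j < n * c then M.unitProb a b c (k + 1) j
  else if j < n * c + n * c then M.unitProb a b c k (j - n * c) else 1

namespace IsUnitMatrix

variable {A : ℕ → ℕ → ℚ}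

theorem substochastic (h : M.IsUnitMatrix a b c A) :
    Substochastic (n * c + (n * c + 1)) A := by
  refine ⟨h.nonneg, fun q hq => ?_⟩
  rcases lt_trichotomy q (n * c) with hq' | hq' | hq'
  · obtain ⟨s, i, hi, rfl⟩ := exists_eq_mul_add hq'
    have h1 := h.row s i hi fun _ => 1
    simp only [mul_one] at h1
    have h2 : M.unitRow a b c s i (fun _ => 1) ≤ 1 := by
      unfold unitRow
      simp only [mul_one, sum_prob']
      split_ifs <;> norm_num
    rw [← h1] at h2
    exact_mod_cast h2
  · subst hq'
    rw [Finset.sum_congr rfl fun j hj => h.last j (Finset.mem_range.1 hj)]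
    simp
  · rw [Finset.sum_eq_zero fun j hj => h.zero q hq' hq j (Finset.mem_range.1 hj)]
    exact zero_le_one

theorem substochastic' (h : M.IsUnitMatrix a b c A) :
    Substochastic (n * c + (n * c + 1)) fun s j => (A s j : ℝ) :=
  ⟨fun s hs j hj => by exact_mod_cast h.substochastic.nonneg s hs j hj,
    fun s hs => by exact_mod_cast h.substochastic.sum_le s hs⟩

/-- A waiting copy (`i > 0`) pays one unit and drops one level. A copy with `i = 0` makes a real
step: without reward it stays on its level; with reward r ≥ 1 it pays one unit at once and enters
copy r - 1 of the successor. -/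
theorem _root_.MarkovChain.unitRow_unitVec (hrew : ∀ s, M.rew s ≤ c) (k : ℕ) (s : Fin n) {i : ℕ}
    (hi : i < c) :
    M.unitRow a b c s i (M.unitVec a b c k) = M.unitProb a b c (k + 1) (s * c + i) := by
  have hs : ∀ (t : Fin n) (i : ℕ), i < c →
      M.unitVec a b c k (n * c + (t * c + i)) = M.untilProb a b t ((k : ℝ) - 1 - i) := by
    intro t i hi
    have := mul_add_lt t hi
    rw [unitVec, if_neg (by omega), if_pos (by omega), Nat.add_sub_cancel_left,
      unitProb_mul_add k t hi]
  have hc : 0 < c := by omega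
  rw [unitProb_mul_add _ s hi, unitRow]
  split_ifs with h1 h2 h3 h4
  · rw [hs s (i - 1) (by omega)]
    push_cast [h1]
    congr 1
    ring
  · have hi0 : i = 0 := by omega
    rw [untilProb_eq, if_neg, if_pos h2, unitVec, if_neg (by omega), if_neg (by omega)]
    simp [hi0]
  · have hi0 : i = 0 := by omega
    subst hi0
    rw [untilProb_eq, if_neg (by simp), if_neg h2, if_pos h3]
    refine Finset.sum_congr rfl fun t _ => ?_
    have := mul_add_lt t hc
    have h5 := unitProb_mul_add (M := M) (a := a) (b := b) (k + 1) t hc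
    rw [add_zero] at h5 this
    rw [unitVec, if_pos this, h5, h4]
    simp
  · have hi0 : i = 0 := by omega
    subst hi0
    rw [untilProb_eq, if_neg (by simp), if_neg h2, if_pos h3]
    refine Finset.sum_congr rfl fun t _ => ?_
    have hr := hrew s
    rw [hs t _ (by omega), Nat.cast_sub (by omega)]
    congr 2
    push_cast
    ring
  · have hi0 : i = 0 := by omega
    subst hi0
    rw [untilProb_eq, if_neg (by simp), if_neg h2, if_neg h3]

/-- The equations are first-step analysis. Leastness cannot come from uniqueness, because of cycles
without reward; instead, every supersolution dominates the step-bounded probabilities, by induction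
on the number of steps, and hence their limit. -/
theorem isLeastSolution (h : M.IsUnitMatrix a b c A) (hc : 0 < c) (hrew : ∀ s, M.rew s ≤ c)
    (k : ℕ) : IsLeastSolution (n * c) (n * c + (n * c + 1)) (fun s j => (A s j : ℝ))
      (M.unitVec a b c k) := by
  refine ⟨fun j _ => ?_, fun q hq => ?_, fun y hy hyx hyA q hq => ?_⟩
  · unfold unitVec
    split_ifs
    · exact unitProb_nonneg _ _
    · exact unitProb_nonneg _ _
    · exact zero_le_one
  · obtain ⟨s, i, hi, rfl⟩ := exists_eq_mul_add hq
    rw [h.row s i hi, unitRow_unitVec hrew k s hi, unitVec, if_pos hq]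
  · have hrow : ∀ (s : Fin n) (i : ℕ), i < c → M.unitRow a b c s i y ≤ y (s * c + i) := by
      intro s i hi
      rw [← h.row s i hi]
      exact hyA _ (mul_add_lt s hi)
    obtain ⟨s, i, hi, rfl⟩ := exists_eq_mul_add hq
    rw [unitVec, if_pos hq]
    rcases Nat.eq_zero_or_pos i with hi0 | hi0
    · subst hi0
      rw [unitProb_mul_add _ s hi]
      -- Only copies with `i = 0` need the induction on steps: transitions with reward lead to given
      -- values, where the step-bounded probability is below the full one.
      refine le_of_tendsto' (tendsto_stepProb s _) fun l => ?_
      rw [add_zero]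
      clear hq
      induction l generalizing s with
      | zero =>
        have := mul_add_lt s hc
        exact hy _ (by omega)
      | succ l ih =>
        have h1 := hrow s 0 hc
        rw [unitRow, if_neg (lt_irrefl 0), add_zero] at h1
        rw [stepProb, if_neg (by simp)]
        refine le_trans ?_ h1
        split_ifs with h2 h3 h4
        · rw [hyx _ (by omega), unitVec, if_neg (by omega), if_neg (by omega)]
        · refine sum_prob_mul_mono s fun t => ?_
          have := ih t
          simpa [h4] using this
        · refine sum_prob_mul_mono s fun t => ?_
          have hr := hrew s
          have h5 : M.rew s - 1 < c := by omega
          have h6 := mul_add_lt t h5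
          rw [hyx _ (by omega), unitVec, if_neg (by omega), if_pos (by omega),
            Nat.add_sub_cancel_left, unitProb_mul_add k t h5]
          refine (stepProb_le_untilProb _ _ _).trans (le_of_eq ?_)
          rw [Nat.cast_sub (by omega)]
          congr 1
          push_cast
          ring
        · exact le_rfl
    · refine le_trans (le_of_eq ?_) (hrow s i hi)
      rw [← unitRow_unitVec hrew k s hi, unitRow, unitRow, if_pos hi0, if_pos hi0, hyx _ (by omega)]

end IsUnitMatrix

end Expanded

end MarkovChain

namespace MarkovChain

variable {n : ℕ} {M : MarkovChain n} {a b : AP} {c : ℕ}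

/-! ## The reduced chain -/

/-- The transition matrix of the chain with unit rewards after the elimination of the transitions
without reward. The last state is the absorbing goal. -/
def reduced (A : ℕ → ℕ → ℚ) (N : ℕ) (i j : ℕ) : ℚ := elim A N i (N + j)

/-- The first `K` rows and columns of `A`, as a matrix. -/
def toMatrix (K : ℕ) (A : ℕ → ℕ → ℚ) : Matrix (Fin K) (Fin K) ℚ := Matrix.of fun i j => A i j

namespace IsUnitMatrix

variable {A : ℕ → ℕ → ℚ}

/-- Row `n * c` lies outside the equations and is used to store the row of the goal. It mentions no
unknown, so elimination leaves it alone. -/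
theorem reduced_last (h : M.IsUnitMatrix a b c A) {j : ℕ} (hj : j < n * c + 1) :
    reduced A (n * c) (n * c) j = if j = n * c then 1 else 0 := by
  rw [reduced, elim_row_eq le_rfl (fun j hj => ?_) le_rfl, h.last _ (by omega)]
  · simp
  · rw [h.last _ (by omega), if_neg (by omega)]

theorem reduced_substochastic (h : M.IsUnitMatrix a b c A) :
    Substochastic (n * c + 1) (reduced A (n * c)) := by
  have h1 := h.substochastic.elim (Nat.le_add_right (n * c) (n * c + 1))
  refine ⟨fun s hs j hj => h1.nonneg s (by omega) _ (by omega), fun s hs => ?_⟩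
  have h2 := h1.sum_le s (by omega)
  rw [Finset.sum_range_add] at h2
  have h3 : 0 ≤ ∑ j ∈ Finset.range (n * c), elim A (n * c) s j := by
    refine Finset.sum_nonneg fun j hj => h1.nonneg s (by omega) j ?_
    have := Finset.mem_range.1 hj
    omega
  unfold reduced
  linarith

/-- After all unknowns of level `k + 1` are eliminated, only level `k` and the constant remain, with
coefficients independent of `k`. -/
theorem unitProb_succ (h : M.IsUnitMatrix a b c A) (hc : 0 < c) (hrew : ∀ s, M.rew s ≤ c)
    (k : ℕ) {q : ℕ} (hq : q < n * c) : M.unitProb a b c (k + 1) q =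
      ∑ j ∈ Finset.range (n * c + 1), (reduced A (n * c) q j : ℝ) *
        (if j < n * c then M.unitProb a b c k j else 1) := by
  have h1 := (h.isLeastSolution hc hrew k).eq_sum_elim h.substochastic' hq
  rw [unitVec, if_pos hq] at h1
  rw [h1]
  refine Finset.sum_congr rfl fun j hj => ?_
  rw [reduced, elim_ratCast, unitVec, if_neg (by omega), Nat.add_sub_cancel_left]
  have := Finset.mem_range.1 hj
  congr 1
  exact if_congr (by omega) rfl rfl

theorem pow_last (h : M.IsUnitMatrix a b c A) (k : ℕ) :
    (toMatrix (n * c + 1) (reduced A (n * c)) ^ k) (Fin.last _) (Fin.last _) = 1 := by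
  induction k with
  | zero => simp
  | succ k ih =>
    rw [pow_succ', Matrix.mul_apply, Finset.sum_eq_single (Fin.last _)]
    · rw [ih, toMatrix, Matrix.of_apply, Fin.val_last, h.reduced_last (Nat.lt_succ_self _)]
      simp
    · intro j _ hj
      rw [toMatrix, Matrix.of_apply, Fin.val_last, h.reduced_last j.2, if_neg, zero_mul]
      exact fun h => hj (Fin.ext h)
    · simp

/-- The powers of the reduced transition matrix contain the probabilities. -/
theorem pow_apply (h : M.IsUnitMatrix a b c A) (hc : 0 < c) (hrew : ∀ s, M.rew s ≤ c)
    (k : ℕ) (q : Fin (n * c + 1)) (hq : (q : ℕ) < n * c) :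
    (((toMatrix (n * c + 1) (reduced A (n * c)) ^ k) q (Fin.last _) : ℚ) : ℝ) =
      M.unitProb a b c k q := by
  induction k generalizing q with
  | zero =>
    rw [unitProb_zero, pow_zero, Matrix.one_apply_ne, Rat.cast_zero]
    exact fun h => by simp [h] at hq
  | succ k ih =>
    rw [h.unitProb_succ hc hrew k hq, pow_succ', Matrix.mul_apply, Finset.sum_range]
    push_cast
    refine Finset.sum_congr rfl fun j _ => ?_
    rw [toMatrix, Matrix.of_apply]
    congr 1
    split_ifs with hj
    · exact ih j hj
    · have : j = Fin.last _ := Fin.ext (by simp; omega)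
      rw [this]
      exact_mod_cast h.pow_last k

theorem unitReach_eq (h : M.IsUnitMatrix a b c A) (hc : 0 < c) (hrew : ∀ s, M.rew s ≤ c)
    {q : ℕ} (hq : q < n * c) : M.unitReach a b c q =
      ∑ j ∈ Finset.range (n * c + 1), (reduced A (n * c) q j : ℝ) *
        (if j < n * c then M.unitReach a b c j else 1) := by
  refine tendsto_nhds_unique ((tendsto_unitProb q).comp (tendsto_add_atTop_nat 1)) ?_
  simp only [Function.comp_def, h.unitProb_succ hc hrew _ hq]
  refine tendsto_finsetSum _ fun j _ => Tendsto.const_mul _ ?_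
  split_ifs
  · exact tendsto_unitProb j
  · exact tendsto_const_nhds

/-- The equation is the limit of the recursion over the levels. A supersolution dominates every
level by induction, starting from the zero vector, hence also the limit. So a second elimination
yields the unbounded probabilities. -/
theorem unitReach_isLeastSolution (h : M.IsUnitMatrix a b c A) (hc : 0 < c)
    (hrew : ∀ s, M.rew s ≤ c) :
    IsLeastSolution (n * c) (n * c + 1) (fun i j => (reduced A (n * c) i j : ℝ))
      (fun j => if j < n * c then M.unitReach a b c j else 1) := by
  have hnn : ∀ q, 0 ≤ M.unitReach a b c q := fun q =>
    ge_of_tendsto' (tendsto_unitProb q) fun k => unitProb_nonneg k q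
  refine ⟨fun s _ => ?_, fun s hs => ?_, fun y hy hyx hyA s hs => ?_⟩
  · split_ifs
    · exact hnn s
    · exact zero_le_one
  · rw [if_pos hs]
    exact h.unitReach_eq hc hrew hs
  · rw [if_pos hs]
    refine le_of_tendsto' (tendsto_unitProb s) fun k => ?_
    induction k generalizing s with
    | zero =>
      rw [unitProb_zero]
      exact hy s (by omega)
    | succ k ih =>
      rw [h.unitProb_succ hc hrew k hs]
      refine (Finset.sum_le_sum fun j hj => mul_le_mul_of_nonneg_left ?_ ?_).trans (hyA s hs)
      · have := Finset.mem_range.1 hj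
        split_ifs with hj'
        · exact ih j hj'
        · rw [hyx j (by omega), if_neg hj']
      · exact_mod_cast h.reduced_substochastic.nonneg s (by omega) j (Finset.mem_range.1 hj)

theorem unitReach_eq_elim (h : M.IsUnitMatrix a b c A) (hc : 0 < c) (hrew : ∀ s, M.rew s ≤ c)
    {q : ℕ} (hq : q < n * c) :
    M.unitReach a b c q = (elim (reduced A (n * c)) (n * c) q (n * c) : ℚ) := by
  have hs := h.reduced_substochastic
  have h1 := (h.unitReach_isLeastSolution hc hrew).eq_sum_elim
    ⟨fun s hs' j hj => by exact_mod_cast hs.nonneg s hs' j hj,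
      fun s hs' => by exact_mod_cast hs.sum_le s hs'⟩ hq
  rw [elim_ratCast]
  simpa [hq] using h1

/-- If the probability of `a U b` is attained by the probability for some bound, then it is
attained for the bound `n * c`. -/
theorem unitProb_eq_unitReach (h : M.IsUnitMatrix a b c A) (hc : 0 < c)
    (hrew : ∀ s, M.rew s ≤ c) {q k : ℕ} (hq : q < n * c)
    (hk : M.unitProb a b c k q = M.unitReach a b c q) {l : ℕ} (hl : n * c ≤ l) :
    M.unitProb a b c l q = M.unitReach a b c q := by
  classical
  -- `T k` consists of the states at which the limit is not yet attained at level `k`.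
  set T : ℕ → Finset ℕ := fun k =>
    (Finset.range (n * c)).filter fun q => M.unitProb a b c k q ≠ M.unitReach a b c q with hT
  have hle : ∀ k q, M.unitProb a b c k q ≤ M.unitReach a b c q := fun k q =>
    (unitProb_mono q).ge_of_tendsto (tendsto_unitProb q) k
  have hanti : Antitone T := by
    intro k k' hkk' q hq
    simp only [hT, Finset.mem_filter] at hq ⊢
    exact ⟨hq.1, fun he => hq.2 (le_antisymm (hle _ _) (he ▸ unitProb_mono q hkk'))⟩
  -- The sum at level `k` is termwise at most the limiting sum, so equality fails exactly if it
  -- fails in a term with nonzero coefficient. Thus `T k` determines `T (k + 1)`.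
  have hsucc : ∀ k q, q ∈ T (k + 1) ↔
      q < n * c ∧ ∃ j ∈ T k, reduced A (n * c) q j ≠ 0 := by
    intro k q
    simp only [hT, Finset.mem_filter, Finset.mem_range, and_congr_right_iff]
    intro hq
    rw [h.unitProb_succ hc hrew k hq, h.unitReach_eq hc hrew hq, ne_eq,
      Finset.sum_eq_sum_iff_of_le]
    · push Not
      constructor
      · rintro ⟨j, hj, hne⟩
        have hj' : j < n * c := by
          by_contra hj'
          simp [hj'] at hne
        simp only [if_pos hj'] at hne
        refine ⟨j, ⟨hj', fun he => hne (by rw [he])⟩, fun h0 => hne ?_⟩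
        rw [h0, Rat.cast_zero, zero_mul, zero_mul]
      · rintro ⟨j, ⟨hj, hne⟩, h0⟩
        refine ⟨j, Finset.mem_range.2 (by omega), ?_⟩
        simp only [if_pos hj]
        exact fun he => hne (mul_left_cancel₀ (by exact_mod_cast h0) he)
    · intro j hj
      refine mul_le_mul_of_nonneg_left ?_ ?_
      · split_ifs
        · exact hle k j
        · exact le_rfl
      · exact_mod_cast h.reduced_substochastic.nonneg q (by omega) j (Finset.mem_range.1 hj)
  -- Either the sequence has become constant, or every step so far has removed a state; the latter
  -- can happen at most `n * c` times.
  have hstab : ∀ i, (∀ j, i ≤ j → T j = T i) ∨ (T i).card + i ≤ n * c := by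
    intro i
    induction i with
    | zero => exact Or.inr ((Finset.card_filter_le _ _).trans (Finset.card_range _).le)
    | succ i ih =>
      rcases ih with ih | ih
      · exact Or.inl fun j hj => (ih j (by omega)).trans (ih (i + 1) (by omega)).symm
      · by_cases he : T (i + 1) = T i
        · refine Or.inl fun j hj => ?_
          induction j, hj using Nat.le_induction with
          | base => rfl
          | succ j _ ihj =>
            ext q
            rw [hsucc j, ihj, he, ← hsucc i, he]
        · have := Finset.card_lt_card ((hanti (Nat.le_add_right i 1)).lt_of_ne he)
          exact Or.inr (by omega)
  have hfix : ∀ j, n * c ≤ j → T j = T (n * c) := by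
    rcases hstab (n * c) with h1 | h1
    · exact h1
    · intro j hj
      have h2 : T (n * c) = ∅ := Finset.card_eq_zero.1 (by omega)
      rw [h2]
      exact Finset.subset_empty.1 (h2 ▸ hanti hj)
  by_contra hne
  have h1 : q ∈ T l := Finset.mem_filter.2 ⟨Finset.mem_range.2 hq, hne⟩
  -- If `q` were in `T l`, it would be in every later `T`, hence in `T k` by antitonicity, against
  -- the attainment at level `k`.
  rw [hfix l hl, ← hfix (max k (n * c)) (le_max_right _ _)] at h1
  exact (Finset.mem_filter.1 (hanti (le_max_left k (n * c)) h1)).2 hk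

end IsUnitMatrix

end MarkovChain

namespace MarkovChain

variable {n : ℕ} {M : MarkovChain n} {a b : AP}

/-! ## A bound for the values -/

section Bound

variable (M a b)

open Classical in
/-- The transition matrix restricted to the states from which the goal can be reached. -/
def liveMatrix : Matrix (Fin n) (Fin n) ℝ :=
  Matrix.of fun s t => if b ∉ M.label s ∧ 0 < M.reachProb a b s then (M.prob s t : ℝ) else 0

/-- The probability of `a U b` being fulfilled, but not within fewer than `k` steps. -/
def tailProb (k : ℕ) (s : Fin n) : ℝ := M.reachProb a b s - M.reachStep a b k s

/-- The product of the denominators of the transition probabilities. -/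
def probDen : ℕ := ∏ st : Fin n × Fin n with 0 < M.prob st.1 st.2, (M.prob st.1 st.2).den

variable {M a b}

/-! ### The live matrix and the tail probabilities -/

theorem prob_le_one (s t : Fin n) : (M.prob s t : ℝ) ≤ 1 := by
  rw [← sum_prob' s]
  exact Finset.single_le_sum (f := fun t => (M.prob s t : ℝ)) (fun t _ => prob_nonneg' s t)
    (Finset.mem_univ t)

theorem liveMatrix_nonneg (s t : Fin n) : 0 ≤ M.liveMatrix a b s t := by
  rw [liveMatrix, Matrix.of_apply]
  split_ifs
  · exact prob_nonneg' s t
  · exact le_rfl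

theorem liveMatrix_le_one (s t : Fin n) : M.liveMatrix a b s t ≤ 1 := by
  rw [liveMatrix, Matrix.of_apply]
  split_ifs
  · exact prob_le_one s t
  · exact zero_le_one

theorem liveMatrix_mulVec_eq_zero {s : Fin n} (h : M.reachProb a b s = 0) (y : Fin n → ℝ) :
    (M.liveMatrix a b).mulVec y s = 0 := by
  rw [Matrix.mulVec, dotProduct]
  exact Finset.sum_eq_zero fun t _ => by simp [liveMatrix, h]

theorem tailProb_zero (s : Fin n) : M.tailProb a b 0 s = M.reachProb a b s := by
  simp [tailProb, reachStep]

theorem tailProb_nonneg (k : ℕ) (s : Fin n) : 0 ≤ M.tailProb a b k s :=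
  sub_nonneg.2 (reachStep_le_reachProb k s)

theorem tailProb_anti (s : Fin n) : Antitone fun k => M.tailProb a b k s :=
  antitone_nat_of_succ_le fun k => sub_le_sub_left (reachStep_le_succ k s) _

theorem tendsto_tailProb (s : Fin n) :
    Tendsto (fun k => M.tailProb a b k s) atTop (𝓝 0) := by
  have := (tendsto_reachStep (M := M) (a := a) (b := b) s).const_sub (M.reachProb a b s)
  rwa [sub_self] at this

/-- At states that are neither goals nor hopeless this is the difference of two first-step
equations. Goals are fulfilled within one step and hopeless states have no tail, which is why
`liveMatrix` can clear both kinds of rows. -/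
theorem tailProb_succ (k : ℕ) (s : Fin n) :
    M.tailProb a b (k + 1) s = (M.liveMatrix a b).mulVec (M.tailProb a b k) s := by
  classical
  rcases (reachProb_nonneg (M := M) (a := a) (b := b) s).eq_or_lt with h0 | h0
  · rw [liveMatrix_mulVec_eq_zero h0.symm]
    have := tailProb_nonneg (M := M) (a := a) (b := b) (k + 1) s
    have h1 := reachStep_nonneg (M := M) (a := a) (b := b) (k + 1) s
    unfold tailProb at this ⊢
    linarith
  · rw [Matrix.mulVec, dotProduct]
    have hQ : ∀ t, M.liveMatrix a b s t = if b ∉ M.label s then (M.prob s t : ℝ) else 0 := by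
      intro t
      simp [liveMatrix, h0]
    simp only [hQ]
    rw [tailProb, reachProb_eq, reachStep]
    split_ifs with hb ha
    · simp
    · rw [← Finset.sum_sub_distrib]
      exact Finset.sum_congr rfl fun t _ => by rw [tailProb, mul_sub]
    · rw [reachProb_eq, if_neg hb, if_neg ha] at h0
      exact absurd h0 (lt_irrefl 0)

theorem exists_abs_le_mul {y : Fin n → ℝ} (h : ∀ s, M.reachProb a b s = 0 → y s = 0) :
    ∃ θ : ℝ, ∀ s, |y s| ≤ θ * M.reachProb a b s := by
  refine ⟨∑ s, |y s| / M.reachProb a b s, fun s => ?_⟩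
  rcases (reachProb_nonneg (M := M) (a := a) (b := b) s).eq_or_lt with h0 | h0
  · rw [h s h0.symm, ← h0]
    simp
  · calc |y s| = |y s| / M.reachProb a b s * M.reachProb a b s := by
          rw [div_mul_cancel₀ _ h0.ne']
      _ ≤ _ := by
          gcongr
          exact Finset.single_le_sum (f := fun s => |y s| / M.reachProb a b s)
            (fun t _ => div_nonneg (abs_nonneg _) (reachProb_nonneg t)) (Finset.mem_univ s)

/-- Iterates of the live matrix are dominated by the tail probabilities. -/
theorem exists_iterate_le {h : ℕ → Fin n → ℝ}
    (hsucc : ∀ k, h (k + 1) = (M.liveMatrix a b).mulVec (h k))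
    (h0 : ∀ s, M.reachProb a b s = 0 → h 0 s = 0) :
    ∃ θ : ℝ, ∀ k s, |h k s| ≤ θ * M.tailProb a b k s := by
  obtain ⟨θ, hθ⟩ := exists_abs_le_mul h0
  refine ⟨θ, fun k => ?_⟩
  induction k with
  | zero => simpa only [tailProb_zero] using hθ
  | succ k ih =>
    intro s
    rw [hsucc, tailProb_succ, Matrix.mulVec, Matrix.mulVec, dotProduct, dotProduct,
      Finset.mul_sum]
    refine (Finset.abs_sum_le_sum_abs _ _).trans (Finset.sum_le_sum fun t _ => ?_)
    rw [abs_mul, abs_of_nonneg (liveMatrix_nonneg s t), mul_left_comm]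
    exact mul_le_mul_of_nonneg_left (ih t) (liveMatrix_nonneg s t)

/-- A kernel vector would be a constant sequence of iterates of the live matrix, and these are
dominated by multiples of the tail probabilities, which tend to 0. -/
theorem det_one_sub_liveMatrix_ne_zero : (1 - M.liveMatrix a b).det ≠ 0 := by
  intro hdet
  obtain ⟨v, hv, hv0⟩ := Matrix.exists_mulVec_eq_zero_iff.2 hdet
  rw [Matrix.sub_mulVec, Matrix.one_mulVec, sub_eq_zero] at hv0
  obtain ⟨θ, hθ⟩ := exists_iterate_le (M := M) (a := a) (b := b) (h := fun _ => v)
    (fun _ => hv0) (fun s hs => by rw [hv0, liveMatrix_mulVec_eq_zero hs])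
  refine hv (funext fun s => ?_)
  have h1 : |v s| ≤ 0 := by
    have h2 := (tendsto_tailProb (M := M) (a := a) (b := b) s).const_mul θ
    rw [mul_zero] at h2
    exact ge_of_tendsto' h2 fun k => hθ k s
  exact abs_eq_zero.1 (le_antisymm h1 (abs_nonneg _))

/-- If `g = x + Q g`, for the live matrix `Q` and the reachability probabilities `x`, then the
tail probabilities decrease at least as fast as `g / k`. -/
theorem mul_tailProb_le {g : Fin n → ℝ}
    (hg : ∀ s, g s = M.reachProb a b s + (M.liveMatrix a b).mulVec g s) (k : ℕ) (s : Fin n) :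
    k * M.tailProb a b k s ≤ g s := by
  have hsum : ∀ k, (M.liveMatrix a b).mulVec (fun t => ∑ i ∈ Finset.range k, M.tailProb a b i t) =
      fun t => ∑ i ∈ Finset.range k, M.tailProb a b (i + 1) t := by
    intro k
    funext t
    simp only [tailProb_succ, Matrix.mulVec, dotProduct, Finset.mul_sum]
    rw [Finset.sum_comm]
  -- The remainder of `g` after subtracting the first `k` tails is itself an iterate of the live
  -- matrix, so it tends to 0. Hence `g` bounds all partial sums of the tails.
  obtain ⟨θ, hθ⟩ := exists_iterate_le (M := M) (a := a) (b := b)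
    (h := fun k => g - fun t => ∑ i ∈ Finset.range k, M.tailProb a b i t)
    (fun k => by
      rw [Matrix.mulVec_sub, hsum]
      funext t
      simp only [Pi.sub_apply]
      rw [Finset.sum_range_succ', tailProb_zero]
      linarith [hg t])
    (fun t ht => by simp [hg t, ht, liveMatrix_mulVec_eq_zero ht])
  have h1 : ∑ i ∈ Finset.range k, M.tailProb a b i s ≤ g s := by
    have h2 : Tendsto (fun l => g s + θ * M.tailProb a b l s) atTop (𝓝 (g s)) := by
      simpa using ((tendsto_tailProb (M := M) (a := a) (b := b) s).const_mul θ).const_add (g s)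
    refine ge_of_tendsto h2 ?_
    filter_upwards [eventually_ge_atTop k] with l hl
    have h4 : ∑ i ∈ Finset.range k, M.tailProb a b i s ≤
        ∑ i ∈ Finset.range l, M.tailProb a b i s :=
      Finset.sum_le_sum_of_subset_of_nonneg (Finset.range_mono hl)
        fun i _ _ => tailProb_nonneg i s
    have h6 := (abs_le.1 (hθ l s)).1
    simp only [Pi.sub_apply] at h6
    linarith
  -- The tails decrease, so each of the first `k` summands is at least the `k`-th tail.
  refine le_trans ?_ h1
  have := Finset.card_nsmul_le_sum (Finset.range k) (fun i => M.tailProb a b i s)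
    (M.tailProb a b k s) fun i hi => tailProb_anti s (Finset.mem_range.1 hi).le
  simpa using this

/-! ### Integral matrices and bounds for determinants -/

theorem probDen_pos : 0 < M.probDen := Finset.prod_pos fun _ _ => Rat.den_pos _

theorem exists_probDen_mul (s t : Fin n) : ∃ z : ℤ, (M.probDen : ℝ) * M.prob s t = z := by
  rcases (M.prob_nonneg s t).eq_or_lt with h | h
  · exact ⟨0, by simp [← h]⟩
  · obtain ⟨d, hd⟩ : (M.prob s t).den ∣ M.probDen :=
      Finset.dvd_prod_of_mem (fun st : Fin n × Fin n => (M.prob st.1 st.2).den)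
        (Finset.mem_filter.2 ⟨Finset.mem_univ (s, t), h⟩)
    refine ⟨d * (M.prob s t).num, ?_⟩
    have h1 : (M.prob s t : ℝ) * (M.prob s t).den = (M.prob s t).num := by
      exact_mod_cast Rat.mul_den_eq_num (M.prob s t)
    rw [hd]
    push_cast
    rw [← h1]
    ring

variable (M) in
/-- A bound for the determinants that occur. -/
def detBound : ℕ := n.factorial * M.probDen ^ n

theorem exists_intMatrix : ∃ A : Matrix (Fin n) (Fin n) ℤ,
    A.map (Int.cast : ℤ → ℝ) = (M.probDen : ℝ) • (1 - M.liveMatrix a b) := by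
  have h : ∀ s t : Fin n, ∃ z : ℤ,
      (z : ℝ) = (M.probDen : ℝ) * ((1 : Matrix (Fin n) (Fin n) ℝ) s t - M.liveMatrix a b s t) := by
    intro s t
    obtain ⟨z, hz⟩ := exists_probDen_mul (M := M) s t
    rw [liveMatrix, Matrix.of_apply, Matrix.one_apply]
    split_ifs
    · exact ⟨M.probDen - z, by push_cast; rw [← hz]; ring⟩
    · exact ⟨M.probDen, by push_cast; ring⟩
    · exact ⟨- z, by push_cast; rw [← hz]; ring⟩
    · exact ⟨0, by simp⟩
  choose A hA using h
  exact ⟨Matrix.of A, by ext s t; simp [hA s t]⟩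

/-- The Leibniz formula has `n!` terms, each a product of `n` entries. -/
theorem abs_det_le {A : Matrix (Fin n) (Fin n) ℝ} (h : ∀ i j, |A i j| ≤ M.probDen) :
    |A.det| ≤ M.detBound := by
  have := Matrix.det_le (abv := AbsoluteValue.abs) (A := A) (x := (M.probDen : ℝ))
    fun i j => by simpa using h i j
  rw [Fintype.card_fin] at this
  simpa [detBound] using this

theorem abs_smul_one_sub_le (s t : Fin n) :
    |((M.probDen : ℝ) • (1 - M.liveMatrix a b)) s t| ≤ M.probDen := by
  rw [Matrix.smul_apply, smul_eq_mul, abs_mul, abs_of_nonneg (Nat.cast_nonneg _)]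
  refine mul_le_of_le_one_right (Nat.cast_nonneg _) (abs_le.2 ?_)
  rw [Matrix.sub_apply, Matrix.one_apply]
  have h1 := liveMatrix_nonneg (M := M) (a := a) (b := b) s t
  have h2 := liveMatrix_le_one (M := M) (a := a) (b := b) s t
  split_ifs <;> constructor <;> linarith

/-- With B = `detBound`: by integrality the gap between the reachability probability and `p` is at
least 1 / (B * den p), and by Cramer's rule the expected-time vector `g` is at most B, so the tail
after k steps is at most B / k. This is below the gap as soon as k > B ^ 2 * den p. -/
theorem exists_lt_reachStep {p : ℚ} {s : Fin n} (h : (p : ℝ) < M.reachProb a b s) :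
    (p : ℝ) < M.reachStep a b (M.detBound ^ 2 * p.den + 1) s := by
  classical
  obtain ⟨A', hA'⟩ := exists_intMatrix (M := M) (a := a) (b := b)
  set A := (M.probDen : ℝ) • (1 - M.liveMatrix a b) with hA
  set x := M.reachProb a b with hx
  have hD : (0 : ℝ) < M.probDen := by exact_mod_cast probDen_pos
  have hdet : A.det = (A'.det : ℝ) := by
    rw [← hA']
    exact ((Int.castRingHom ℝ).map_det A').symm
  have hdet0 : A.det ≠ 0 := by
    rw [hA, Matrix.det_smul]
    exact mul_ne_zero (pow_ne_zero _ hD.ne') det_one_sub_liveMatrix_ne_zero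
  have hdet1 : 1 ≤ |A.det| := by
    rw [hdet, ← Int.cast_abs]
    exact_mod_cast Int.one_le_abs fun h0 => hdet0 (by rw [hdet, h0, Int.cast_zero])
  have hdetB : |A.det| ≤ M.detBound := abs_det_le abs_smul_one_sub_le
  have hB : (1 : ℝ) ≤ M.detBound := hdet1.trans hdetB
  -- the reachability probabilities are rational numbers with denominator `A.det`
  have hAx : A.mulVec x = (M.probDen : ℝ) • fun t => if b ∈ M.label t then (1 : ℝ) else 0 := by
    rw [hA, Matrix.smul_mulVec, Matrix.sub_mulVec, Matrix.one_mulVec]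
    congr 1
    funext t
    have h1 := tailProb_succ (M := M) (a := a) (b := b) 0 t
    have h2 : M.tailProb a b 0 = x := funext fun t => tailProb_zero t
    rw [h2] at h1
    rw [Pi.sub_apply, ← h1, tailProb, reachStep]
    simp [reachStep, hx]
  -- `A` times `x` is an integral vector; multiplying by the integral adjugate turns the left-hand
  -- side into `det A` times `x`.
  obtain ⟨z, hz⟩ : ∃ z : ℤ, A.det * x s = z := by
    have h1 : A.adjugate.mulVec (A.mulVec x) = A.det • x := by
      rw [Matrix.mulVec_mulVec, Matrix.adjugate_mul, Matrix.smul_mulVec, Matrix.one_mulVec]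
    have h2 : A.adjugate = A'.adjugate.map (Int.cast : ℤ → ℝ) := by
      rw [← hA']
      exact ((Int.castRingHom ℝ).map_adjugate A').symm
    refine ⟨∑ t, A'.adjugate s t * (M.probDen * if b ∈ M.label t then 1 else 0), ?_⟩
    rw [← smul_eq_mul, ← Pi.smul_apply, ← h1, hAx, h2, Matrix.mulVec, dotProduct]
    push_cast
    refine Finset.sum_congr rfl fun t _ => ?_
    simp
  -- After multiplication by `det A` and the denominator of `p`, the gap is a nonzero integer, hence
  -- at least 1 in absolute value.
  have hgap : 1 ≤ M.detBound * p.den * (x s - p) := by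
    have h1 : A.det * p.den * (x s - p) = ((z * p.den - A'.det * p.num : ℤ) : ℝ) := by
      have : (p : ℝ) * p.den = p.num := by exact_mod_cast Rat.mul_den_eq_num p
      simp only [Int.cast_sub, Int.cast_mul, Int.cast_natCast]
      rw [← hz, ← hdet, ← this]
      ring
    have hden : (0 : ℝ) < p.den := by exact_mod_cast p.den_pos
    have h2 : |A.det * p.den * (x s - p)| = |A.det| * p.den * (x s - p) := by
      rw [abs_mul, abs_mul, abs_of_pos hden, abs_of_pos (sub_pos.2 h)]
    have h3 : 1 ≤ |A.det| * p.den * (x s - p) := by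
      rw [← h2, h1, ← Int.cast_abs]
      have h4 : (z * p.den - A'.det * p.num : ℤ) ≠ 0 := by
        intro h0
        rw [h0, Int.cast_zero] at h1
        exact mul_ne_zero (mul_ne_zero hdet0 hden.ne') (sub_pos.2 h).ne' h1
      exact_mod_cast Int.one_le_abs h4
    refine h3.trans ?_
    have := sub_pos.2 h
    gcongr
  -- the expected number of steps
  set g : Fin n → ℝ := A.det⁻¹ • A.cramer ((M.probDen : ℝ) • x) with hg
  have hAg : A.mulVec g = (M.probDen : ℝ) • x := by
    rw [hg, Matrix.mulVec_smul, Matrix.mulVec_cramer, inv_smul_smul₀ hdet0]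
  have hgeq : ∀ t, g t = x t + (M.liveMatrix a b).mulVec g t := by
    intro t
    have h1 : g - (M.liveMatrix a b).mulVec g = x := by
      rw [hA, Matrix.smul_mulVec, Matrix.sub_mulVec, Matrix.one_mulVec] at hAg
      exact smul_right_injective _ hD.ne' hAg
    rw [← h1]
    simp
  -- Replacing a column by `probDen` times probabilities keeps the entries within the bound of
  -- `abs_det_le`; dividing by `det A`, which is at least 1 in absolute value, does not increase the
  -- quotient.
  have hgB : g s ≤ M.detBound := by
    have h1 : |A.cramer ((M.probDen : ℝ) • x) s| ≤ M.detBound := by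
      rw [Matrix.cramer_apply]
      refine abs_det_le fun i j => ?_
      rw [Matrix.updateCol_apply]
      split_ifs
      · rw [Pi.smul_apply, smul_eq_mul, abs_of_nonneg (mul_nonneg hD.le (reachProb_nonneg i))]
        exact mul_le_of_le_one_right hD.le (reachProb_le_one i)
      · exact abs_smul_one_sub_le i j
    refine (le_abs_self _).trans ?_
    rw [hg, Pi.smul_apply, smul_eq_mul, abs_mul, abs_inv]
    exact (mul_le_of_le_one_left (abs_nonneg _) (inv_le_one_of_one_le₀ hdet1)).trans h1
  have hk := (mul_tailProb_le hgeq (M.detBound ^ 2 * p.den + 1) s).trans hgB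
  have hlt : M.tailProb a b (M.detBound ^ 2 * p.den + 1) s < x s - p := by
    by_contra hcon
    rw [not_lt] at hcon
    have h1 : ((M.detBound ^ 2 * p.den + 1 : ℕ) : ℝ) * (x s - p) ≤ M.detBound :=
      (mul_le_mul_of_nonneg_left hcon (Nat.cast_nonneg _)).trans hk
    push_cast at h1
    have h2 := mul_le_mul_of_nonneg_left hgap (zero_le_one.trans hB)
    have h3 := sub_pos.2 h
    nlinarith
  unfold tailProb at hlt
  linarith

/-! ### The bound in terms of the size -/

theorem natSize_pos (x : ℕ) : 0 < natSize x := lt_of_lt_of_le one_pos (le_max_left _ _)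

theorem den_le_two_pow_ratSize (x : ℚ) : x.den ≤ 2 ^ ratSize x := by
  refine (Nat.lt_size_self x.den).le.trans (Nat.pow_le_pow_right two_pos ?_)
  exact (le_max_right 1 (Nat.size x.den)).trans (Nat.le_add_left _ _)

theorem le_size : n ≤ M.size := by
  have h : ∑ s : Fin n, 1 ≤ ∑ s, natSize (M.rew s) := Finset.sum_le_sum fun s _ => natSize_pos _
  simp only [Finset.sum_const, Finset.card_univ, Fintype.card_fin, smul_eq_mul, mul_one] at h
  exact h.trans (Nat.le_add_right _ _)

/-- Each denominator is at most 2 to its contribution to the size, and the contributions add up in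
the exponent. -/
theorem probDen_le : M.probDen ≤ 2 ^ M.size := by
  unfold probDen
  calc _ ≤ ∏ st : Fin n × Fin n with 0 < M.prob st.1 st.2, 2 ^ ratSize (M.prob st.1 st.2) :=
        Finset.prod_le_prod' fun _ _ => den_le_two_pow_ratSize _
    _ = 2 ^ ∑ st : Fin n × Fin n with 0 < M.prob st.1 st.2, ratSize (M.prob st.1 st.2) :=
        Finset.prod_pow_eq_pow_sum _ _ _
    _ ≤ _ := Nat.pow_le_pow_right two_pos (Nat.le_add_left _ _)

theorem detBound_le {z : ℕ} (hz : M.size ≤ z) : M.detBound ≤ 2 ^ (2 * z ^ 2) := by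
  have hn : n ≤ z := le_size.trans hz
  calc M.detBound ≤ (2 ^ z) ^ z * (2 ^ z) ^ z := by
        refine Nat.mul_le_mul ?_ ?_
        · calc n.factorial ≤ n ^ n := Nat.factorial_le_pow n
            _ ≤ (2 ^ z) ^ n := Nat.pow_le_pow_left (hn.trans Nat.lt_two_pow_self.le) n
            _ ≤ _ := Nat.pow_le_pow_right (by positivity) hn
        · calc M.probDen ^ n ≤ (2 ^ z) ^ n := Nat.pow_le_pow_left
                (probDen_le.trans (Nat.pow_le_pow_right two_pos hz)) n
            _ ≤ _ := Nat.pow_le_pow_right (by positivity) hn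
    _ = 2 ^ (2 * z ^ 2) := by rw [← pow_mul, ← pow_add]; congr 1; ring

/-- The step bound of `exists_lt_reachStep`, times `c`, is a sufficient reward bound; one more is
needed for the shift in `unitProb`. All of it is at most 2 to the power 4z² + 2z + 2, with `z` a
common bound for the parameters. -/
theorem lt_unitProb {c z j : ℕ} (hc : 0 < c) (hrew : ∀ s, M.rew s ≤ c) (hcz : c ≤ z)
    (hz : M.size ≤ z) {p : ℚ} (hp : ratSize p ≤ z) {s : Fin n}
    (h : (p : ℝ) < M.reachProb a b s) (hj : 4 * z ^ 2 + 2 * z + 2 ≤ j) :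
    (p : ℝ) < M.unitProb a b c (2 ^ j) (s * c) := by
  have h1 := unitProb_mul_add (M := M) (a := a) (b := b) (2 ^ j) s hc
  rw [add_zero] at h1
  rw [h1]
  refine (exists_lt_reachStep h).trans_le (reachStep_le_untilProb hrew _ s ?_)
  have h2 : c * (M.detBound ^ 2 * p.den + 1) + 1 ≤ 2 ^ j := by
    calc c * (M.detBound ^ 2 * p.den + 1) + 1
        ≤ 2 ^ z * ((2 ^ (2 * z ^ 2)) ^ 2 * 2 ^ z + 1) + 1 := by
          gcongr
          · exact hcz.trans Nat.lt_two_pow_self.le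
          · exact detBound_le hz
          · exact (den_le_two_pow_ratSize p).trans (Nat.pow_le_pow_right two_pos hp)
      _ ≤ 2 ^ z * (2 ^ (4 * z ^ 2 + z + 1)) + 1 := by
          gcongr
          rw [← pow_mul, ← pow_add, show 2 * z ^ 2 * 2 + z = 4 * z ^ 2 + z by ring,
            pow_succ 2 (4 * z ^ 2 + z)]
          have : 0 < 2 ^ (4 * z ^ 2 + z) := by positivity
          omega
      _ ≤ 2 ^ (4 * z ^ 2 + 2 * z + 2) := by
          rw [← pow_add, show z + (4 * z ^ 2 + z + 1) = 4 * z ^ 2 + 2 * z + 1 by ring,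
            pow_succ 2 (4 * z ^ 2 + 2 * z + 1)]
          have : 0 < 2 ^ (4 * z ^ 2 + 2 * z + 1) := by positivity
          omega
      _ ≤ 2 ^ j := Nat.pow_le_pow_right two_pos hj
  have h3 : ((c * (M.detBound ^ 2 * p.den + 1) : ℕ) : ℝ) + 1 ≤ ((2 ^ j : ℕ) : ℝ) := by
    exact_mod_cast h2
  rw [Nat.cast_zero, sub_zero]
  linarith

end Bound

end MarkovChain

/-! ## Values of queries -/

theorem Comparison.Holds.mono {cmp : Comparison} {x y z : ℝ} (h : cmp.Holds x z) (hxy : x ≤ y) :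
    cmp.Holds y z := by
  cases cmp
  · exact le_trans h hxy
  · exact lt_of_lt_of_le h hxy

namespace MarkovChain

variable {n : ℕ} {M : MarkovChain n} {a b : AP} {c : ℕ} {cmp : Comparison} {p : ℚ} {s : Fin n}

theorem unitProb_mul (hc : 0 < c) (k : ℕ) (s : Fin n) :
    M.unitProb a b c k (s * c) = M.untilProb a b s ((k : ℝ) - 1) := by
  simpa using unitProb_mul_add (M := M) (a := a) (b := b) k s hc

/-- For negative bounds the probability is 0, so if 0 meets the threshold then all negative bounds
qualify. -/
theorem queryValue_eq_bot (h : cmp.Holds 0 p) : M.queryValue cmp p a b s = ⊥ := by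
  refine sInf_eq_bot.2 fun x hx => ?_
  obtain ⟨r, hr⟩ := EReal.lt_iff_exists_real_btwn.1 hx
  refine ⟨((min r (-1) : ℝ) : EReal), ⟨min r (-1), ?_, rfl⟩, ?_⟩
  · change cmp.Holds (M.untilProb a b s _) p
    rwa [untilProb_of_neg s ((min_le_right r (-1)).trans_lt (by norm_num))]
  · exact lt_of_le_of_lt (EReal.coe_le_coe_iff.2 (min_le_left r (-1))) hr.2

theorem queryValue_eq_top (hc : 0 < c) (h : ∀ k, ¬ cmp.Holds (M.unitProb a b c k (s * c)) p) :
    M.queryValue cmp p a b s = ⊤ := by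
  have h1 : {r : ℝ | M.Satisfies cmp p a b r s} = ∅ := by
    refine Set.eq_empty_iff_forall_notMem.2 fun r hr => ?_
    refine h (⌈r⌉₊ + 1) ?_
    rw [unitProb_mul hc]
    refine Comparison.Holds.mono (x := M.untilProb a b s r) hr (untilProb_mono s ?_)
    push_cast
    linarith [Nat.le_ceil r]
  rw [queryValue, h1, Set.image_empty, sInf_empty]

/-- Level `k + 1` belongs to the bound `k`, so `k` qualifies. A smaller real bound has integer part
at most `k - 1`, or is negative, and therefore fails along with level `k`. -/
theorem queryValue_eq_natCast (hc : 0 < c) {k : ℕ}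
    (h : ¬ cmp.Holds (M.unitProb a b c k (s * c)) p)
    (h' : cmp.Holds (M.unitProb a b c (k + 1) (s * c)) p) :
    M.queryValue cmp p a b s = ((k : ℝ) : EReal) := by
  rw [unitProb_mul hc] at h h'
  refine IsLeast.csInf_eq ⟨⟨k, ?_, rfl⟩, ?_⟩
  · change cmp.Holds (M.untilProb a b s _) p
    simpa using h'
  · rintro _ ⟨r, hr, rfl⟩
    refine EReal.coe_le_coe_iff.2 ?_
    by_contra hlt
    rw [not_le] at hlt
    change cmp.Holds (M.untilProb a b s r) p at hr
    refine h (hr.mono ?_)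
    by_cases hr0 : 0 ≤ r
    · rw [untilProb_floor s hr0]
      refine untilProb_mono s ?_
      have h1 : ⌊r⌋₊ < k := (Nat.floor_lt hr0).2 hlt
      have h2 : ((⌊r⌋₊ + 1 : ℕ) : ℝ) ≤ k := by exact_mod_cast h1
      push_cast at h2
      linarith
    · rw [untilProb_of_neg s (not_le.1 hr0)]
      exact untilProb_nonneg _ _

/-- For `>` the threshold is out of reach. For `≥` it could be met at some level only if the limit
were attained there, hence also at level `l ≥ n * c`; thus testing one such level settles all of
them. -/
theorem IsUnitMatrix.not_holds {A : ℕ → ℕ → ℚ} (hA : M.IsUnitMatrix a b c A) (hc : 0 < c)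
    (hrew : ∀ s, M.rew s ≤ c) (hp : M.reachProb a b s ≤ p) {l : ℕ} (hl : n * c ≤ l)
    (h : ¬ cmp.Holds (M.unitProb a b c l (s * c)) p) (k : ℕ) :
    ¬ cmp.Holds (M.unitProb a b c k (s * c)) p := by
  intro hk
  have hr : M.unitReach a b c (s * c) = M.reachProb a b s := by
    simpa using unitReach_mul_add (M := M) (a := a) (b := b) s hc
  have h1 : M.unitProb a b c k (s * c) ≤ M.reachProb a b s := by
    rw [unitProb_mul hc]
    exact untilProb_le_reachProb _ _
  have hq : (s : ℕ) * c < n * c := by simpa using mul_add_lt s hc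
  cases cmp with
  | gt => exact absurd (lt_of_lt_of_le hk (h1.trans hp)) (lt_irrefl _)
  | ge =>
    have h2 : (p : ℝ) ≤ M.unitProb a b c k (s * c) := hk
    refine h ?_
    rw [hA.unitProb_eq_unitReach hc hrew hq (by rw [hr]; linarith) hl, hr]
    exact h2.trans h1

end MarkovChain

/-! ## Basic programs -/

theorem mul_add_lt_mul {K i j : ℕ} (hi : i < K) (hj : j < K) : i * K + j < K * K :=
  calc i * K + j < i * K + K := by omega
    _ = (i + 1) * K := by ring
    _ ≤ K * K := Nat.mul_le_mul_right _ hi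

theorem mul_add_inj {C s j s' j' : ℕ} (hj : j < C) (hj' : j' < C) :
    s * C + j = s' * C + j' ↔ s = s' ∧ j = j' := by
  refine ⟨fun h => ?_, fun h => by rw [h.1, h.2]⟩
  have hC : 0 < C := by omega
  have h1 : s = s' := by
    have := congrArg (· / C) h
    simpa [mul_comm _ C, Nat.mul_add_div hC, Nat.div_eq_of_lt hj, Nat.div_eq_of_lt hj'] using this
  exact ⟨h1, by subst h1; omega⟩

namespace RamProg

variable {Z : ℕ} {P P' : RamProg} {m : RamMemory} {Q : RamMemory → Prop} {e f : RamExpr}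

/-- Branching on `e ≥ f` or `e > f`. -/
def test (cmp : Comparison) (e f : RamExpr) (P P' : RamProg) : RamProg :=
  match cmp with
  | .ge => ite e f P' P
  | .gt => ite f e P P'

theorem Ensures.test {cmp : Comparison} {x y : ℚ} (he : e.eval m = some x) (hf : f.eval m = some y)
    (h : cmp.Holds (x : ℝ) y → P.Ensures Z m Q) (h' : ¬ cmp.Holds (x : ℝ) y → P'.Ensures Z m Q) :
    (test cmp e f P P').Ensures Z m Q := by
  cases cmp with
  | ge =>
    exact Ensures.ite he hf (fun hlt => h' (not_le.2 (by exact_mod_cast hlt)))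
      fun hlt => h (by
        have : (y : ℝ) ≤ x := by exact_mod_cast not_lt.1 hlt
        exact this)
  | gt =>
    exact Ensures.ite hf he (fun hlt => h (by
        have : (y : ℝ) < x := by exact_mod_cast hlt
        exact this)) fun hlt => h' (fun hh : (y : ℝ) < x => hlt (by exact_mod_cast hh))

theorem test_writes (cmp : Comparison) (e f : RamExpr) (P P' : RamProg) (l : ℕ) :
    (test cmp e f P P').Writes l = (P.Writes l || P'.Writes l) := by
  cases cmp
  · exact Bool.or_comm _ _
  · rfl

/-- Filling a square block of array `D`. -/
theorem Ensures.fill {v w D K base : ℕ} (val : ℕ → ℕ → ℚ) (hK : K ≤ Z)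
    (hv : (RamProg.forTo w e P).Writes v = false) (hw : P.Writes w = false)
    (hDv : D ≠ v) (hDw : D ≠ w)
    (he : ∀ m', (RamProg.forTo v e (RamProg.forTo w e P)).Frame m m' → e.eval m' = some (K : ℚ))
    (hstep : ∀ m' i j, i < K → j < K → (RamProg.forTo v e (RamProg.forTo w e P)).Frame m m' →
      m' v 0 = i → m' w 0 = j →
      (∀ x, x < base ∨ base + K * K ≤ x → m' D x = m D x) →
      P.Ensures Z m' fun m'' =>
        ∀ x, m'' D x = if x = base + (i * K + j) then val i j else m' D x) :
    (RamProg.forTo v e (RamProg.forTo w e P)).Ensures Z m fun m' =>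
      (∀ i < K, ∀ j < K, m' D (base + (i * K + j)) = val i j) ∧
        ∀ x, x < base ∨ base + K * K ≤ x → m' D x = m D x := by
  have hfr : ∀ {m1 m2}, (RamProg.forTo v e (RamProg.forTo w e P)).Frame m m1 →
      (RamProg.forTo w e P).Frame m1 m2 →
      (RamProg.forTo v e (RamProg.forTo w e P)).Frame m m2 := by
    intro m1 m2 h1 h2 l hl
    rw [h2 l (by
      simp only [RamProg.forTo, Writes, Bool.or_eq_false_iff] at hl ⊢
      exact hl.2.1), h1 l hl]
  refine (Ensures.forTo (n := K) (fun i m' =>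
    (∀ i' < i, ∀ j < K, m' D (base + (i' * K + j)) = val i' j) ∧
        ∀ x, x < base ∨ base + K * K ≤ x → m' D x = m D x) hK hv ?_ (fun m' _ h _ => he m' h)
    ?_).mono fun m' _ h => h
  · simp [RamMemory.write_of_ne _ hDv]
  · intro m1 i hi hf1 hi1 ⟨h1, h2⟩
    refine (Ensures.forTo (n := K) (fun j m' => (∀ j' < j, m' D (base + (i * K + j')) = val i j') ∧
      (∀ i' < i, ∀ j < K, m' D (base + (i' * K + j)) = val i' j) ∧
        ∀ x, x < base ∨ base + K * K ≤ x → m' D x = m D x) hK hw ?_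
        (fun m' _ h _ => he m' (hfr hf1 h)) ?_).mono fun m' _ h => ?_
    · simp only [RamMemory.write_of_ne _ hDw]
      exact ⟨by simp, h1, h2⟩
    · intro m2 j hj hf2 hj2 ⟨g1, g2, g3⟩
      have hi2 : m2 v 0 = i := by rw [hf2 v hv, hi1]
      refine (hstep m2 i j hi hj (hfr hf1 hf2) hi2 hj2 g3).mono fun m3 _ h3 => ?_
      simp only [RamMemory.write_of_ne _ hDw, h3]
      refine ⟨fun j' hj' => ?_, fun i' hi' j' hj' => ?_, fun x hx => ?_⟩
      · rcases Nat.lt_succ_iff_lt_or_eq.1 hj' with hlt' | rfl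
        · rw [if_neg (by omega), g1 j' hlt']
        · rw [if_pos rfl]
      · rw [if_neg, g2 i' hi' j' hj']
        intro h
        exact hi'.ne ((mul_add_inj hj' hj).1 (Nat.add_left_cancel h)).1
      · rw [if_neg, g3 x hx]
        have := mul_add_lt_mul hi hj
        omega
    · obtain ⟨g1, g2, g3⟩ := h
      simp only [RamMemory.write_of_ne _ hDv]
      refine ⟨fun i' hi' j hj => ?_, g3⟩
      rcases Nat.lt_succ_iff_lt_or_eq.1 hi' with hlt' | rfl
      · exact g2 i' hlt' j hj
      · exact g1 j hj

end RamProg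

/-! ## Matrix powers

The variables of the program: array 7 holds the transition matrix that is reduced, array 8 a
sequence of square matrices. Cell 0 of array 10 holds the bound for the rewards, of array 11 the
number of states of the chain with unit rewards, of array 12 the width of the matrix in array 7, of
array 13 the width of the matrices in array 8, and of array 14 its square. -/

open RamExpr RamProg

/-- The matrix that is stored in array 8 from cell `d` on. -/
def slot (m : RamMemory) (K d : ℕ) : Matrix (Fin K) (Fin K) ℚ :=
  Matrix.of fun i j => m 8 (d + (i * K + j))

theorem slot_congr {m m' : RamMemory} {K d D : ℕ} (hd : d + K * K ≤ D)
    (h : ∀ x < D, m' 8 x = m 8 x) : slot m' K d = slot m K d := by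
  ext i j
  have := mul_add_lt_mul i.2 j.2
  exact h _ (by omega)

theorem slot_congr' {m m' : RamMemory} {K d : ℕ} (h : m' 8 = m 8) : slot m' K d = slot m K d := by
  simp only [slot, h]

/-- Multiplication of the matrices at the positions given by the variables 30 and 31; the variable
32 gives the position of the result. -/
def mulProg : RamProg :=
  forTo 33 (var 13) (forTo 34 (var 13)
    (seq (set 36 (const 0))
      (seq (forTo 35 (var 13)
          (set 36 (add (var 36) (mul
            (read 8 (add (var 30) (add (mul (var 33) (var 13)) (var 35))))
            (read 8 (add (var 31) (add (mul (var 35) (var 13)) (var 34))))))))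
        (assign 8 (add (var 32) (add (mul (var 33) (var 13)) (var 34))) (var 36)))))

/-- Both operands lie below the position of the result, so writing the product does not disturb the
factors; they may coincide, as in squaring. -/
theorem mulProg_ensures {Z K a b d : ℕ} {m : RamMemory} (hK : K ≤ Z) (h13 : m 13 0 = (K : ℚ))
    (h30 : m 30 0 = (a : ℚ)) (h31 : m 31 0 = (b : ℚ)) (h32 : m 32 0 = (d : ℚ))
    (had : a + K * K ≤ d) (hbd : b + K * K ≤ d) :
    mulProg.Ensures Z m fun m' =>
      slot m' K d = slot m K a * slot m K b ∧ ∀ x < d, m' 8 x = m 8 x := by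
  refine (Ensures.fill (D := 8) (K := K) (base := d)
    (fun i j => ∑ l ∈ Finset.range K, m 8 (a + (i * K + l)) * m 8 (b + (l * K + j))) hK
    (by decide) (by decide) (by decide) (by decide) ?_ ?_).mono ?_
  · intro m' hf
    rw [eval_var, hf 13 (by decide), h13]
  · intro m1 i j hi hj hf1 hi1 hj1 h1
    have e13 : m1 13 0 = K := by rw [hf1 13 (by decide), h13]
    have e30 : m1 30 0 = a := by rw [hf1 30 (by decide), h30]
    have e31 : m1 31 0 = b := by rw [hf1 31 (by decide), h31]
    have e32 : m1 32 0 = d := by rw [hf1 32 (by decide), h32]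
    refine Ensures.seq (Ensures.set rfl ?_)
    refine Ensures.seq' (Ensures.forTo (n := K) (fun k m2 => m2 36 0 =
      ∑ l ∈ Finset.range k, m 8 (a + (i * K + l)) * m 8 (b + (l * K + j))) hK (by decide)
      (by simp [RamMemory.write_apply]) ?_ ?_) ?_
    · intro m2 _ hf2 _
      rw [eval_var, hf2 13 (by decide), RamMemory.write_of_ne _ (by decide), e13]
    · intro m2 k hk hf2 hk2 h2
      have hf2' : ∀ l, l ≠ 36 → l ≠ 35 → m2 l = m1 l := by
        intro l h36 h35
        rw [hf2 l (by simp [forTo, Writes, h36, h35]), RamMemory.write_of_ne _ h36]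
      refine Ensures.set (x := m2 36 0 + m 8 (a + (i * K + k)) * m 8 (b + (k * K + j))) ?_ ?_
      · have ha := mul_add_lt_mul hi hk
        have hb := mul_add_lt_mul hk hj
        simp only [RamExpr.eval, toIndex_zero, Option.bind_some, Option.map_some, hk2,
          hf2' 13 (by decide) (by decide), hf2' 30 (by decide) (by decide),
          hf2' 31 (by decide) (by decide), hf2' 33 (by decide) (by decide),
          hf2' 34 (by decide) (by decide), hf2' 8 (by decide) (by decide), e13, e30, e31, hi1, hj1,
          ← Nat.cast_add, ← Nat.cast_mul, toIndex_natCast]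
        rw [h1 _ (Or.inl (by omega)), h1 _ (Or.inl (by omega))]
      · rw [RamMemory.write_of_ne _ (by decide), RamMemory.write_self, Function.update_self, h2,
          Finset.sum_range_succ]
    · intro m2 hf2 h2
      have hf2' : ∀ l, l ≠ 36 → l ≠ 35 → m2 l = m1 l := by
        intro l h36 h35
        rw [hf2 l (by simp [forTo, Writes, h36, h35]), RamMemory.write_of_ne _ h36]
      refine Ensures.assign (x := ((d + (i * K + j) : ℕ) : ℚ)) ?_ rfl (eval_var _ _) ?_
      · simp only [RamExpr.eval, toIndex_zero, Option.bind_some, Option.map_some,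
          hf2' 13 (by decide) (by decide), hf2' 32 (by decide) (by decide),
          hf2' 33 (by decide) (by decide), hf2' 34 (by decide) (by decide), e13, e32, hi1, hj1,
          ← Nat.cast_add, ← Nat.cast_mul]
      · intro x
        rw [RamMemory.write_self, Function.update_apply, h2, hf2' 8 (by decide) (by decide)]
  · rintro m' - ⟨h1, h2⟩
    refine ⟨?_, fun x hx => h2 x (Or.inl hx)⟩
    ext i j
    rw [Matrix.mul_apply, slot, Matrix.of_apply, h1 i i.2 j j.2, Finset.sum_range]
    rfl

/-- The memory contains the identity matrix and the powers `W ^ 2 ^ i`, for `i ≤ J`. -/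
structure HasPowers {K : ℕ} (W : Matrix (Fin K) (Fin K) ℚ) (J : ℕ) (m : RamMemory) : Prop where
  width : m 13 0 = (K : ℚ)
  sq : m 14 0 = ((K * K : ℕ) : ℚ)
  top : m 15 0 = (((J + 1) * (K * K) : ℕ) : ℚ)
  pow : m 16 0 = ((2 ^ J : ℕ) : ℚ)
  count : m 17 0 = (J : ℚ)
  one : slot m K 0 = 1
  slot_eq : ∀ i ≤ J, slot m K ((i + 1) * (K * K)) = W ^ 2 ^ i

/-- Only the first `J + 2` blocks of array 8 matter. Everything above is scratch space, in which the
binary search stores its products. -/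
theorem HasPowers.congr {K : ℕ} {W : Matrix (Fin K) (Fin K) ℚ} {J : ℕ} {m m' : RamMemory}
    (h : HasPowers W J m) (h13 : m' 13 = m 13) (h14 : m' 14 = m 14) (h15 : m' 15 = m 15)
    (h16 : m' 16 = m 16) (h17 : m' 17 = m 17)
    (h8 : ∀ x < (J + 2) * (K * K), m' 8 x = m 8 x) : HasPowers W J m' := by
  refine ⟨by rw [h13, h.width], by rw [h14, h.sq], by rw [h15, h.top], by rw [h16, h.pow],
    by rw [h17, h.count], ?_, fun i hi => ?_⟩
  · rw [slot_congr _ h8, h.one]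
    nlinarith [Nat.zero_le (J * (K * K))]
  · rw [slot_congr _ h8, h.slot_eq i hi]
    rw [← Nat.succ_mul]
    exact Nat.mul_le_mul_right _ (by omega)

/-- Appending the square of the last power. -/
def squareProg : RamProg :=
  seq (set 30 (var 15)) (seq (set 31 (var 15)) (seq (set 32 (add (var 15) (var 14)))
    (seq mulProg (seq (set 15 (var 32)) (seq (set 16 (add (var 16) (var 16)))
      (set 17 (add (var 17) (const 1))))))))

theorem squareProg_ensures {Z K J : ℕ} {W : Matrix (Fin K) (Fin K) ℚ} {m : RamMemory} (hK : K ≤ Z)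
    (h : HasPowers W J m) : squareProg.Ensures Z m (HasPowers W (J + 1)) := by
  refine Ensures.seq (Ensures.set (eval_var _ _) ?_)
  refine Ensures.seq (Ensures.set (eval_var _ _) ?_)
  refine Ensures.seq (Ensures.set (x := (((J + 2) * (K * K) : ℕ) : ℚ)) ?_ ?_)
  · simp only [RamExpr.eval, toIndex_zero, Option.bind_some, Option.map_some,
      RamMemory.write_apply, h.top, h.sq]
    norm_num
    ring
  refine Ensures.seq' (mulProg_ensures (K := K) (a := (J + 1) * (K * K)) (b := (J + 1) * (K * K))
    (d := (J + 2) * (K * K)) hK ?_ ?_ ?_ ?_ (by rw [← Nat.succ_mul]) (by rw [← Nat.succ_mul])) ?_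
  · simp [RamMemory.write_apply, h.width]
  · simp [RamMemory.write_apply, h.top]
  · simp [RamMemory.write_apply, h.top]
  · simp [RamMemory.write_apply]
  intro m1 hf1 ⟨h1, h2⟩
  have e32 : m1 32 0 = (((J + 2) * (K * K) : ℕ) : ℚ) := by
    rw [hf1 32 (by decide)]
    simp [RamMemory.write_apply]
  have e : ∀ l, mulProg.Writes l = false → l ≠ 30 → l ≠ 31 → l ≠ 32 → m1 l = m l := by
    intro l hl h30 h31 h32
    rw [hf1 l hl, RamMemory.write_of_ne _ h32, RamMemory.write_of_ne _ h31,
      RamMemory.write_of_ne _ h30]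
  have e8 : ∀ l, slot (((m.write 30 0 (m 15 0)).write 31 0 ((m.write 30 0 (m 15 0)) 15 0)).write 32
      0 (((J + 2) * (K * K) : ℕ) : ℚ)) K l = slot m K l := fun l => slot_congr' (by
    rw [RamMemory.write_of_ne _ (by decide), RamMemory.write_of_ne _ (by decide),
      RamMemory.write_of_ne _ (by decide)])
  rw [e8, h.slot_eq J le_rfl] at h1
  refine Ensures.seq (Ensures.set (eval_var _ _) ?_)
  refine Ensures.seq (Ensures.set (x := ((2 ^ (J + 1) : ℕ) : ℚ)) ?_ ?_)
  · simp only [RamExpr.eval, toIndex_zero, Option.bind_some, Option.map_some,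
      RamMemory.write_apply]
    rw [e 16 (by decide) (by decide) (by decide) (by decide), h.pow]
    norm_num
    ring
  refine Ensures.set (x := ((J + 1 : ℕ) : ℚ)) ?_ ?_
  · simp only [RamExpr.eval, toIndex_zero, Option.bind_some, Option.map_some,
      RamMemory.write_apply]
    rw [e 17 (by decide) (by decide) (by decide) (by decide), h.count]
    norm_num
  have h8 : ∀ l, slot (((m1.write 15 0 (m1 32 0)).write 16 0 ((2 ^ (J + 1) : ℕ) : ℚ)).write 17 0
      ((J + 1 : ℕ) : ℚ)) K l = slot m1 K l := fun l => slot_congr' (by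
    rw [RamMemory.write_of_ne _ (by decide), RamMemory.write_of_ne _ (by decide),
      RamMemory.write_of_ne _ (by decide)])
  have hlow : ∀ l, l + K * K ≤ (J + 2) * (K * K) → slot m1 K l = slot m K l := fun l hl => by
    rw [← e8, slot_congr hl h2]
  refine ⟨?_, ?_, ?_, ?_, ?_, ?_, fun i hi => ?_⟩
  · simp [RamMemory.write_apply, e 13 (by decide) (by decide) (by decide) (by decide), h.width]
  · simp [RamMemory.write_apply, e 14 (by decide) (by decide) (by decide) (by decide), h.sq]
  · simp only [RamMemory.write_apply, e32]
    norm_num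
    left
    ring
  · simp [RamMemory.write_apply]
  · simp [RamMemory.write_apply]
  · rw [h8, hlow, h.one]
    nlinarith [Nat.zero_le (J * (K * K))]
  · rw [h8]
    rcases Nat.lt_or_eq_of_le hi with hi' | rfl
    · rw [hlow, h.slot_eq i (by omega)]
      rw [← Nat.succ_mul]
      exact Nat.mul_le_mul_right _ (by omega)
    · rw [show (J + 1 + 1) = J + 2 by ring, h1, ← pow_add]
      congr 1
      ring

/-! ## The elimination program -/

/-- Array 7 contains the first `C` rows and columns of `B`. -/
def HasMatrix (m : RamMemory) (C : ℕ) (B : ℕ → ℕ → ℚ) : Prop :=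
  ∀ s < C, ∀ j < C, m 7 (s * C + j) = B s j

/-- Normalization of the pivot row, whose number is in variable 20. -/
def pivotProg : RamProg :=
  seq (set 21 (mul (var 20) (var 12)))
    (seq (set 22 (sub (const 1) (read 7 (add (var 21) (var 20)))))
      (seq (assign 7 (add (var 21) (var 20)) (const 0))
        (ite (const 0) (var 22)
          (forTo 23 (var 12) (assign 7 (add (var 21) (var 23))
            (div (read 7 (add (var 21) (var 23))) (var 22)))) skip)))

/-- Addition of multiples of the pivot row to the other rows. -/
def rowsProg : RamProg :=
  forTo 23 (var 12) (seq (set 24 (mul (var 23) (var 12)))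
    (seq (set 25 (read 7 (add (var 24) (var 20))))
      (seq (assign 7 (add (var 24) (var 20)) (const 0))
        (forTo 26 (var 12) (assign 7 (add (var 24) (var 26))
          (add (read 7 (add (var 24) (var 26)))
            (mul (var 25) (read 7 (add (var 21) (var 26))))))))))

/-- Elimination in the matrix of width given by variable 12, with as many pivots as given by
variable 11. -/
def elimProg : RamProg := forTo 20 (var 11) (seq pivotProg rowsProg)

theorem pivotProg_ensures {Z C k : ℕ} {B : ℕ → ℕ → ℚ} {m : RamMemory} (hC : C ≤ Z)
    (h12 : m 12 0 = (C : ℚ)) (h20 : m 20 0 = (k : ℚ)) (hk : k < C) (hB : HasMatrix m C B) :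
    pivotProg.Ensures Z m fun m' => m' 21 0 = ((k * C : ℕ) : ℚ) ∧
      HasMatrix m' C fun s j => if s = k then pivotRow B k j else B s j := by
  refine Ensures.seq (Ensures.set (x := ((k * C : ℕ) : ℚ)) ?_ ?_)
  · simp only [RamExpr.eval, toIndex_zero, Option.bind_some, Option.map_some, h12, h20,
      ← Nat.cast_mul]
  refine Ensures.seq (Ensures.set (x := 1 - B k k) ?_ ?_)
  · simp only [RamExpr.eval, toIndex_zero, Option.bind_some, Option.map_some,
      RamMemory.write_self, Function.update_self, RamMemory.write_of_ne _ (show 20 ≠ 21 by decide),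
      RamMemory.write_of_ne _ (show 7 ≠ 21 by decide), h20, ← Nat.cast_add, toIndex_natCast,
      hB k hk k hk]
  -- The diagonal entry has been saved in variable 22; clearing it first lets the division run over
  -- all columns without an exception.
  refine Ensures.seq (Ensures.assign (x := ((k * C + k : ℕ) : ℚ)) (y := 0) ?_ rfl rfl ?_)
  · simp only [RamExpr.eval, toIndex_zero, Option.bind_some, Option.map_some,
      RamMemory.write_apply]
    simp [h20]
  set m1 := ((m.write 21 0 ((k * C : ℕ) : ℚ)).write 22 0 (1 - B k k)).write 7 (k * C + k) 0 with hm1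
  have e21 : m1 21 0 = ((k * C : ℕ) : ℚ) := by simp [hm1, RamMemory.write_apply]
  have e22 : m1 22 0 = 1 - B k k := by simp [hm1, RamMemory.write_apply]
  have e12 : m1 12 0 = C := by simp [hm1, RamMemory.write_apply, h12]
  have e7 : ∀ s < C, ∀ j < C, m1 7 (s * C + j) = if s = k ∧ j = k then 0 else B s j := by
    intro s hs j hj
    simp only [hm1, RamMemory.write_apply, mul_add_inj hj hk, true_and,
      show (7 : ℕ) ≠ 22 by decide, show (7 : ℕ) ≠ 21 by decide, false_and, if_false, hB s hs j hj]
  clear_value m1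
  refine Ensures.ite rfl (eval_var _ _) (fun hlt => ?_) (fun hlt => Ensures.skip ⟨e21, ?_⟩)
  · rw [e22, sub_pos] at hlt
    refine (Ensures.forTo (n := C) (fun l m' => ∀ s < C, ∀ j < C, m' 7 (s * C + j) =
      if s = k then (if j < l then pivotRow B k j else if j = k then 0 else B k j) else B s j) hC
      (by decide) ?_ ?_ ?_).mono ?_
    · intro s hs j hj
      rw [RamMemory.write_of_ne _ (by decide), e7 s hs j hj]
      by_cases h : s = k <;> simp [h]
    · intro m2 l hf2 _
      rw [eval_var, hf2 12 (by decide), e12]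
    · intro m2 l hl hf2 hl2 h2
      have e21' : m2 21 0 = ((k * C : ℕ) : ℚ) := by rw [hf2 21 (by decide), e21]
      have e22' : m2 22 0 = 1 - B k k := by rw [hf2 22 (by decide), e22]
      have hne : 1 - B k k ≠ 0 := (sub_pos.2 hlt).ne'
      refine Ensures.assign (x := ((k * C + l : ℕ) : ℚ)) (y := pivotRow B k l) ?_ rfl ?_ ?_
      · simp only [RamExpr.eval, toIndex_zero, Option.bind_some, Option.map_some, e21', hl2,
          ← Nat.cast_add]
      · simp only [RamExpr.eval, toIndex_zero, Option.bind_some, Option.map_some, e21', hl2,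
          ← Nat.cast_add, toIndex_natCast, e22', if_neg hne, h2 k hk l hl, if_true,
          lt_irrefl, if_false, pivotRow, if_pos hlt]
        congr 1
        split_ifs <;> simp
      · intro s hs j hj
        simp only [RamMemory.write_apply, true_and, mul_add_inj hj hl,
          show (7 : ℕ) ≠ 23 by decide, false_and, if_false, h2 s hs j hj]
        by_cases h1 : s = k
        · by_cases h3 : j = l
          · simp [h1, h3]
          · simp only [h1, h3, true_and, if_true, if_false]
            exact if_congr (by omega) rfl rfl
        · simp [h1]
    · intro m2 hf2 h2
      refine ⟨by rw [hf2 21 (by decide), e21], fun s hs j hj => ?_⟩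
      rw [h2 s hs j hj, if_pos hj]
  · rw [e22, sub_pos] at hlt
    intro s hs j hj
    rw [e7 s hs j hj]
    by_cases h1 : s = k <;> by_cases h2 : j = k <;> simp [h1, h2, pivotRow, hlt]

/-- The pivot row needs no exception: its entry in column `k` is already 0, so the factor read there
is 0 and the row is left unchanged. Hence the invariant treats row `k` as finished from the start.
-/
theorem rowsProg_ensures {Z C k : ℕ} {B : ℕ → ℕ → ℚ} {m : RamMemory} (hC : C ≤ Z)
    (h12 : m 12 0 = (C : ℚ)) (h20 : m 20 0 = (k : ℚ)) (h21 : m 21 0 = ((k * C : ℕ) : ℚ))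
    (hk : k < C) (hB : HasMatrix m C fun s j => if s = k then pivotRow B k j else B s j) :
    rowsProg.Ensures Z m fun m' => HasMatrix m' C (elimStep B k) := by
  have hpk : pivotRow B k k = 0 := by simp [pivotRow]
  refine (Ensures.forTo (n := C) (fun s m' => HasMatrix m' C fun s' j =>
    if s' < s ∨ s' = k then elimStep B k s' j else B s' j) hC (by decide) ?_ ?_ ?_).mono ?_
  · intro s hs j hj
    rw [RamMemory.write_of_ne _ (by decide), hB s hs j hj]
    by_cases h : s = k <;> simp [h, elimStep]
  · intro m1 _ hf1 _
    rw [eval_var, hf1 12 (by decide), h12]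
  · intro m1 s hs hf1 hs1 h1
    have e12 : m1 12 0 = C := by rw [hf1 12 (by decide), h12]
    have e20 : m1 20 0 = k := by rw [hf1 20 (by decide), h20]
    have e21 : m1 21 0 = ((k * C : ℕ) : ℚ) := by rw [hf1 21 (by decide), h21]
    -- the factor
    set φ : ℚ := if s = k then 0 else B s k with hφ
    have hφ1 : m1 7 (s * C + k) = φ := by
      rw [h1 s hs k hk, hφ]
      by_cases h : s = k <;> simp [h, elimStep, hpk]
    refine Ensures.seq (Ensures.set (x := ((s * C : ℕ) : ℚ)) ?_ ?_)
    · simp only [RamExpr.eval, toIndex_zero, Option.bind_some, Option.map_some, hs1, e12,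
        ← Nat.cast_mul]
    refine Ensures.seq (Ensures.set (x := φ) ?_ ?_)
    · simp only [RamExpr.eval, toIndex_zero, Option.bind_some, Option.map_some,
        RamMemory.write_self, Function.update_self,
        RamMemory.write_of_ne _ (show 20 ≠ 24 by decide),
        RamMemory.write_of_ne _ (show 7 ≠ 24 by decide), e20, ← Nat.cast_add, toIndex_natCast, hφ1]
    refine Ensures.seq (Ensures.assign (x := ((s * C + k : ℕ) : ℚ)) (y := 0) ?_ rfl rfl ?_)
    · simp only [RamExpr.eval, toIndex_zero, Option.bind_some, Option.map_some,
        RamMemory.write_apply]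
      simp [e20]
    set m2 := ((m1.write 24 0 ((s * C : ℕ) : ℚ)).write 25 0 φ).write 7 (s * C + k) 0 with hm2
    have f12 : m2 12 0 = C := by simp [hm2, RamMemory.write_apply, e12]
    have f21 : m2 21 0 = ((k * C : ℕ) : ℚ) := by simp [hm2, RamMemory.write_apply, e21]
    have f24 : m2 24 0 = ((s * C : ℕ) : ℚ) := by simp [hm2, RamMemory.write_apply]
    have f25 : m2 25 0 = φ := by simp [hm2, RamMemory.write_apply]
    have f7 : HasMatrix m2 C fun s' j => if s' = s ∧ j = k then 0 else
        if s' < s ∨ s' = k then elimStep B k s' j else B s' j := by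
      intro s' hs' j hj
      simp only [hm2, RamMemory.write_apply, mul_add_inj hj hk, true_and,
        show (7 : ℕ) ≠ 25 by decide, show (7 : ℕ) ≠ 24 by decide, false_and, if_false,
        h1 s' hs' j hj]
    clear_value m2
    refine (Ensures.forTo (n := C) (fun l m' => HasMatrix m' C fun s' j =>
      if s' = s then
        if s = k then pivotRow B k j
        else (if j = k then 0 else B s j) + if j < l then φ * pivotRow B k j else 0
      else if s' < s ∨ s' = k then elimStep B k s' j else B s' j) hC
      (by decide) ?_ ?_ ?_).mono ?_
    · intro s' hs' j hj
      rw [RamMemory.write_of_ne _ (by decide), f7 s' hs' j hj]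
      by_cases h : s' = s
      · by_cases h3 : s = k <;> by_cases h4 : j = k <;> simp [h, h3, h4, elimStep, hpk]
      · simp [h]
    · intro m3 _ hf3 _
      rw [eval_var, hf3 12 (by decide), f12]
    · intro m3 l hl hf3 hl3 h3
      have g21 : m3 21 0 = ((k * C : ℕ) : ℚ) := by rw [hf3 21 (by decide), f21]
      have g24 : m3 24 0 = ((s * C : ℕ) : ℚ) := by rw [hf3 24 (by decide), f24]
      have g25 : m3 25 0 = φ := by rw [hf3 25 (by decide), f25]
      have hpiv : φ * m3 7 (k * C + l) = φ * pivotRow B k l := by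
        by_cases h : s = k
        · simp [hφ, h]
        · rw [h3 k hk l hl]
          simp only [if_neg (Ne.symm h), or_true, if_true, elimStep]
      refine Ensures.assign (x := ((s * C + l : ℕ) : ℚ))
        (y := m3 7 (s * C + l) + φ * pivotRow B k l) ?_ rfl ?_ ?_
      · simp only [RamExpr.eval, toIndex_zero, Option.bind_some, Option.map_some, g24, hl3,
          ← Nat.cast_add]
      · simp only [RamExpr.eval, toIndex_zero, Option.bind_some, Option.map_some, g24, g21, g25,
          hl3, ← Nat.cast_add, toIndex_natCast, hpiv]
      · intro s' hs' j hj
        simp only [RamMemory.write_apply, true_and, mul_add_inj hj hl,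
          show (7 : ℕ) ≠ 26 by decide, false_and, if_false, h3 s' hs' j hj, h3 s hs l hl]
        by_cases h4 : s' = s
        · by_cases h5 : j = l
          · by_cases h6 : s = k <;> simp [h4, h5, h6, hφ]
          · have h6 : j < l + 1 ↔ j < l := by omega
            simp [h4, h5, h6]
        · simp [h4]
    · intro m3 _ h3 s' hs' j hj
      rw [RamMemory.write_of_ne _ (by decide), h3 s' hs' j hj]
      by_cases h4 : s' = s
      · subst h4
        by_cases h5 : s' = k
        · simp [h5, elimStep]
        · by_cases h6 : j = k
          · simp [h5, h6, elimStep, hpk]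
          · simp [h5, h6, elimStep, hφ, hj]
      · have h5 : s' < s + 1 ↔ s' < s := by omega
        simp [h4, h5]
  · intro m1 _ h1 s hs j hj
    rw [h1 s hs j hj]
    simp only [hs, true_or, if_true]

theorem elimProg_ensures {Z C N : ℕ} {B : ℕ → ℕ → ℚ} {m : RamMemory} (hC : C ≤ Z) (hN : N ≤ C)
    (h11 : m 11 0 = (N : ℚ)) (h12 : m 12 0 = (C : ℚ)) (hB : HasMatrix m C B) :
    elimProg.Ensures Z m fun m' => HasMatrix m' C (elim B N) := by
  refine (Ensures.forTo (n := N) (fun k m' => HasMatrix m' C (elim B k)) (hN.trans hC)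
    (by decide) ?_ ?_ ?_).mono fun m' _ h => h
  · intro s hs j hj
    rw [RamMemory.write_of_ne _ (by decide), hB s hs j hj, elim]
  · intro m1 _ hf1 _
    rw [eval_var, hf1 11 (by decide), h11]
  · intro m1 k hk hf1 hk1 h1
    have e12 : m1 12 0 = C := by rw [hf1 12 (by decide), h12]
    refine Ensures.seq' (pivotProg_ensures hC e12 hk1 (hk.trans_le hN) h1) ?_
    intro m2 hf2 ⟨h21, h2⟩
    refine (rowsProg_ensures hC (by rw [hf2 12 (by decide), e12])
      (by rw [hf2 20 (by decide), hk1]) h21 (hk.trans_le hN) h2).mono fun m3 _ h3 => ?_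
    intro s hs j hj
    rw [RamMemory.write_of_ne _ (by decide), h3 s hs j hj, elim]

/-! ## The construction of the chain with unit rewards -/

namespace MarkovChain

variable {n : ℕ} {M : MarkovChain n} {a b : AP} {p : ℚ}

variable (M a b p) in
open Classical in
/-- The memory contains the input. -/
structure HasInput (m : RamMemory) : Prop where
  states : m 0 0 = (n : ℚ)
  threshold : m 0 1 = p
  rew : ∀ s : Fin n, m 1 s = (M.rew s : ℚ)
  left : ∀ s : Fin n, m 2 s = if a ∈ M.label s then 1 else 0
  right : ∀ s : Fin n, m 3 s = if b ∈ M.label s then 1 else 0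
  prob : ∀ s t : Fin n, m 4 (s * n + t) = M.prob s t

theorem HasInput.congr {m m' : RamMemory} (h : M.HasInput a b p m) (hm : ∀ l ≤ 4, m' l = m l) :
    M.HasInput a b p m' := by
  refine ⟨?_, ?_, fun s => ?_, fun s => ?_, fun s => ?_, fun s t => ?_⟩
  · rw [hm 0 (by decide), h.states]
  · rw [hm 0 (by decide), h.threshold]
  · rw [hm 1 (by decide), h.rew]
  · rw [hm 2 (by decide), h.left]
  · rw [hm 3 (by decide), h.right]
  · rw [hm 4 (by decide), h.prob]

theorem hasInput_inputMemory : M.HasInput a b p (inputMemory M a b p) := by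
  refine ⟨by simp [inputMemory], by simp [inputMemory], fun s => ?_, fun s => ?_, fun s => ?_,
    fun s t => ?_⟩
  · simp [inputMemory]
  · simp [inputMemory]
  · simp [inputMemory]
  · have h : (s : ℕ) * n + t < n * n := mul_add_lt_mul s.2 t.2
    have h1 : finProdFinEquiv.symm ⟨(s : ℕ) * n + t, h⟩ = (s, t) := by
      rw [Equiv.symm_apply_eq]
      ext
      simp [mul_comm, add_comm]
    simp only [inputMemory, dif_pos h, h1]

/-- The number of states. -/
abbrev numStates : RamExpr := read 0 (const 0)

theorem HasInput.eval_numStates {m : RamMemory} (h : M.HasInput a b p m) :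
    numStates.eval m = some (n : ℚ) := by
  simp [RamExpr.eval, h.states]

/-- Computation of a bound for the rewards, in variable 10. -/
def boundProg : RamProg :=
  seq (set 10 (const 1)) (forTo 20 numStates
    (ite (var 10) (read 1 (var 20)) (set 10 (read 1 (var 20))) skip))

/-- The maximum starts at 1 rather than 0 because the encoding `s * c + i` requires at least one
copy of each state. -/
theorem boundProg_ensures {Z : ℕ} {m : RamMemory} (hn : n ≤ Z) (h : M.HasInput a b p m) :
    boundProg.Ensures Z m fun m' => ∃ c : ℕ, m' 10 0 = c ∧ 0 < c ∧ (∀ s, M.rew s ≤ c) ∧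
      c ≤ max 1 M.maxReward := by
  refine Ensures.seq (Ensures.set rfl ?_)
  refine (Ensures.forTo (n := n) (fun j m' => ∃ c : ℕ, m' 10 0 = c ∧ 0 < c ∧
    (∀ s : Fin n, (s : ℕ) < j → M.rew s ≤ c) ∧ c ≤ max 1 M.maxReward) hn (by decide) ?_ ?_
    ?_).mono ?_
  · exact ⟨1, by simp [RamMemory.write_apply], one_pos, by simp, le_max_left _ _⟩
  · intro m1 _ hf1 _
    simp [RamExpr.eval, hf1 0 (by decide), RamMemory.write_apply, h.states]
  · rintro m1 j hj hf1 hj1 ⟨c, h1, h2, h3, h4⟩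
    have e1 : m1 1 j = (M.rew ⟨j, hj⟩ : ℚ) := by
      rw [hf1 1 (by decide), RamMemory.write_of_ne _ (by decide)]
      exact h.rew ⟨j, hj⟩
    have e2 : (read 1 (var 20)).eval m1 = some (M.rew ⟨j, hj⟩ : ℚ) := by
      simp [RamExpr.eval, hj1, e1]
    refine Ensures.ite (eval_var _ _) e2 (fun hlt => Ensures.set e2 ?_) fun hlt => Ensures.skip ?_
    · rw [h1, Nat.cast_lt] at hlt
      refine ⟨M.rew ⟨j, hj⟩, by simp [RamMemory.write_apply], by omega, fun s hs => ?_, ?_⟩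
      · rcases Nat.lt_succ_iff_lt_or_eq.1 hs with hs' | rfl
        · exact (h3 s hs').trans hlt.le
        · exact le_rfl
      · exact (Finset.le_sup (f := M.rew) (Finset.mem_univ _)).trans (le_max_right _ _)
    · rw [h1, Nat.cast_lt, not_lt] at hlt
      refine ⟨c, by simp [RamMemory.write_apply, h1], h2, fun s hs => ?_, h4⟩
      rcases Nat.lt_succ_iff_lt_or_eq.1 hs with hs' | rfl
      · exact h3 s hs'
      · exact hlt
  · rintro m1 - ⟨c, h1, h2, h3, h4⟩
    exact ⟨c, h1, h2, fun s => h3 s s.2, h4⟩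

/-- The sizes of the matrices are in the variables. -/
structure HasSizes (N c C : ℕ) (m : RamMemory) : Prop where
  bound : m 10 0 = (c : ℚ)
  states : m 11 0 = (N : ℚ)
  width : m 12 0 = (C : ℚ)

theorem HasSizes.congr {N c C : ℕ} {m m' : RamMemory} (h : HasSizes N c C m)
    (h10 : m' 10 = m 10) (h11 : m' 11 = m 11) (h12 : m' 12 = m 12) : HasSizes N c C m' :=
  ⟨by rw [h10, h.bound], by rw [h11, h.states], by rw [h12, h.width]⟩

/-- Computation of the sizes. -/
def sizesProg : RamProg :=
  seq (set 11 (mul numStates (var 10))) (seq (set 13 (add (var 11) (const 1)))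
    (seq (set 12 (add (var 11) (var 13))) (set 14 (mul (var 13) (var 13)))))

theorem sizesProg_ensures {Z c : ℕ} {m : RamMemory} (h : M.HasInput a b p m)
    (h10 : m 10 0 = (c : ℚ)) :
    sizesProg.Ensures Z m fun m' => HasSizes (n * c) c (n * c + (n * c + 1)) m' ∧
      m' 13 0 = ((n * c + 1 : ℕ) : ℚ) ∧ m' 14 0 = (((n * c + 1) * (n * c + 1) : ℕ) : ℚ) := by
  refine Ensures.seq (Ensures.set (x := ((n * c : ℕ) : ℚ)) ?_ ?_)
  · simp [RamExpr.eval, h.states, h10]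
  refine Ensures.seq (Ensures.set (x := ((n * c + 1 : ℕ) : ℚ)) ?_ ?_)
  · simp [RamExpr.eval, RamMemory.write_apply]
  refine Ensures.seq (Ensures.set (x := ((n * c + (n * c + 1) : ℕ) : ℚ)) ?_ ?_)
  · simp [RamExpr.eval, RamMemory.write_apply]
  refine Ensures.set (x := (((n * c + 1) * (n * c + 1) : ℕ) : ℚ)) ?_ ?_
  · simp [RamExpr.eval, RamMemory.write_apply]
  · exact ⟨⟨by simp [RamMemory.write_apply, h10], by simp [RamMemory.write_apply],
      by simp [RamMemory.write_apply]⟩, by simp [RamMemory.write_apply],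
      by simp [RamMemory.write_apply]⟩

/-- The value at `x` of the linear form given by row `q` of a matrix of width `C`. -/
def rowSum (f : ℕ → ℚ) (C q : ℕ) (x : ℕ → ℝ) : ℝ :=
  ∑ l ∈ Finset.range C, (f (q * C + l) : ℝ) * x l

theorem rowSum_congr {f g : ℕ → ℚ} {C q : ℕ} {x : ℕ → ℝ}
    (h : ∀ l < C, f (q * C + l) = g (q * C + l)) : rowSum f C q x = rowSum g C q x :=
  Finset.sum_congr rfl fun l hl => by rw [h l (Finset.mem_range.1 hl)]

theorem rowSum_update {f : ℕ → ℚ} {C q i : ℕ} {x : ℕ → ℝ} {d : ℚ} (hi : i < C) :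
    rowSum (Function.update f (q * C + i) (f (q * C + i) + d)) C q x =
      rowSum f C q x + d * x i := by
  have h : ∀ l, ((Function.update f (q * C + i) (f (q * C + i) + d) (q * C + l) : ℚ) : ℝ) * x l =
      (f (q * C + l) : ℝ) * x l + if l = i then (d : ℝ) * x i else 0 := by
    intro l
    by_cases hl : l = i
    · subst hl
      simp [add_mul]
    · rw [Function.update_of_ne (by omega)]
      simp [hl]
  rw [rowSum, Finset.sum_congr rfl fun l _ => h l, Finset.sum_add_distrib, Finset.sum_ite_eq',
    if_pos (Finset.mem_range.2 hi), rowSum]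

/-- Adding the transitions of the state in variable 20 to the row that starts at variable 22, with
the offset in variable 23. -/
def transProg : RamProg :=
  forTo 24 numStates (seq (set 25 (add (var 22) (add (mul (var 24) (var 10)) (var 23))))
    (assign 7 (var 25) (add (read 7 (var 25)) (read 4 (add (mul (var 20) numStates) (var 24))))))

/-- Probabilities are added to their cells, so the row, read as a linear form, is a partial sum over
the successors; whether the cells are distinct never has to be examined. -/
theorem transProg_ensures {Z N c C q o : ℕ} {m : RamMemory} (hn : n ≤ Z)
    (h : M.HasInput a b p m) (hs : HasSizes N c C m) (s : Fin n) (h20 : m 20 0 = ((s : ℕ) : ℚ))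
    (h22 : m 22 0 = ((q * C : ℕ) : ℚ)) (h23 : m 23 0 = (o : ℚ))
    (ho : ∀ t : Fin n, (t : ℕ) * c + o < C) (h0 : ∀ l < C, m 7 (q * C + l) = 0) :
    transProg.Ensures Z m fun m' =>
      (∀ x, rowSum (m' 7) C q x = ∑ t : Fin n, (M.prob s t : ℝ) * x (t * c + o)) ∧
      (∀ l < C, 0 ≤ m' 7 (q * C + l)) ∧
      ∀ i, i < q * C ∨ q * C + C ≤ i → m' 7 i = m 7 i := by
  refine (Ensures.forTo (n := n) (fun j m' =>
      (∀ x, rowSum (m' 7) C q x = ∑ t ∈ Finset.range j, (m 4 (s * n + t) : ℝ) * x (t * c + o)) ∧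
      (∀ l < C, 0 ≤ m' 7 (q * C + l)) ∧
      ∀ i, i < q * C ∨ q * C + C ≤ i → m' 7 i = m 7 i) hn (by decide) ?_ ?_ ?_).mono ?_
  · rw [RamMemory.write_of_ne _ (by decide)]
    refine ⟨fun x => ?_, fun l hl => (h0 l hl).ge, fun _ _ => rfl⟩
    rw [rowSum, Finset.sum_range_zero]
    exact Finset.sum_eq_zero fun l hl => by rw [h0 l (Finset.mem_range.1 hl)]; simp
  · intro m1 _ hf1 _
    exact (h.congr fun l hl => hf1 l (by interval_cases l <;> decide)).eval_numStates
  · rintro m1 j hj hf1 hj1 ⟨h1, h2, h3⟩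
    have hinp : M.HasInput a b p m1 := h.congr fun l hl => hf1 l (by interval_cases l <;> decide)
    have e20 : m1 20 0 = ((s : ℕ) : ℚ) := by rw [hf1 20 (by decide), h20]
    have e22 : m1 22 0 = ((q * C : ℕ) : ℚ) := by rw [hf1 22 (by decide), h22]
    have e23 : m1 23 0 = (o : ℚ) := by rw [hf1 23 (by decide), h23]
    have e10 : m1 10 0 = (c : ℚ) := by rw [hf1 10 (by decide), hs.bound]
    have hoj := ho ⟨j, hj⟩
    simp only at hoj
    refine Ensures.seq (Ensures.set (x := ((q * C + (j * c + o) : ℕ) : ℚ)) ?_ ?_)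
    · simp only [RamExpr.eval, toIndex_zero, Option.bind_some, Option.map_some, e22, e23, e10, hj1,
        ← Nat.cast_add, ← Nat.cast_mul]
    refine Ensures.assign (j := q * C + (j * c + o))
      (y := m1 7 (q * C + (j * c + o)) + m 4 (s * n + j)) (eval_var _ _) ?_ ?_ ?_
    · simp [RamMemory.write_apply]
    · simp only [RamExpr.eval, toIndex_zero, Option.bind_some, Option.map_some,
        RamMemory.write_self, Function.update_self,
        RamMemory.write_of_ne _ (show 20 ≠ 25 by decide),
        RamMemory.write_of_ne _ (show 0 ≠ 25 by decide),
        RamMemory.write_of_ne _ (show 24 ≠ 25 by decide),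
        RamMemory.write_of_ne _ (show 4 ≠ 25 by decide),
        RamMemory.write_of_ne _ (show 7 ≠ 25 by decide), e20, hinp.states, hj1,
        ← Nat.cast_add, ← Nat.cast_mul, toIndex_natCast]
      rw [hf1 4 (by decide)]
    · rw [RamMemory.write_of_ne _ (by decide), RamMemory.write_self,
        RamMemory.write_of_ne _ (by decide)]
      refine ⟨fun x => ?_, fun l hl => ?_, fun i hi => ?_⟩
      · rw [rowSum_update hoj, h1, Finset.sum_range_succ]
      · rw [Function.update_apply]
        split_ifs
        · refine add_nonneg (h2 _ hoj) ?_
          have := h.prob s ⟨j, hj⟩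
          simp only at this
          rw [this]
          exact M.prob_nonneg _ _
        · exact h2 l hl
      · rw [Function.update_of_ne (by omega), h3 i hi]
  · rintro m1 - ⟨h1, h2, h3⟩
    refine ⟨fun x => ?_, h2, h3⟩
    rw [h1, Finset.sum_range]
    exact Finset.sum_congr rfl fun t _ => by rw [h.prob]

/-- The row of the state in variable 20. -/
def rowProg : RamProg :=
  seq (set 21 (mul (var 20) (var 10))) (seq (set 22 (mul (var 21) (var 12)))
    (ite (const 0) (read 3 (var 20))
      (assign 7 (add (var 22) (add (var 11) (var 11))) (const 1))
      (ite (const 0) (read 2 (var 20))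
        (seq (ite (read 1 (var 20)) (const 1) (set 23 (const 0))
          (set 23 (add (var 11) (sub (read 1 (var 20)) (const 1))))) transProg)
        skip)))

theorem rowProg_ensures {Z c : ℕ} {m : RamMemory} (hn : n ≤ Z) (hc : 0 < c)
    (hrew : ∀ s, M.rew s ≤ c) (h : M.HasInput a b p m)
    (hs : HasSizes (n * c) c (n * c + (n * c + 1)) m) (s : Fin n) (h20 : m 20 0 = ((s : ℕ) : ℚ))
    (h0 : ∀ i, (s * c) * (n * c + (n * c + 1)) ≤ i → m 7 i = 0) :
    rowProg.Ensures Z m fun m' => m' 21 0 = ((s * c : ℕ) : ℚ) ∧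
      (∀ x, rowSum (m' 7) (n * c + (n * c + 1)) (s * c) x = M.unitRow a b c s 0 x) ∧
      (∀ l < n * c + (n * c + 1), 0 ≤ m' 7 (s * c * (n * c + (n * c + 1)) + l)) ∧
      ∀ i, i < s * c * (n * c + (n * c + 1)) ∨
        s * c * (n * c + (n * c + 1)) + (n * c + (n * c + 1)) ≤ i → m' 7 i = m 7 i := by
  classical
  set C := n * c + (n * c + 1) with hC
  refine Ensures.seq (Ensures.set (x := ((s * c : ℕ) : ℚ)) ?_ ?_)
  · simp [RamExpr.eval, h20, hs.bound]
  refine Ensures.seq (Ensures.set (x := ((s * c * C : ℕ) : ℚ)) ?_ ?_)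
  · simp only [RamExpr.eval, toIndex_zero, Option.bind_some, Option.map_some,
      RamMemory.write_self, Function.update_self, RamMemory.write_of_ne _ (show 12 ≠ 21 by decide),
      hs.width, ← Nat.cast_mul]
  set m1 := (m.write 21 0 ((s * c : ℕ) : ℚ)).write 22 0 ((s * c * C : ℕ) : ℚ) with hm1
  have e : ∀ l, l ≠ 21 → l ≠ 22 → m1 l = m l := fun l h21 h22 => by
    rw [hm1, RamMemory.write_of_ne _ h22, RamMemory.write_of_ne _ h21]
  have e21 : m1 21 0 = ((s * c : ℕ) : ℚ) := by simp [hm1, RamMemory.write_apply]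
  have e22 : m1 22 0 = ((s * c * C : ℕ) : ℚ) := by simp [hm1, RamMemory.write_apply]
  have e7 : m1 7 = m 7 := e 7 (by decide) (by decide)
  have hinp : M.HasInput a b p m1 := h.congr fun l hl => e l (by omega) (by omega)
  have hsz : HasSizes (n * c) c C m1 :=
    hs.congr (e 10 (by decide) (by decide)) (e 11 (by decide) (by decide))
      (e 12 (by decide) (by decide))
  have e20 : m1 20 0 = ((s : ℕ) : ℚ) := by rw [e 20 (by decide) (by decide), h20]
  clear_value m1
  have hzero : ∀ x, rowSum (m 7) C (s * c) x = 0 := fun x =>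
    Finset.sum_eq_zero fun l _ => by rw [h0 _ (by omega)]; simp
  refine Ensures.ite (y := if b ∈ M.label s then 1 else 0) rfl ?_ (fun hlt => ?_) fun hlt => ?_
  · simp [RamExpr.eval, e20, hinp.right]
  · have hb : b ∈ M.label s := by
      by_contra hb
      simp [hb] at hlt
    have hlt : n * c + n * c < C := by omega
    refine Ensures.assign (x := ((s * c * C + (n * c + n * c) : ℕ) : ℚ)) (y := m 7 (s * c * C +
      (n * c + n * c)) + 1) ?_ rfl ?_ ?_
    · simp only [RamExpr.eval, toIndex_zero, Option.bind_some, Option.map_some, e22, hsz.states,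
        ← Nat.cast_add]
    · rw [h0 _ (by omega), zero_add]
      rfl
    · rw [RamMemory.write_self, RamMemory.write_of_ne _ (by decide), e7]
      refine ⟨e21, fun x => ?_, fun l hl => ?_, fun i hi => ?_⟩
      · rw [rowSum_update hlt, hzero, unitRow, if_neg (lt_irrefl 0), if_pos hb]
        simp
      · rw [Function.update_apply, h0 _ (by omega), h0 _ (by omega)]
        split_ifs <;> norm_num
      · rw [Function.update_of_ne (by omega)]
  · have hb : b ∉ M.label s := by
      intro hb
      simp [hb] at hlt
    refine Ensures.ite (y := if a ∈ M.label s then 1 else 0) rfl ?_ (fun hlt => ?_) fun hlt => ?_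
    · simp [RamExpr.eval, e20, hinp.left]
    · have ha : a ∈ M.label s := by
        by_contra ha
        simp [ha] at hlt
      have e1 : (read 1 (var 20)).eval m1 = some (M.rew s : ℚ) := by
        simp [RamExpr.eval, e20, hinp.rew]
      -- The two cases of the reward differ only in the offset: 0 on the same level, `n * c + (M.rew
      -- s - 1)` on the level below.
      have key : ∀ o : ℕ, (∀ t : Fin n, (t : ℕ) * c + o < C) →
          (∀ x, ∑ t : Fin n, (M.prob s t : ℝ) * x (t * c + o) = M.unitRow a b c s 0 x) →
          transProg.Ensures Z (m1.write 23 0 (o : ℚ)) fun m' => m' 21 0 = ((s * c : ℕ) : ℚ) ∧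
            (∀ x, rowSum (m' 7) C (s * c) x = M.unitRow a b c s 0 x) ∧
            (∀ l < C, 0 ≤ m' 7 (s * c * C + l)) ∧
            ∀ i, i < s * c * C ∨ s * c * C + C ≤ i → m' 7 i = m 7 i := by
        intro o ho hx
        refine (transProg_ensures hn (hinp.congr fun l hl => RamMemory.write_of_ne _ (by omega) _ _)
          (hsz.congr (RamMemory.write_of_ne _ (by decide) _ _)
            (RamMemory.write_of_ne _ (by decide) _ _) (RamMemory.write_of_ne _ (by decide) _ _)) s
          (q := s * c) (o := o) ?_ ?_ ?_ ho ?_).mono ?_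
        · rw [RamMemory.write_of_ne _ (by decide), e20]
        · rw [RamMemory.write_of_ne _ (by decide), e22]
        · simp [RamMemory.write_apply]
        · intro l _
          rw [RamMemory.write_of_ne _ (by decide), e7, h0 _ (by omega)]
        · rintro m2 hf2 ⟨h1, h2, h3⟩
          refine ⟨?_, fun x => by rw [h1, hx], h2, fun i hi => ?_⟩
          · rw [hf2 21 (by decide), RamMemory.write_of_ne _ (by decide), e21]
          · rw [h3 i hi, RamMemory.write_of_ne _ (by decide), e7]
      refine Ensures.seq (Ensures.ite e1 rfl (fun hr => ?_) fun hr => ?_)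
      · have hr0 : M.rew s = 0 := Nat.lt_one_iff.1 (by exact_mod_cast hr)
        refine Ensures.set rfl ?_
        have := key 0 (fun t => ?_) fun x => ?_
        · simpa using this
        · have := mul_add_lt t hc
          omega
        · rw [unitRow, if_neg (lt_irrefl 0), if_neg hb, if_pos ha, if_pos hr0]
          rfl
      · have hr0 : 1 ≤ M.rew s := by exact_mod_cast not_lt.1 hr
        refine Ensures.set (x := ((n * c + (M.rew s - 1) : ℕ) : ℚ)) ?_ (key _ (fun t => ?_)
          fun x => ?_)
        · have e2 : (sub (read 1 (var 20)) (const 1)).eval m1 = some ((M.rew s : ℚ) - 1) := by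
            rw [RamExpr.eval, e1]
            rfl
          rw [RamExpr.eval, eval_var, e2, hsz.states]
          push_cast [hr0]
          rfl
        · have h1 := hrew s
          have := mul_add_lt (i := M.rew s - 1) t (c := c) (by omega)
          omega
        · rw [unitRow, if_neg (lt_irrefl 0), if_neg hb, if_pos ha, if_neg (by omega)]
          refine Finset.sum_congr rfl fun t _ => ?_
          congr 2
          ring
    · have ha : a ∉ M.label s := by
        intro ha
        simp [ha] at hlt
      refine Ensures.skip ⟨e21, fun x => ?_, fun l _ => ?_, fun i _ => by rw [e7]⟩
      · rw [e7, hzero, unitRow, if_neg (lt_irrefl 0), if_neg hb, if_neg ha]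
      · rw [e7, h0 _ (by omega)]

/-- The rows of the states in which reward has to be earned. -/
def delayProg : RamProg :=
  seq (set 26 (sub (var 10) (const 1))) (forTo 24 (var 26)
    (assign 7 (add (mul (add (add (var 21) (var 24)) (const 1)) (var 12))
      (add (var 11) (add (var 21) (var 24)))) (const 1)))

theorem delayProg_ensures {Z N c C q : ℕ} {m : RamMemory} (hcZ : c ≤ Z) (hc : 0 < c)
    (hs : HasSizes N c C m) (h21 : m 21 0 = (q : ℚ)) :
    delayProg.Ensures Z m fun m' => ∀ x, m' 7 x =
      if ∃ i < c - 1, x = (q + i + 1) * C + (N + (q + i)) then 1 else m 7 x := by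
  refine Ensures.seq (Ensures.set (x := ((c - 1 : ℕ) : ℚ)) ?_ ?_)
  · simp only [RamExpr.eval, toIndex_zero, Option.bind_some, Option.map_some, hs.bound]
    push_cast [Nat.succ_le_of_lt hc]
    rfl
  refine (Ensures.forTo (n := c - 1) (fun j m' => ∀ x, m' 7 x =
      if ∃ i < j, x = (q + i + 1) * C + (N + (q + i)) then 1 else m 7 x)
    ((Nat.sub_le _ _).trans hcZ) (by decide) ?_ ?_ ?_).mono fun m' _ h => h
  · intro x
    simp [RamMemory.write_apply]
  · intro m1 _ hf1 _
    rw [eval_var, hf1 26 (by decide)]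
    simp [RamMemory.write_apply]
  · intro m1 j hj hf1 hj1 h1
    have e : ∀ l, l ≠ 26 → l ≠ 24 → l ≠ 7 → m1 l = m l := fun l h26 h24 h7 => by
      rw [hf1 l (by simp [forTo, Writes, h24, h7]), RamMemory.write_of_ne _ h26]
    refine Ensures.assign (x := (((q + j + 1) * C + (N + (q + j)) : ℕ) : ℚ)) ?_ rfl rfl ?_
    · simp only [RamExpr.eval, toIndex_zero, Option.bind_some, Option.map_some, hj1,
        e 21 (by decide) (by decide) (by decide), e 12 (by decide) (by decide) (by decide),
        e 11 (by decide) (by decide) (by decide), hs.states, hs.width, h21]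
      push_cast
      rfl
    · intro x
      rw [RamMemory.write_of_ne _ (by decide), RamMemory.write_self, Function.update_apply, h1]
      by_cases hx : x = (q + j + 1) * C + (N + (q + j))
      · rw [if_pos hx, if_pos ⟨j, Nat.lt_succ_self j, hx⟩]
      · rw [if_neg hx]
        refine if_congr ⟨?_, ?_⟩ rfl rfl
        · rintro ⟨i, hi, h⟩
          exact ⟨i, by omega, h⟩
        · rintro ⟨i, hi, h⟩
          rcases Nat.lt_succ_iff_lt_or_eq.1 hi with hi' | rfl
          · exact ⟨i, hi', h⟩
          · exact absurd h hx

/-- Construction of the transition matrix. -/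
def buildProg : RamProg :=
  seq (forTo 20 numStates (seq rowProg delayProg))
    (assign 7 (add (mul (var 11) (var 12)) (add (var 11) (var 11))) (const 1))

theorem buildProg_ensures {Z c : ℕ} {m : RamMemory} (hn : n ≤ Z) (hcZ : c ≤ Z) (hc : 0 < c)
    (hrew : ∀ s, M.rew s ≤ c) (h : M.HasInput a b p m)
    (hs : HasSizes (n * c) c (n * c + (n * c + 1)) m) (h0 : ∀ i, m 7 i = 0) :
    buildProg.Ensures Z m fun m' =>
      M.IsUnitMatrix a b c fun q j => m' 7 (q * (n * c + (n * c + 1)) + j) := by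
  set C := n * c + (n * c + 1) with hC
  -- Rows not yet reached must be known to be zero, since `rowProg` accumulates into its row and
  -- `delayProg` sets only one entry per row.
  refine Ensures.seq' (Ensures.forTo (n := n) (fun j m' =>
    (∀ x, 0 ≤ m' 7 x) ∧ (∀ x, (j * c) * C ≤ x → m' 7 x = 0) ∧
    ∀ s : Fin n, (s : ℕ) < j → ∀ i < c, ∀ x, rowSum (m' 7) C (s * c + i) x =
      M.unitRow a b c s i x) hn (by decide) ?_ ?_ ?_) ?_
  · rw [RamMemory.write_of_ne _ (by decide)]
    exact ⟨fun x => (h0 x).ge, fun x _ => h0 x, by simp⟩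
  · intro m1 _ hf1 _
    exact (h.congr fun l hl => hf1 l (by interval_cases l <;> decide)).eval_numStates
  · rintro m1 j hj hf1 hj1 ⟨h1, h2, h3⟩
    have hsz1 : HasSizes (n * c) c C m1 :=
      hs.congr (hf1 10 (by decide)) (hf1 11 (by decide)) (hf1 12 (by decide))
    refine Ensures.seq' (rowProg_ensures hn hc hrew
      (h.congr fun l hl => hf1 l (by interval_cases l <;> decide)) hsz1 ⟨j, hj⟩ hj1 h2) ?_
    rw [← hC]
    simp only
    rintro m2 hf2 ⟨g1, g2, g3, g4⟩
    refine (delayProg_ensures hcZ hc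
      (hsz1.congr (hf2 10 (by decide)) (hf2 11 (by decide)) (hf2 12 (by decide))) g1).mono ?_
    intro m3 _ h4
    rw [RamMemory.write_of_ne _ (by decide)]
    have hjc : j * c + c ≤ n * c := by
      rw [← Nat.succ_mul]
      exact Nat.mul_le_mul_right _ hj
    -- a cell in a given row of the matrix
    have hcell : ∀ r l, l < C → m3 7 (r * C + l) =
        if ∃ i < c - 1, r = j * c + i + 1 ∧ l = n * c + (j * c + i) then 1
        else m2 7 (r * C + l) := by
      intro r l hl
      rw [h4]
      refine if_congr ?_ rfl rfl
      refine exists_congr fun i => and_congr_right fun hi => mul_add_inj hl (by omega)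
    have h2' : ∀ r l, j * c < r → l < C → m2 7 (r * C + l) = 0 := by
      intro r l hr hl
      have : (j * c + 1) * C ≤ r * C := Nat.mul_le_mul_right _ hr
      rw [Nat.succ_mul] at this
      rw [g4 _ (Or.inr (by omega)), h2 _ (by omega)]
    refine ⟨fun x => ?_, fun x hx => ?_, fun s hs' i hi x => ?_⟩
    · rw [h4]
      split_ifs
      · exact zero_le_one
      · by_cases hx : x < j * c * C ∨ j * c * C + C ≤ x
        · rw [g4 x hx]
          exact h1 x
        · have := g3 (x - j * c * C) (by omega)
          rwa [Nat.add_sub_cancel' (by omega)] at this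
    · have hCpos : 0 < C := by omega
      have hx1 : x = x / C * C + x % C := (Nat.div_add_mod' x C).symm
      have hr : j * c + c ≤ x / C := by
        rw [Nat.le_div_iff_mul_le hCpos]
        refine le_trans (le_of_eq ?_) hx
        ring
      rw [hx1, hcell _ _ (Nat.mod_lt _ hCpos), if_neg, h2' _ _ (by omega) (Nat.mod_lt _ hCpos)]
      rintro ⟨i, hi, h5, -⟩
      omega
    · rcases Nat.lt_succ_iff_lt_or_eq.1 hs' with hlt | heq
      · rw [← h3 s hlt i hi x]
        have hle : (s : ℕ) * c + c ≤ j * c := by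
          rw [← Nat.succ_mul]
          exact Nat.mul_le_mul_right _ hlt
        refine rowSum_congr fun l hl => ?_
        rw [hcell _ _ hl, if_neg, g4]
        · left
          have : (s * c + i + 1) * C ≤ j * c * C := Nat.mul_le_mul_right _ (by omega)
          rw [Nat.succ_mul] at this
          omega
        · rintro ⟨i', _, h5, -⟩
          omega
      · have hsj : s = ⟨j, hj⟩ := Fin.ext heq
        subst hsj
        simp only
        rcases Nat.eq_zero_or_pos i with rfl | hi0
        · rw [← g2 x]
          refine rowSum_congr fun l hl => ?_
          rw [add_zero, hcell _ _ hl, if_neg]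
          rintro ⟨i', _, h5, -⟩
          omega
        · rw [unitRow, if_pos hi0, rowSum, Finset.sum_eq_single (n * c + (j * c + (i - 1)))]
          · rw [hcell _ _ (by omega), if_pos ⟨i - 1, by omega, by omega, rfl⟩]
            simp
          · intro l hl hne
            rw [hcell _ _ (Finset.mem_range.1 hl), if_neg, h2' _ _ (by omega)
              (Finset.mem_range.1 hl)]
            · simp
            · rintro ⟨i', _, h5, h6⟩
              exact hne (by omega)
          · intro hl
            exact absurd (Finset.mem_range.2 (by omega)) hl
  · rintro m1 hf1 ⟨h1, h2, h3⟩
    -- The row of the goal: a single 1 in the column of the constant, which becomes the diagonal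
    -- entry of the absorbing state in the reduced matrix.
    refine Ensures.assign (x := ((n * c * C + (n * c + n * c) : ℕ) : ℚ)) (y := 1) ?_ rfl rfl ?_
    · simp only [RamExpr.eval, toIndex_zero, Option.bind_some, Option.map_some,
        hf1 11 (by decide), hf1 12 (by decide), hs.states, hs.width, ← Nat.cast_add,
        ← Nat.cast_mul]
    · rw [RamMemory.write_self]
      have hlt : n * c + n * c < C := by omega
      refine ⟨fun q _ l _ => ?_, fun s i hi x => ?_, fun l hl => ?_, fun q hq _ l hl => ?_⟩
      · rw [Function.update_apply]
        split_ifs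
        · exact zero_le_one
        · exact h1 _
      · rw [← h3 s s.2 i hi x]
        refine rowSum_congr fun l hl => ?_
        rw [Function.update_of_ne]
        rw [Ne, mul_add_inj hl hlt]
        have := mul_add_lt s hi
        omega
      · have : (n * c * C + l = n * c * C + (n * c + n * c)) ↔ l = n * c + n * c := by omega
        rw [Function.update_apply, h2 _ (by omega)]
        exact if_congr this rfl rfl
      · rw [Function.update_of_ne, h2]
        · exact (Nat.mul_le_mul_right _ hq.le).trans (Nat.le_add_right _ _)
        · rw [Ne, mul_add_inj hl hlt]
          omega

end MarkovChain

/-! ## Preparation of the matrices -/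

namespace MarkovChain

/-- Storing the identity and the reduced matrix in array 8; the reduced matrix is also copied to
array 7. -/
def copyProg : RamProg :=
  seq (forTo 20 (var 13) (assign 8 (add (mul (var 20) (var 13)) (var 20)) (const 1)))
    (seq (forTo 20 (var 13) (forTo 21 (var 13)
        (assign 8 (add (var 14) (add (mul (var 20) (var 13)) (var 21)))
          (read 7 (add (mul (var 20) (var 12)) (add (var 11) (var 21)))))))
      (seq (forTo 20 (var 13) (forTo 21 (var 13)
          (assign 7 (add (mul (var 20) (var 13)) (var 21))
            (read 8 (add (var 14) (add (mul (var 20) (var 13)) (var 21)))))))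
        (seq (set 12 (var 13)) (seq (set 15 (var 14)) (seq (set 16 (const 1))
          (set 17 (const 0)))))))

theorem copyProg_ensures {Z N c : ℕ} {E : ℕ → ℕ → ℚ} {m : RamMemory} (hK : N + 1 ≤ Z)
    (hs : HasSizes N c (N + (N + 1)) m) (h13 : m 13 0 = ((N + 1 : ℕ) : ℚ))
    (h14 : m 14 0 = (((N + 1) * (N + 1) : ℕ) : ℚ)) (h8 : ∀ x, m 8 x = 0)
    (hE : HasMatrix m (N + (N + 1)) E) :
    copyProg.Ensures Z m fun m' => m' 12 0 = ((N + 1 : ℕ) : ℚ) ∧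
      HasMatrix m' (N + 1) (fun i j => E i (N + j)) ∧
      HasPowers (toMatrix (N + 1) fun i j => E i (N + j)) 0 m' := by
  set K := N + 1 with hKN
  refine Ensures.seq' (Ensures.forTo (n := K) (fun l m' => ∀ i < K, ∀ j < K,
    m' 8 (i * K + j) = if i = j ∧ i < l then 1 else 0) hK (by decide) ?_ ?_ ?_) ?_
  · intro i _ j _
    simp [RamMemory.write_apply, h8]
  · intro m1 _ hf1 _
    rw [eval_var, hf1 13 (by decide), h13]
  · intro m1 l hl hf1 hl1 h1
    refine Ensures.assign (x := ((l * K + l : ℕ) : ℚ)) ?_ rfl rfl ?_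
    · simp only [RamExpr.eval, toIndex_zero, Option.bind_some, Option.map_some, hl1,
        hf1 13 (by decide), h13, ← Nat.cast_add, ← Nat.cast_mul]
    · intro i hi j hj
      rw [RamMemory.write_of_ne _ (by decide), RamMemory.write_self, Function.update_apply,
        h1 i hi j hj]
      simp only [mul_add_inj hj hl]
      by_cases h : i = l ∧ j = l
      · rw [if_pos h, if_pos (by omega)]
      · rw [if_neg h]
        exact if_congr (by omega) rfl rfl
  intro m1 hf1 h1
  refine Ensures.seq' (Ensures.fill (D := 8) (K := K) (base := K * K) (fun i j => E i (N + j)) hK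
    (by decide) (by decide) (by decide) (by decide) ?_ ?_) ?_
  · intro m2 hf2
    rw [eval_var, hf2 13 (by decide), hf1 13 (by decide), h13]
  · intro m2 i j hi hj hf2 hi2 hj2 _
    have e : ∀ l, l ≠ 8 → l ≠ 20 → l ≠ 21 → m2 l = m l := fun l h8 h20 h21 => by
      rw [hf2 l (by simp [forTo, Writes, h8, h20, h21]), hf1 l (by simp [forTo, Writes, h8, h20])]
    refine Ensures.assign (x := ((K * K + (i * K + j) : ℕ) : ℚ)) (y := E i (N + j)) ?_ rfl ?_ ?_
    · simp only [RamExpr.eval, toIndex_zero, Option.bind_some, Option.map_some, hi2, hj2,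
        e 13 (by decide) (by decide) (by decide), e 14 (by decide) (by decide) (by decide), h13,
        h14, ← Nat.cast_add, ← Nat.cast_mul]
    · simp only [RamExpr.eval, toIndex_zero, Option.bind_some, Option.map_some, hi2, hj2,
        e 12 (by decide) (by decide) (by decide), e 11 (by decide) (by decide) (by decide),
        e 7 (by decide) (by decide) (by decide), hs.width, hs.states, ← Nat.cast_add,
        ← Nat.cast_mul, toIndex_natCast]
      rw [hE i (by omega) (N + j) (by omega)]
    · intro x
      rw [RamMemory.write_self, Function.update_apply]
  rintro m2 hf2 ⟨h2, h2'⟩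
  have e2 : ∀ l, l ≠ 8 → l ≠ 20 → l ≠ 21 → m2 l = m l := fun l h8 h20 h21 => by
    rw [hf2 l (by simp [forTo, Writes, h8, h20, h21]), hf1 l (by simp [forTo, Writes, h8, h20])]
  refine Ensures.seq' (Ensures.fill (D := 7) (K := K) (base := 0) (fun i j => E i (N + j)) hK
    (by decide) (by decide) (by decide) (by decide) ?_ ?_) ?_
  · intro m3 hf3
    rw [eval_var, hf3 13 (by decide), e2 13 (by decide) (by decide) (by decide), h13]
  · intro m3 i j hi hj hf3 hi3 hj3 _
    have e : ∀ l, l ≠ 7 → l ≠ 20 → l ≠ 21 → m3 l = m2 l := fun l h7 h20 h21 => by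
      rw [hf3 l (by simp [forTo, Writes, h7, h20, h21])]
    have e13 : m3 13 0 = (K : ℚ) := by
      rw [e 13 (by decide) (by decide) (by decide), e2 13 (by decide) (by decide) (by decide), h13]
    have e14 : m3 14 0 = ((K * K : ℕ) : ℚ) := by
      rw [e 14 (by decide) (by decide) (by decide), e2 14 (by decide) (by decide) (by decide), h14]
    refine Ensures.assign (x := ((i * K + j : ℕ) : ℚ)) (y := E i (N + j)) ?_ rfl ?_ ?_
    · simp only [RamExpr.eval, toIndex_zero, Option.bind_some, Option.map_some, hi3, hj3, e13,
        ← Nat.cast_add, ← Nat.cast_mul]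
    · simp only [RamExpr.eval, toIndex_zero, Option.bind_some, Option.map_some, hi3, hj3, e13, e14,
        ← Nat.cast_add, ← Nat.cast_mul, toIndex_natCast]
      rw [e 8 (by decide) (by decide) (by decide), h2 i hi j hj]
    · intro x
      rw [RamMemory.write_self, Function.update_apply, zero_add]
  rintro m3 hf3 ⟨h3, -⟩
  have e3 : ∀ l, l ≠ 7 → l ≠ 20 → l ≠ 21 → m3 l = m2 l := fun l h7 h20 h21 => by
    rw [hf3 l (by simp [forTo, Writes, h7, h20, h21])]
  have e13 : m3 13 0 = (K : ℚ) := by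
    rw [e3 13 (by decide) (by decide) (by decide), e2 13 (by decide) (by decide) (by decide), h13]
  have e14 : m3 14 0 = ((K * K : ℕ) : ℚ) := by
    rw [e3 14 (by decide) (by decide) (by decide), e2 14 (by decide) (by decide) (by decide), h14]
  refine Ensures.seq (Ensures.set (eval_var _ _) (Ensures.seq (Ensures.set (eval_var _ _)
    (Ensures.seq (Ensures.set rfl (Ensures.set rfl ?_))))))
  have e8 : ∀ d, slot ((((m3.write 12 0 (m3 13 0)).write 15 0
      (m3.write 12 0 (m3 13 0) 14 0)).write 16 0 1).write 17 0 0) K d = slot m2 K d := fun d =>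
    slot_congr' (by simp only [RamMemory.write_of_ne _ (show (8 : ℕ) ≠ 17 by decide),
      RamMemory.write_of_ne _ (show (8 : ℕ) ≠ 16 by decide),
      RamMemory.write_of_ne _ (show (8 : ℕ) ≠ 15 by decide),
      RamMemory.write_of_ne _ (show (8 : ℕ) ≠ 12 by decide),
      e3 8 (by decide) (by decide) (by decide)])
  refine ⟨by simp [RamMemory.write_apply, e13], fun i hi j hj => ?_, ?_, ?_, ?_, ?_, ?_, ?_,
    fun i hi => ?_⟩
  · have := h3 i hi j hj
    rw [zero_add] at this
    simp [RamMemory.write_apply, this]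
  · simp [RamMemory.write_apply, e13]
  · simp [RamMemory.write_apply, e14]
  · simp [RamMemory.write_apply, e14]
  · simp [RamMemory.write_apply]
  · simp [RamMemory.write_apply]
  · rw [e8]
    ext i j
    rw [slot, Matrix.of_apply, zero_add, h2' _ (Or.inl (mul_add_lt_mul i.2 j.2)),
      h1 i i.2 j j.2, Matrix.one_apply]
    exact if_congr (by simp [Fin.ext_iff]) rfl rfl
  · obtain rfl : i = 0 := Nat.le_zero.1 hi
    rw [e8, zero_add, one_mul, pow_zero, pow_one]
    ext i j
    rw [slot, Matrix.of_apply, h2 i i.2 j j.2]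
    rfl

variable {n : ℕ} {M : MarkovChain n} {a b : AP} {p : ℚ}

variable (M a b p) in
/-- The memory contains the input, the probabilities of `a U b`, and powers of the reduced
transition matrix. -/
structure IsPrepared (A : ℕ → ℕ → ℚ) (c J : ℕ) (m : RamMemory) : Prop where
  input : M.HasInput a b p m
  bound : m 10 0 = (c : ℚ)
  states : m 11 0 = ((n * c : ℕ) : ℚ)
  reach : ∀ s : Fin n, ((m 7 (s * c * (n * c + 1) + n * c) : ℚ) : ℝ) = M.reachProb a b s
  powers : HasPowers (toMatrix (n * c + 1) (reduced A (n * c))) J m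

/-- Preparation of the search for the values. -/
def prepProg : RamProg :=
  seq boundProg (seq sizesProg (seq buildProg (seq elimProg (seq copyProg (seq elimProg
    (loop (var 16) (var 13) squareProg))))))

/-- The first elimination removes the transitions without reward, the second one computes the
unbounded probabilities. The final squarings provide a power with exponent at least `n * c`, as
`not_holds` requires. -/
theorem prepProg_ensures {Z : ℕ} {m : RamMemory} (hn : n ≤ Z)
    (hZ : 2 * (n * max 1 M.maxReward) + 1 ≤ Z) (hZ' : max 1 M.maxReward ≤ Z)
    (h : M.HasInput a b p m) (h7 : ∀ x, m 7 x = 0) (h8 : ∀ x, m 8 x = 0) :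
    prepProg.Ensures Z m fun m' => ∃ A c J, 0 < c ∧ (∀ s, M.rew s ≤ c) ∧
      c ≤ max 1 M.maxReward ∧ M.IsUnitMatrix a b c A ∧ J ≤ n * c + 1 ∧ n * c + 1 ≤ 2 ^ J ∧
      M.IsPrepared a b p A c J m' := by
  refine Ensures.seq' (boundProg_ensures hn h) ?_
  rintro m1 hf1 ⟨c, e10, hc, hrew, hcM⟩
  have hnc : n * c ≤ n * max 1 M.maxReward := Nat.mul_le_mul_left _ hcM
  refine Ensures.seq' (sizesProg_ensures
    (h.congr fun l hl => hf1 l (by interval_cases l <;> decide)) e10) ?_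
  rintro m2 hf2 ⟨hs2, e13, e14⟩
  have hin2 : M.HasInput a b p m2 := h.congr fun l hl => by
    rw [hf2 l (by interval_cases l <;> decide), hf1 l (by interval_cases l <;> decide)]
  refine Ensures.seq' (buildProg_ensures hn (hcM.trans hZ') hc hrew hin2 hs2 fun x => by
    rw [hf2 7 (by decide), hf1 7 (by decide), h7]) ?_
  intro m3 hf3 hA
  set A : ℕ → ℕ → ℚ := fun q j => m3 7 (q * (n * c + (n * c + 1)) + j) with hAdef
  have hs3 := hs2.congr (hf3 10 (by decide)) (hf3 11 (by decide)) (hf3 12 (by decide))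
  refine Ensures.seq' (elimProg_ensures (B := A) (by omega) (Nat.le_add_right _ _) hs3.states
    hs3.width fun _ _ _ _ => rfl) ?_
  intro m4 hf4 h4
  have hs4 := hs3.congr (hf4 10 (by decide)) (hf4 11 (by decide)) (hf4 12 (by decide))
  refine Ensures.seq' (copyProg_ensures (by omega) hs4
    (by rw [hf4 13 (by decide), hf3 13 (by decide), e13])
    (by rw [hf4 14 (by decide), hf3 14 (by decide), e14]) (fun x => by
      rw [hf4 8 (by decide), hf3 8 (by decide), hf2 8 (by decide), hf1 8 (by decide), h8]) h4) ?_
  rintro m5 hf5 ⟨e12, h5, hp5⟩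
  have e11 : m5 11 0 = ((n * c : ℕ) : ℚ) := by rw [hf5 11 (by decide), hs4.states]
  refine Ensures.seq' (elimProg_ensures (by omega) (Nat.le_add_right _ _) e11 e12 h5) ?_
  intro m6 hf6 h6
  have hp6 : HasPowers (toMatrix (n * c + 1) (reduced A (n * c))) 0 m6 :=
    hp5.congr (hf6 13 (by decide)) (hf6 14 (by decide)) (hf6 15 (by decide)) (hf6 16 (by decide))
      (hf6 17 (by decide)) fun x _ => by rw [hf6 8 (by decide)]
  have hin6 : M.HasInput a b p m6 := hin2.congr fun l hl => by
    rw [hf6 l (by interval_cases l <;> decide), hf5 l (by interval_cases l <;> decide),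
      hf4 l (by interval_cases l <;> decide), hf3 l (by interval_cases l <;> decide)]
  have hs6 : m6 10 0 = c := by rw [hf6 10 (by decide), hf5 10 (by decide), hs4.bound]
  -- Since `J < 2 ^ J`, at most `n * c + 1` squarings are made here.
  refine Ensures.loop (fun m' => ∃ J, J ≤ n * c + 1 ∧
    HasPowers (toMatrix (n * c + 1) (reduced A (n * c))) J m')
    (fun m' => n * c + 1 - (m' 17 0).num.toNat) ⟨0, Nat.zero_le _, hp6⟩ (by omega) ?_
  rintro m7 hf7 ⟨J, hJ, hp7⟩
  refine ⟨_, _, eval_var _ _, eval_var _ _, fun hlt => ?_, fun hlt => ?_⟩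
  · rw [hp7.pow, hp7.width, Nat.cast_lt] at hlt
    have hJ' : J < n * c + 1 := Nat.lt_two_pow_self.trans hlt
    refine (squareProg_ensures (by omega) hp7).mono fun m8 _ hp8 => ⟨⟨J + 1, hJ', hp8⟩, ?_⟩
    rw [hp8.count, hp7.count, Rat.num_natCast, Rat.num_natCast]
    simp only [Int.toNat_natCast]
    omega
  · rw [hp7.pow, hp7.width, Nat.cast_lt, not_lt] at hlt
    refine ⟨A, c, J, hc, hrew, hcM, hA, hJ, hlt, ⟨?_, ?_, ?_, fun s => ?_, hp7⟩⟩
    · exact hin6.congr fun l hl => hf7 l (by interval_cases l <;> decide)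
    · rw [hf7 10 (by decide), hs6]
    · rw [hf7 11 (by decide), hf6 11 (by decide), e11]
    · have hq : (s : ℕ) * c < n * c := by simpa using mul_add_lt s hc
      rw [hf7 7 (by decide), h6 _ (by omega) _ (by omega)]
      rw [← unitReach_mul_add (M := M) (a := a) (b := b) s hc, add_zero,
        hA.unitReach_eq_elim hc hrew hq]
      rfl

end MarkovChain

/-! ## The search for the values -/

section Search

/-- The entry of the last matrix power at the position in variable 22. -/
abbrev topEntry : RamExpr := read 8 (add (var 15) (var 22))

/-- The threshold. -/
abbrev threshold : RamExpr := read 0 (const 1)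

theorem eval_threshold {m : RamMemory} {p : ℚ} (h : m 0 1 = p) : threshold.eval m = some p := by
  simp [RamExpr.eval, h]

theorem HasPowers.eval_topEntry {N J : ℕ} {W : Matrix (Fin (N + 1)) (Fin (N + 1)) ℚ}
    {m : RamMemory} (h : HasPowers W J m) {q : Fin (N + 1)}
    (h22 : m 22 0 = ((q * (N + 1) + N : ℕ) : ℚ)) :
    topEntry.eval m = some ((W ^ 2 ^ J) q (Fin.last N)) := by
  have h1 := h.slot_eq J le_rfl
  rw [← h1]
  simp only [RamExpr.eval, toIndex_zero, Option.bind_some, Option.map_some, h.top, h22,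
    ← Nat.cast_add, toIndex_natCast]
  rfl

/-- Setting variable 23 to 0 if the last matrix power meets the threshold. -/
def flagProg (cmp : Comparison) : RamProg := test cmp topEntry threshold (set 23 (const 0)) skip

/-- Appending matrix powers until the threshold is met. -/
def raiseProg (cmp : Comparison) : RamProg :=
  seq (set 23 (const 1)) (seq (flagProg cmp)
    (loop (const 0) (var 23) (seq squareProg (flagProg cmp))))

/-- One step of the binary search. The variables 24 and 25 hold the position of a matrix power and
its exponent, the variables 26 and 27 those of the power that is tried next, and variable 28 the
position of a free slot. -/
def descentStep (cmp : Comparison) : RamProg :=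
  seq (set 30 (var 26)) (seq (set 31 (var 24)) (seq (set 32 (var 28)) (seq mulProg
    (seq (test cmp (read 8 (add (var 28) (var 22))) threshold skip
        (seq (set 24 (var 28)) (set 25 (add (var 25) (var 27)))))
      (seq (set 28 (add (var 28) (var 14))) (seq (set 26 (sub (var 26) (var 14)))
        (set 27 (div (var 27) (const 2)))))))))

/-- Binary search for the largest exponent that does not meet the threshold. -/
def descentProg (cmp : Comparison) : RamProg :=
  seq (set 24 (const 0)) (seq (set 25 (const 0)) (seq (set 26 (var 15)) (seq (set 27 (var 16))
    (seq (set 28 (add (var 15) (var 14)))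
      (forTo 29 (add (var 17) (const 1)) (descentStep cmp))))))

variable {Z N J : ℕ} {W : Matrix (Fin (N + 1)) (Fin (N + 1)) ℚ} {m : RamMemory}
  {cmp : Comparison} {p : ℚ} {q : Fin (N + 1)}

theorem flagProg_writes {l : ℕ} (h : l ≠ 23) : (flagProg cmp).Writes l = false := by
  simp [flagProg, test_writes, Writes, h]

theorem flagProg_ensures (h : HasPowers W J m) (h01 : m 0 1 = p)
    (h22 : m 22 0 = ((q * (N + 1) + N : ℕ) : ℚ)) (h23 : m 23 0 = 1) :
    (flagProg cmp).Ensures Z m fun m' =>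
      m' 23 0 = 1 ∧ ¬ cmp.Holds ((W ^ 2 ^ J) q (Fin.last N) : ℚ) p ∨
        m' 23 0 = 0 ∧ cmp.Holds ((W ^ 2 ^ J) q (Fin.last N) : ℚ) p :=
  Ensures.test (h.eval_topEntry h22) (eval_threshold h01)
    (fun hh => Ensures.set rfl (Or.inr ⟨by simp [RamMemory.write_apply], hh⟩))
    fun hh => Ensures.skip (Or.inl ⟨h23, hh⟩)

theorem raiseProg_frame {m' : RamMemory} (h : (raiseProg cmp).Frame m m') {l : ℕ}
    (hl : l < 8 ∨ (9 ≤ l ∧ l < 15) ∨ (18 ≤ l ∧ l < 23)) : m' l = m l := by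
  refine h l ?_
  have : l < 23 := by omega
  interval_cases l <;> first | omega | (cases cmp <;> decide)

/-- The bound `B` is unknown to the program, which stops when the threshold is met; `B` only
supplies the variant. Powers already present are kept. -/
theorem raiseProg_ensures {B : ℕ} (hN : N + 1 ≤ Z) (hBZ : B ≤ Z) (hJ : J ≤ B)
    (h : HasPowers W J m) (h01 : m 0 1 = p) (h22 : m 22 0 = ((q * (N + 1) + N : ℕ) : ℚ))
    (hB : ∀ J, B ≤ J → cmp.Holds ((W ^ 2 ^ J) q (Fin.last N) : ℚ) p) :
    (raiseProg cmp).Ensures Z m fun m' => ∃ J', J ≤ J' ∧ J' ≤ B ∧ HasPowers W J' m' ∧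
      cmp.Holds ((W ^ 2 ^ J') q (Fin.last N) : ℚ) p := by
  have hflag : ∀ {m m' : RamMemory} {J : ℕ}, (flagProg cmp).Frame m m' → HasPowers W J m →
      HasPowers W J m' := fun hf h =>
    h.congr (hf 13 (flagProg_writes (by decide))) (hf 14 (flagProg_writes (by decide)))
      (hf 15 (flagProg_writes (by decide))) (hf 16 (flagProg_writes (by decide)))
      (hf 17 (flagProg_writes (by decide))) fun x _ => by rw [hf 8 (flagProg_writes (by decide))]
  refine Ensures.seq (Ensures.set rfl ?_)
  have h1 : HasPowers W J (m.write 23 0 1) :=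
    h.congr (RamMemory.write_of_ne _ (by decide) _ _) (RamMemory.write_of_ne _ (by decide) _ _)
      (RamMemory.write_of_ne _ (by decide) _ _) (RamMemory.write_of_ne _ (by decide) _ _)
      (RamMemory.write_of_ne _ (by decide) _ _)
      fun x _ => by rw [RamMemory.write_of_ne _ (by decide)]
  refine Ensures.seq' (flagProg_ensures (cmp := cmp) (p := p) (q := q) h1
    (by rw [RamMemory.write_of_ne _ (by decide), h01])
    (by rw [RamMemory.write_of_ne _ (by decide), h22]) (by simp [RamMemory.write_apply])) ?_
  intro m1 hf1 h2
  have e0 : m1 0 1 = p := by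
    rw [hf1 0 (flagProg_writes (by decide)), RamMemory.write_of_ne _ (by decide), h01]
  have e22 : m1 22 0 = ((q * (N + 1) + N : ℕ) : ℚ) := by
    rw [hf1 22 (flagProg_writes (by decide)), RamMemory.write_of_ne _ (by decide), h22]
  refine Ensures.loop (fun m' => ∃ J', J ≤ J' ∧ J' ≤ B ∧ HasPowers W J' m' ∧ m' 0 1 = p ∧
      m' 22 0 = ((q * (N + 1) + N : ℕ) : ℚ) ∧
      (m' 23 0 = 1 ∧ ¬ cmp.Holds ((W ^ 2 ^ J') q (Fin.last N) : ℚ) p ∨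
        m' 23 0 = 0 ∧ cmp.Holds ((W ^ 2 ^ J') q (Fin.last N) : ℚ) p))
    (fun m' => B - (m' 17 0).num.toNat) ⟨J, le_rfl, hJ, hflag hf1 h1, e0, e22, h2⟩
    ((Nat.sub_le _ _).trans hBZ) ?_
  rintro m2 - ⟨J', hJJ, hJB, h3, f0, f22, h4⟩
  refine ⟨_, _, rfl, eval_var _ _, fun hlt => ?_, fun hlt => ?_⟩
  · rcases h4 with ⟨h23, hnot⟩ | ⟨h23, -⟩
    · have hlt' : J' < B := by
        by_contra hcon
        exact hnot (hB J' (not_lt.1 hcon))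
      refine Ensures.seq' (squareProg_ensures hN h3) ?_
      intro m3 hf3 h5
      refine (flagProg_ensures (cmp := cmp) (p := p) (q := q) h5 (by rw [hf3 0 (by decide), f0])
        (by rw [hf3 22 (by decide), f22]) (by rw [hf3 23 (by decide), h23])).mono ?_
      intro m4 hf4 h6
      refine ⟨⟨J' + 1, by omega, hlt', hflag hf4 h5, ?_, ?_, h6⟩, ?_⟩
      · rw [hf4 0 (flagProg_writes (by decide)), hf3 0 (by decide), f0]
      · rw [hf4 22 (flagProg_writes (by decide)), hf3 22 (by decide), f22]
      · rw [(hflag hf4 h5).count, h3.count, Rat.num_natCast, Rat.num_natCast]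
        simp only [Int.toNat_natCast]
        omega
    · rw [h23] at hlt
      exact absurd hlt (lt_irrefl 0)
  · rcases h4 with ⟨h23, -⟩ | ⟨-, hh⟩
    · rw [h23] at hlt
      exact absurd zero_lt_one hlt
    · exact ⟨J', hJJ, hJB, h3, hh⟩

/-- The invariant of the binary search, after `j` steps. -/
structure DescentInv (W : Matrix (Fin (N + 1)) (Fin (N + 1)) ℚ) (J : ℕ) (cmp : Comparison) (p : ℚ)
    (q : Fin (N + 1)) (j k d : ℕ) (m : RamMemory) : Prop where
  powers : HasPowers W J m
  pos : m 24 0 = (d : ℚ)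
  exponent : m 25 0 = (k : ℚ)
  next : m 26 0 = (((J + 1 - j) * ((N + 1) * (N + 1)) : ℕ) : ℚ)
  nextExponent : m 27 0 = (2 : ℚ) ^ J / 2 ^ j
  free : m 28 0 = (((J + 2 + j) * ((N + 1) * (N + 1)) : ℕ) : ℚ)
  lt_free : d + (N + 1) * (N + 1) ≤ (J + 2 + j) * ((N + 1) * (N + 1))
  slot_eq : slot m (N + 1) d = W ^ k
  not_holds : ¬ cmp.Holds ((W ^ k) q (Fin.last N) : ℚ) p
  holds : cmp.Holds ((W ^ (k + 2 ^ (J + 1 - j))) q (Fin.last N) : ℚ) p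

theorem DescentInv.congr {j k d : ℕ} {m' : RamMemory} (h : DescentInv W J cmp p q j k d m)
    (hm : ∀ l, l ≠ 29 → m' l = m l) : DescentInv W J cmp p q j k d m' := by
  refine ⟨h.powers.congr (hm 13 (by decide)) (hm 14 (by decide)) (hm 15 (by decide))
    (hm 16 (by decide)) (hm 17 (by decide)) fun x _ => by rw [hm 8 (by decide)],
    by rw [hm 24 (by decide), h.pos], by rw [hm 25 (by decide), h.exponent],
    by rw [hm 26 (by decide), h.next], by rw [hm 27 (by decide), h.nextExponent],
    by rw [hm 28 (by decide), h.free], h.lt_free, ?_, h.not_holds, h.holds⟩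
  rw [slot_congr' (hm 8 (by decide)), h.slot_eq]

/-- The answer lies in an interval starting at `k` whose length is a power of two. One product with
a stored power gives the matrix at the midpoint, and the test there selects a half. -/
theorem descentStep_ensures {j k d : ℕ} (hN : N + 1 ≤ Z) (h01 : m 0 1 = p)
    (h22 : m 22 0 = ((q * (N + 1) + N : ℕ) : ℚ)) (hj : j ≤ J)
    (h : DescentInv W J cmp p q j k d m) :
    (descentStep cmp).Ensures Z m fun m' => ∃ k' d', DescentInv W J cmp p q (j + 1) k' d' m' := by
  -- The exponent tried in this step is `2 ^ i`. The invariant states it as a quotient in ℚ, because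
  -- after the last step the halved variable is 1/2.
  obtain ⟨i, rfl⟩ : ∃ i, J = i + j := ⟨J - j, by omega⟩
  have hij : i + j + 1 - j = i + 1 := by omega
  have hij' : i + j + 1 - (j + 1) = i := by omega
  have hnext := h.next
  have hholds := h.holds
  rw [hij] at hnext hholds
  have hpow : (2 : ℚ) ^ (i + j) / 2 ^ j = ((2 ^ i : ℕ) : ℚ) := by
    rw [pow_add, mul_div_cancel_right₀ _ (pow_ne_zero _ two_ne_zero)]
    push_cast
    rfl
  refine Ensures.seq (Ensures.set (eval_var _ _) (Ensures.seq (Ensures.set (eval_var _ _)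
    (Ensures.seq (Ensures.set (eval_var _ _) ?_)))))
  set m1 := ((m.write 30 0 (m 26 0)).write 31 0 ((m.write 30 0 (m 26 0)) 24 0)).write 32 0
    (((m.write 30 0 (m 26 0)).write 31 0 ((m.write 30 0 (m 26 0)) 24 0)) 28 0) with hm1
  have e : ∀ l, l < 30 → m1 l = m l := fun l hl => by
    rw [hm1, RamMemory.write_of_ne _ (by omega), RamMemory.write_of_ne _ (by omega),
      RamMemory.write_of_ne _ (by omega)]
  have e30 : m1 30 0 = (((i + 1) * ((N + 1) * (N + 1)) : ℕ) : ℚ) := by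
    rw [← hnext]
    simp [hm1, RamMemory.write_apply]
  have e31 : m1 31 0 = (d : ℚ) := by
    rw [← h.pos]
    simp [hm1, RamMemory.write_apply]
  have e32 : m1 32 0 = (((i + j + 2 + j) * ((N + 1) * (N + 1)) : ℕ) : ℚ) := by
    rw [← h.free]
    simp [hm1, RamMemory.write_apply]
  clear_value m1
  refine Ensures.seq' (mulProg_ensures (K := N + 1) hN (by rw [e 13 (by decide), h.powers.width]) e30
    e31 e32 ?_ h.lt_free) ?_
  · rw [← Nat.succ_mul]
    exact Nat.mul_le_mul_right _ (by omega)
  rintro m2 hf2 ⟨h2, h2'⟩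
  rw [slot_congr' (m := m) (e 8 (by decide)), slot_congr' (m := m) (e 8 (by decide)), h.slot_eq,
    h.powers.slot_eq i (by omega), ← pow_add] at h2
  have f : ∀ l, l < 30 → l ≠ 8 → m2 l = m l := fun l hl h8 => by
    rw [hf2 l (by interval_cases l <;> first | omega | decide), e l hl]
  have f8 : ∀ x < (i + j + 2 + j) * ((N + 1) * (N + 1)), m2 8 x = m 8 x := fun x hx => by
    rw [h2' x hx, e 8 (by decide)]
  have hp2 : HasPowers W (i + j) m2 :=
    h.powers.congr (f 13 (by decide) (by decide)) (f 14 (by decide) (by decide))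
      (f 15 (by decide) (by decide)) (f 16 (by decide) (by decide)) (f 17 (by decide) (by decide))
      fun x hx => f8 x (hx.trans_le (Nat.mul_le_mul_right _ (by omega)))
  have hent : (read 8 (add (var 28) (var 22))).eval m2 =
      some ((W ^ (2 ^ i + k)) q (Fin.last N)) := by
    rw [← h2]
    simp only [RamExpr.eval, toIndex_zero, Option.bind_some, Option.map_some,
      f 28 (by decide) (by decide), f 22 (by decide) (by decide), h.free, h22, ← Nat.cast_add,
      toIndex_natCast]
    rfl
  refine Ensures.seq' (R := fun m3 => ∃ k' d' : ℕ, m3 24 0 = (d' : ℚ) ∧ m3 25 0 = (k' : ℚ) ∧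
    (∀ l, l ≠ 24 → l ≠ 25 → m3 l = m2 l) ∧
    d' + (N + 1) * (N + 1) ≤ (i + j + 2 + (j + 1)) * ((N + 1) * (N + 1)) ∧ slot m2 (N + 1) d' = W ^ k' ∧
    ¬ cmp.Holds ((W ^ k') q (Fin.last N) : ℚ) p ∧
    cmp.Holds ((W ^ (k' + 2 ^ i)) q (Fin.last N) : ℚ) p) (Ensures.test hent
      (eval_threshold (by rw [f 0 (by decide) (by decide), h01])) (fun hh => ?_) fun hh => ?_) ?_
  · rw [Nat.add_comm (2 ^ i) k] at hh
    refine Ensures.skip ⟨k, d, by rw [f 24 (by decide) (by decide), h.pos],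
      by rw [f 25 (by decide) (by decide), h.exponent], fun _ _ _ => rfl, ?_, ?_, h.not_holds, hh⟩
    · exact h.lt_free.trans (Nat.mul_le_mul_right _ (by omega))
    · rw [slot_congr h.lt_free f8, h.slot_eq]
  · refine Ensures.seq (Ensures.set (eval_var _ _) (Ensures.set (x := ((2 ^ i + k : ℕ) : ℚ)) ?_
      ⟨2 ^ i + k, (i + j + 2 + j) * ((N + 1) * (N + 1)), ?_, ?_, ?_, ?_, h2, hh, ?_⟩))
    · simp only [RamExpr.eval, toIndex_zero, Option.bind_some, Option.map_some,
        RamMemory.write_of_ne _ (show 25 ≠ 24 by decide),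
        RamMemory.write_of_ne _ (show 27 ≠ 24 by decide), f 25 (by decide) (by decide),
        f 27 (by decide) (by decide), h.exponent, h.nextExponent, hpow, ← Nat.cast_add]
      rw [add_comm]
    · simp [RamMemory.write_apply, f 28 (by decide) (by decide), h.free]
    · simp [RamMemory.write_apply]
    · intro l h24 h25
      rw [RamMemory.write_of_ne _ h25, RamMemory.write_of_ne _ h24]
    · rw [← Nat.succ_mul]
      exact le_rfl
    · rwa [show 2 ^ i + k + 2 ^ i = k + 2 ^ (i + 1) by ring]
  rintro m3 - ⟨k', d', g24, g25, g, hd', hslot, hnot, hh⟩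
  have g28 : m3 28 0 = (((i + j + 2 + j) * ((N + 1) * (N + 1)) : ℕ) : ℚ) := by
    rw [g 28 (by decide) (by decide), f 28 (by decide) (by decide), h.free]
  have g14 : m3 14 0 = (((N + 1) * (N + 1) : ℕ) : ℚ) := by
    rw [g 14 (by decide) (by decide), hp2.sq]
  have g26 : m3 26 0 = (((i + 1) * ((N + 1) * (N + 1)) : ℕ) : ℚ) := by
    rw [g 26 (by decide) (by decide), f 26 (by decide) (by decide), hnext]
  have g27 : m3 27 0 = (2 : ℚ) ^ (i + j) / 2 ^ j := by
    rw [g 27 (by decide) (by decide), f 27 (by decide) (by decide), h.nextExponent]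
  refine Ensures.seq (Ensures.set (x := (((i + j + 2 + (j + 1)) * ((N + 1) * (N + 1)) : ℕ) : ℚ)) ?_
    (Ensures.seq (Ensures.set (x := ((i * ((N + 1) * (N + 1)) : ℕ) : ℚ)) ?_
    (Ensures.set (x := (2 : ℚ) ^ (i + j) / 2 ^ (j + 1)) ?_ ⟨k', d', ?_⟩))))
  · simp only [RamExpr.eval, toIndex_zero, Option.bind_some, Option.map_some, g28, g14]
    push_cast
    congr 1
    ring
  · simp only [RamExpr.eval, toIndex_zero, Option.bind_some, Option.map_some,
      RamMemory.write_of_ne _ (show 26 ≠ 28 by decide),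
      RamMemory.write_of_ne _ (show 14 ≠ 28 by decide), g26, g14]
    push_cast
    congr 1
    ring
  · simp only [RamExpr.eval, toIndex_zero, Option.bind_some, Option.map_some,
      RamMemory.write_of_ne _ (show 27 ≠ 28 by decide),
      RamMemory.write_of_ne _ (show 27 ≠ 26 by decide), g27, if_neg (two_ne_zero (α := ℚ))]
    rw [pow_succ, div_div]
  · set m4 := ((m3.write 28 0 (((i + j + 2 + (j + 1)) * ((N + 1) * (N + 1)) : ℕ) : ℚ)).write 26 0
      ((i * ((N + 1) * (N + 1)) : ℕ) : ℚ)).write 27 0 ((2 : ℚ) ^ (i + j) / 2 ^ (j + 1)) with hm4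
    have k0 : ∀ l, l ≠ 26 → l ≠ 27 → l ≠ 28 → m4 l = m3 l := fun l h26 h27 h28 => by
      rw [hm4, RamMemory.write_of_ne _ h27, RamMemory.write_of_ne _ h26,
        RamMemory.write_of_ne _ h28]
    have k1 : ∀ l, l < 24 → m4 l = m2 l := fun l hl => by
      rw [k0 l (by omega) (by omega) (by omega), g l (by omega) (by omega)]
    refine ⟨hp2.congr (k1 13 (by decide)) (k1 14 (by decide)) (k1 15 (by decide))
      (k1 16 (by decide)) (k1 17 (by decide)) fun x _ => by rw [k1 8 (by decide)], ?_, ?_, ?_, ?_,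
      ?_, hd', ?_, hnot, ?_⟩
    · rw [k0 24 (by decide) (by decide) (by decide), g24]
    · rw [k0 25 (by decide) (by decide) (by decide), g25]
    · rw [hij', hm4]
      simp [RamMemory.write_apply]
    · simp [hm4, RamMemory.write_apply]
    · simp [hm4, RamMemory.write_apply]
    · rw [slot_congr' (k1 8 (by decide)), hslot]
    · rwa [hij']

theorem descentProg_frame {m' : RamMemory} (h : (descentProg cmp).Frame m m') {l : ℕ}
    (hl : l < 8 ∨ (9 ≤ l ∧ l < 24)) : m' l = m l := by
  refine h l ?_
  have : l < 24 := by omega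
  interval_cases l <;> first | omega | (cases cmp <;> decide)

/-- The search starts from the identity matrix in slot 0, at exponent 0, on an interval of length `2
^ (J + 1)`; after `J + 1` halvings the length is 1. -/
theorem descentProg_ensures (hN : N + 1 ≤ Z) (hJ : J + 1 ≤ Z) (h01 : m 0 1 = p)
    (h22 : m 22 0 = ((q * (N + 1) + N : ℕ) : ℚ)) (h : HasPowers W J m)
    (hnot : ¬ cmp.Holds ((W ^ 0) q (Fin.last N) : ℚ) p)
    (hh : cmp.Holds ((W ^ 2 ^ (J + 1)) q (Fin.last N) : ℚ) p) :
    (descentProg cmp).Ensures Z m fun m' => HasPowers W J m' ∧ ∃ k : ℕ, m' 25 0 = k ∧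
      ¬ cmp.Holds ((W ^ k) q (Fin.last N) : ℚ) p ∧
      cmp.Holds ((W ^ (k + 1)) q (Fin.last N) : ℚ) p := by
  refine Ensures.seq (Ensures.set rfl (Ensures.seq (Ensures.set rfl (Ensures.seq
    (Ensures.set (x := (((J + 1) * ((N + 1) * (N + 1)) : ℕ) : ℚ)) ?_ (Ensures.seq
    (Ensures.set (x := ((2 ^ J : ℕ) : ℚ)) ?_ (Ensures.seq
    (Ensures.set (x := (((J + 2) * ((N + 1) * (N + 1)) : ℕ) : ℚ)) ?_ ?_)))))))))
  · rw [eval_var, ← h.top]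
    simp [RamMemory.write_apply]
  · rw [eval_var, ← h.pow]
    simp [RamMemory.write_apply]
  · simp only [RamExpr.eval, toIndex_zero, Option.bind_some, Option.map_some,
      RamMemory.write_of_ne _ (show 15 ≠ 24 by decide),
      RamMemory.write_of_ne _ (show 15 ≠ 25 by decide),
      RamMemory.write_of_ne _ (show 15 ≠ 26 by decide),
      RamMemory.write_of_ne _ (show 15 ≠ 27 by decide),
      RamMemory.write_of_ne _ (show 14 ≠ 24 by decide),
      RamMemory.write_of_ne _ (show 14 ≠ 25 by decide),
      RamMemory.write_of_ne _ (show 14 ≠ 26 by decide),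
      RamMemory.write_of_ne _ (show 14 ≠ 27 by decide), h.top, h.sq]
    push_cast
    congr 1
    ring
  set m1 := ((((m.write 24 0 0).write 25 0 0).write 26 0
    (((J + 1) * ((N + 1) * (N + 1)) : ℕ) : ℚ)).write 27 0 ((2 ^ J : ℕ) : ℚ)).write 28 0
    (((J + 2) * ((N + 1) * (N + 1)) : ℕ) : ℚ) with hm1
  have e : ∀ l, l < 24 → m1 l = m l := fun l hl => by
    rw [hm1, RamMemory.write_of_ne _ (by omega), RamMemory.write_of_ne _ (by omega),
      RamMemory.write_of_ne _ (by omega), RamMemory.write_of_ne _ (by omega),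
      RamMemory.write_of_ne _ (by omega)]
  have hp1 : HasPowers W J m1 :=
    h.congr (e 13 (by decide)) (e 14 (by decide)) (e 15 (by decide)) (e 16 (by decide))
      (e 17 (by decide)) fun x _ => by rw [e 8 (by decide)]
  have hinv : DescentInv W J cmp p q 0 0 0 m1 := by
    refine ⟨hp1, ?_, ?_, ?_, ?_, ?_, ?_, ?_, hnot, ?_⟩
    · simp [hm1, RamMemory.write_apply]
    · simp [hm1, RamMemory.write_apply]
    · simp [hm1, RamMemory.write_apply]
    · simp [hm1, RamMemory.write_apply]
    · simp [hm1, RamMemory.write_apply]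
    · rw [zero_add]
      exact Nat.le_mul_of_pos_left _ (by omega)
    · rw [hp1.one, pow_zero]
    · simpa using hh
  have hfr : ∀ {m' : RamMemory} {l : ℕ},
      (RamProg.forTo 29 (add (var 17) (const 1)) (descentStep cmp)).Frame m1 m' → l < 24 → l ≠ 8 →
      m' l = m1 l := by
    intro m' l hf hl hl8
    refine hf l ?_
    interval_cases l <;> first | omega | (cases cmp <;> decide)
  refine (Ensures.forTo (n := J + 1) (fun j m' => ∃ k d, DescentInv W J cmp p q j k d m') hJ
    (by cases cmp <;> decide) ⟨0, 0, hinv.congr fun l hl => RamMemory.write_of_ne _ hl _ _⟩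
    ?_ ?_).mono ?_
  · intro m2 _ hf2 _
    simp only [RamExpr.eval, toIndex_zero, Option.bind_some, Option.map_some,
      hfr hf2 (show 17 < 24 by decide) (by decide), hp1.count]
    push_cast
    rfl
  · rintro m2 j hj hf2 - ⟨k, d, h2⟩
    refine (descentStep_ensures hN ?_ ?_ (Nat.lt_succ_iff.1 hj) h2).mono ?_
    · rw [hfr hf2 (show 0 < 24 by decide) (by decide), e 0 (by decide), h01]
    · rw [hfr hf2 (show 22 < 24 by decide) (by decide), e 22 (by decide), h22]
    · rintro m3 - ⟨k', d', h3⟩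
      exact ⟨k', d', h3.congr fun l hl => RamMemory.write_of_ne _ hl _ _⟩
  · rintro m2 - ⟨k, d, h2⟩
    refine ⟨h2.powers, k, h2.exponent, h2.not_holds, ?_⟩
    simpa using h2.holds

end Search

/-! ## The program -/

/-- Computation of the value of the state whose number is in variable 20. -/
def stateProg (cmp : Comparison) : RamProg :=
  seq (set 21 (mul (var 20) (var 10))) (seq (set 22 (add (mul (var 21) (var 13)) (var 11)))
    (seq (ite threshold (read 7 (var 22)) (raiseProg cmp) skip)
      (test cmp topEntry threshold
        (test cmp (const 0) threshold (assign 5 (var 20) (const (-1)))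
          (seq (descentProg cmp) (seq (assign 5 (var 20) (const 0)) (assign 6 (var 20) (var 25)))))
        (assign 5 (var 20) (const 1)))))

/-- The evaluation of a query. -/
def mainProg (cmp : Comparison) : RamProg := seq MarkovChain.prepProg (forTo 20 MarkovChain.numStates (stateProg cmp))

namespace MarkovChain

variable {n : ℕ} {M : MarkovChain n} {a b : AP} {p : ℚ} {Z c J : ℕ} {A : ℕ → ℕ → ℚ}
  {m : RamMemory} {cmp : Comparison}

theorem IsPrepared.congr {m' : RamMemory} (h : M.IsPrepared a b p A c J m)
    (hm : ∀ l < 18, l ≠ 5 → l ≠ 6 → m' l = m l) : M.IsPrepared a b p A c J m' := by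
  refine ⟨h.input.congr fun l hl => hm l (by omega) (by omega) (by omega), ?_, ?_, fun s => ?_,
    h.powers.congr ?_ ?_ ?_ ?_ ?_ fun x _ => ?_⟩
  · rw [hm 10 (by decide) (by decide) (by decide), h.bound]
  · rw [hm 11 (by decide) (by decide) (by decide), h.states]
  · rw [hm 7 (by decide) (by decide) (by decide), h.reach]
  all_goals rw [hm _ (by decide) (by decide) (by decide)]

theorem IsPrepared.of_hasPowers {m' : RamMemory} {J' : ℕ} (h : M.IsPrepared a b p A c J m)
    (hm : ∀ l < 12, l ≠ 8 → m' l = m l)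
    (h' : HasPowers (toMatrix (n * c + 1) (reduced A (n * c))) J' m') :
    M.IsPrepared a b p A c J' m' := by
  refine ⟨h.input.congr fun l hl => hm l (by omega) (by omega), ?_, ?_, fun s => ?_, h'⟩
  · rw [hm 10 (by decide) (by decide), h.bound]
  · rw [hm 11 (by decide) (by decide), h.states]
  · rw [hm 7 (by decide) (by decide), h.reach]

/-- If the unbounded probability exceeds `p`, squaring eventually meets the threshold. Otherwise no
squaring is needed, the stored exponent being at least `n * c`. So a failed test of the last power
means `⊤`; a successful one means `⊥` if 0 already qualifies, and a binary search otherwise. -/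
theorem stateProg_ensures {B : ℕ} (hc : 0 < c) (hrew : ∀ s, M.rew s ≤ c)
    (hA : M.IsUnitMatrix a b c A) (hK : n * c + 1 ≤ Z) (hBZ : B + 1 ≤ Z) (hJB : J ≤ B)
    (hJ : n * c ≤ 2 ^ J) {s : Fin n}
    (hB : ∀ j, B ≤ j → (p : ℝ) < M.reachProb a b s → (p : ℝ) < M.unitProb a b c (2 ^ j) (s * c))
    (h : M.IsPrepared a b p A c J m) (hs : m 20 0 = ((s : ℕ) : ℚ)) :
    (stateProg cmp).Ensures Z m fun m' => ∃ J', M.IsPrepared a b p A c J' m' ∧ J' ≤ B ∧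
      n * c ≤ 2 ^ J' ∧ outputValue m' s = M.queryValue cmp p a b s ∧
      ∀ x, x ≠ (s : ℕ) → outputValue m' x = outputValue m x := by
  have hsc : (s : ℕ) * c < n * c := by simpa using mul_add_lt s hc
  set q : Fin (n * c + 1) := ⟨s * c, by omega⟩ with hq
  have hpow : ∀ k, (((toMatrix (n * c + 1) (reduced A (n * c)) ^ k) q (Fin.last _) : ℚ) : ℝ) =
      M.unitProb a b c k (s * c) := fun k => hA.pow_apply hc hrew k q hsc
  refine Ensures.seq (Ensures.set (x := ((s * c : ℕ) : ℚ)) ?_ (Ensures.seq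
    (Ensures.set (x := ((q * (n * c + 1) + n * c : ℕ) : ℚ)) ?_ ?_)))
  · simp [RamExpr.eval, hs, h.bound]
  · simp only [RamExpr.eval, toIndex_zero, Option.bind_some, Option.map_some,
      RamMemory.write_of_ne _ (show 13 ≠ 21 by decide),
      RamMemory.write_of_ne _ (show 11 ≠ 21 by decide), h.powers.width, h.states,
      RamMemory.write_self, Function.update_self, hq, ← Nat.cast_mul, ← Nat.cast_add]
  set m1 := (m.write 21 0 ((s * c : ℕ) : ℚ)).write 22 0 ((q * (n * c + 1) + n * c : ℕ) : ℚ) with hm1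
  have e1 : ∀ l, l < 21 → m1 l = m l := fun l hl => by
    rw [hm1, RamMemory.write_of_ne _ (by omega), RamMemory.write_of_ne _ (by omega)]
  have h22 : m1 22 0 = ((q * (n * c + 1) + n * c : ℕ) : ℚ) := by
    simp [hm1, RamMemory.write_apply]
  clear_value m1
  have hp1 : M.IsPrepared a b p A c J m1 := h.congr fun l hl _ _ => e1 l (by omega)
  have hreach : (read 7 (var 22)).eval m1 = some (m1 7 (s * c * (n * c + 1) + n * c)) := by
    simp only [RamExpr.eval, toIndex_zero, Option.bind_some, Option.map_some, h22, toIndex_natCast,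
      hq]
  refine Ensures.seq' (R := fun m2 => (∀ l < 23, l ≠ 8 → l < 15 ∨ 18 ≤ l → m2 l = m1 l) ∧
    ∃ J', J ≤ J' ∧ J' ≤ B ∧ HasPowers (toMatrix (n * c + 1) (reduced A (n * c))) J' m2 ∧
      ((p : ℝ) < M.reachProb a b s → cmp.Holds (M.unitProb a b c (2 ^ J') (s * c)) p))
    (Ensures.ite (eval_threshold hp1.input.threshold) hreach (fun hlt => ?_) fun hlt => ?_) ?_
  · have hlt' : (p : ℝ) < M.reachProb a b s := by
      rw [← hp1.reach]
      exact_mod_cast hlt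
    refine (raiseProg_ensures (cmp := cmp) (p := p) (q := q) hK (by omega) hJB hp1.powers
      hp1.input.threshold h22 fun j hj => ?_).mono ?_
    · rw [hpow]
      have := hB j hj hlt'
      cases cmp
      · exact this.le
      · exact this
    · rintro m2 hf2 ⟨J', h1, h2, h3, h4⟩
      rw [hpow] at h4
      exact ⟨fun l hl _ _ => raiseProg_frame hf2 (by omega), J', h1, h2, h3, fun _ => h4⟩
  · refine Ensures.skip ⟨fun _ _ _ _ => rfl, J, le_rfl, hJB, hp1.powers, fun hh => ?_⟩
    rw [← hp1.reach] at hh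
    exact absurd (by exact_mod_cast hh) hlt
  rintro m2 - ⟨e2, J', hJJ, hJB', hpow2, hraise⟩
  have hp2 : M.IsPrepared a b p A c J' m2 :=
    hp1.of_hasPowers (fun l hl h8 => e2 l (by omega) h8 (by omega)) hpow2
  have hJ' : n * c ≤ 2 ^ J' := hJ.trans (Nat.pow_le_pow_right two_pos hJJ)
  have f22 : m2 22 0 = ((q * (n * c + 1) + n * c : ℕ) : ℚ) := by
    rw [e2 22 (by decide) (by decide) (by decide), h22]
  have f20 : m2 20 0 = ((s : ℕ) : ℚ) := by
    rw [e2 20 (by decide) (by decide) (by decide), e1 20 (by decide), hs]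
  have f5 : m2 5 = m 5 := by rw [e2 5 (by decide) (by decide) (by decide), e1 5 (by decide)]
  have f6 : m2 6 = m 6 := by rw [e2 6 (by decide) (by decide) (by decide), e1 6 (by decide)]
  -- writing an infinite value
  have hinf : ∀ y : ℚ, (if 0 < y then ⊤ else if y < 0 then ⊥ else (0 : EReal)) =
      M.queryValue cmp p a b s → y ≠ 0 →
      (assign 5 (var 20) (const y)).Ensures Z m2 fun m' => ∃ J', M.IsPrepared a b p A c J' m' ∧
        J' ≤ B ∧ n * c ≤ 2 ^ J' ∧ outputValue m' s = M.queryValue cmp p a b s ∧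
        ∀ x, x ≠ (s : ℕ) → outputValue m' x = outputValue m x := by
    intro y hy hy0
    refine Ensures.assign (eval_var _ _) f20 rfl ⟨J', hp2.congr fun l _ h5 _ =>
      RamMemory.write_of_ne _ h5 _ _, hJB', hJ', ?_, fun x hx => ?_⟩
    · rw [← hy]
      simp only [outputValue, RamMemory.write_self, Function.update_self]
      rcases hy0.lt_or_gt with h0 | h0
      · rw [if_neg h0.not_gt, if_pos h0, if_neg h0.not_gt, if_pos h0]
      · rw [if_pos h0, if_pos h0]
    · simp only [outputValue, RamMemory.write_self, Function.update_of_ne hx,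
        RamMemory.write_of_ne _ (show 6 ≠ 5 by decide), f5, f6]
  refine Ensures.test (hpow2.eval_topEntry f22) (eval_threshold hp2.input.threshold) (fun hh => ?_)
    fun hh => ?_
  · rw [hpow] at hh
    refine Ensures.test rfl (eval_threshold hp2.input.threshold) (fun h0 => ?_) fun h0 => ?_
    · rw [Rat.cast_zero] at h0
      exact hinf (-1) (by rw [queryValue_eq_bot h0]; norm_num) (by norm_num)
    · rw [Rat.cast_zero] at h0
      refine Ensures.seq' (descentProg_ensures (cmp := cmp) (p := p) (q := q) hK (by omega)
        hp2.input.threshold f22 hpow2 ?_ ?_) ?_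
      · rwa [hpow, unitProb_zero]
      · rw [hpow]
        -- The search interval extends to twice the exponent at which the threshold is known to be
        -- met; monotonicity covers this.
        exact hh.mono (unitProb_mono _ (Nat.pow_le_pow_right two_pos (Nat.le_succ _)))
      rintro m3 hf3 ⟨hpow3, k, h25, h3, h4⟩
      rw [hpow] at h3 h4
      have e3 : ∀ l < 24, l ≠ 8 → m3 l = m2 l := fun l hl h8 => descentProg_frame hf3 (by omega)
      have hp3 : M.IsPrepared a b p A c J' m3 :=
        hp2.of_hasPowers (fun l hl h8 => e3 l (by omega) h8) hpow3
      have g20 : m3 20 0 = ((s : ℕ) : ℚ) := by rw [e3 20 (by decide) (by decide), f20]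
      refine Ensures.seq (Ensures.assign (eval_var _ _) g20 rfl (Ensures.assign (eval_var _ _)
        (by rw [RamMemory.write_of_ne _ (by decide), g20]) (eval_var _ _)
        ⟨J', hp3.congr fun l _ h5 h6 => ?_, hJB', hJ', ?_, fun x hx => ?_⟩))
      · rw [RamMemory.write_of_ne _ h6, RamMemory.write_of_ne _ h5]
      · rw [queryValue_eq_natCast hc h3 h4]
        simp [outputValue, RamMemory.write_apply, h25]
      · simp [outputValue, RamMemory.write_apply, hx, e3 5 (by decide) (by decide),
          e3 6 (by decide) (by decide), f5, f6]
  · rw [hpow] at hh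
    -- Squaring would have ended with success had the probability exceeded `p`.
    have hp : M.reachProb a b s ≤ p := not_lt.1 fun hlt => hh (hraise hlt)
    exact hinf 1 (by rw [queryValue_eq_top hc (hA.not_holds hc hrew hp hJ' hh)]; simp) one_ne_zero

/-- The loop bound is one more than the squaring bound of `lt_unitProb`, because the binary search
takes one round more than the index of the last stored power. The powers are shared by all states,
so the total number of squarings stays bounded as well. -/
theorem mainProg_ensures {z : ℕ} (hz : M.size ≤ z) (hp : 0 < n → ratSize p ≤ z)
    (hcz : max 1 M.maxReward ≤ z) (hnc : n * max 1 M.maxReward ≤ z) :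
    (mainProg cmp).Ensures (4 * z ^ 2 + 2 * z + 3) (inputMemory M a b p) fun m =>
      ∀ s : Fin n, outputValue m s = M.queryValue cmp p a b s := by
  have hn : n ≤ z := le_size.trans hz
  have hZ : 2 * z + 3 ≤ 4 * z ^ 2 + 2 * z + 3 := by omega
  refine Ensures.seq' (prepProg_ensures (by omega) (by omega) (by omega) hasInput_inputMemory
    (fun _ => rfl) fun _ => rfl) ?_
  rintro m1 - ⟨A, c, J, hc, hrew, hcM, hA, hJ, hJ', h1⟩
  have hnc' : n * c ≤ z := (Nat.mul_le_mul_left _ hcM).trans hnc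
  refine (Ensures.forTo (n := n) (fun j m' => ∃ J, M.IsPrepared a b p A c J m' ∧
    J ≤ 4 * z ^ 2 + 2 * z + 2 ∧ n * c ≤ 2 ^ J ∧
    ∀ s : Fin n, (s : ℕ) < j → outputValue m' s = M.queryValue cmp p a b s) (by omega)
    (by cases cmp <;> decide) ⟨J, h1.congr fun l hl _ _ => RamMemory.write_of_ne _ (by omega) _ _,
      by omega, by omega, by simp⟩ ?_ ?_).mono ?_
  · rintro m2 j - ⟨J, h2, -⟩
    exact h2.input.eval_numStates
  · rintro m2 j hj - hj2 ⟨J, h2, hJB, hJ2, h3⟩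
    refine (stateProg_ensures (s := ⟨j, hj⟩) hc hrew hA (by omega) le_rfl hJB hJ2
      (fun j hj hlt => lt_unitProb hc hrew (hcM.trans hcz) hz (hp (by omega)) hlt hj) h2 hj2).mono ?_
    rintro m3 - ⟨J', g1, g2, g3, g4, g5⟩
    have hout : ∀ x, outputValue (m3.write 20 0 ((j + 1 : ℕ) : ℚ)) x = outputValue m3 x := fun x => by
      simp only [outputValue, RamMemory.write_of_ne _ (show 5 ≠ 20 by decide),
        RamMemory.write_of_ne _ (show 6 ≠ 20 by decide)]
    refine ⟨J', g1.congr fun l hl _ _ => RamMemory.write_of_ne _ (by omega) _ _, g2, g3,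
      fun s hs => ?_⟩
    rw [hout]
    rcases Nat.lt_succ_iff_lt_or_eq.1 hs with hlt | heq
    · rw [g5 _ hlt.ne, h3 s hlt]
    · obtain rfl : s = ⟨j, hj⟩ := Fin.ext heq
      exact g4
  · rintro m2 - ⟨J, -, -, -, h2⟩ s
    exact h2 s s.2

end MarkovChain

end

/-! ### Assembly: the polynomial running time -/

theorem mainTheorem9 (cmp : Comparison) :
    ∃ (P : RamProg) (f : Polynomial ℕ),
      ∀ (n : ℕ) (M : MarkovChain n) (a b : AP) (p : ℚ), 0 ≤ p → p ≤ 1 →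
        ∃ (t : ℕ) (m : RamMemory),
          RamExec P (inputMemory M a b p) t m ∧
          t ≤ f.eval (max 1 M.maxReward * M.size * ratSize p) ∧
          ∀ s : Fin n, outputValue m s = M.queryValue cmp p a b s := by
  obtain ⟨g, hg⟩ := RamProg.exists_polynomial_timeBound (mainProg cmp)
  -- The loop bound 4z² + 2z + 3 at z = w + 1. The increment covers the chain without states, for
  -- which w = 0 although `max 1 M.maxReward` is 1.
  refine ⟨mainProg cmp, g.comp (4 * (.X + 1) ^ 2 + 2 * (.X + 1) + 3), fun n M a b p _ _ => ?_⟩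
  set w := max 1 M.maxReward * M.size * ratSize p with hw
  have hc : 0 < max 1 M.maxReward := lt_of_lt_of_le one_pos (le_max_left _ _)
  have hp : 0 < ratSize p := Nat.add_pos_left (MarkovChain.natSize_pos _) _
  have h1 : max 1 M.maxReward * M.size ≤ w := Nat.le_mul_of_pos_right _ hp
  have h2 : M.size ≤ w := (Nat.le_mul_of_pos_left _ hc).trans h1
  have hn : n ≤ M.size := MarkovChain.le_size
  have h3 : n * max 1 M.maxReward ≤ w :=
    (Nat.mul_le_mul_right _ hn).trans ((mul_comm _ _).le.trans h1)
  have h4 : 0 < n → ratSize p ≤ w := fun h =>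
    Nat.le_mul_of_pos_left _ (Nat.mul_pos hc (h.trans_le hn))
  have h5 : max 1 M.maxReward ≤ w + 1 := by
    rcases Nat.eq_zero_or_pos n with rfl | h
    · simp [MarkovChain.maxReward]
    · exact ((Nat.le_mul_of_pos_left _ h).trans h3).trans (Nat.le_succ _)
  obtain ⟨t, m, ht, htb, hm⟩ := MarkovChain.mainProg_ensures (M := M) (a := a) (b := b) (p := p)
    (cmp := cmp) (z := w + 1) (h2.trans (Nat.le_succ _)) (fun h => (h4 h).trans (Nat.le_succ _)) h5
    (h3.trans (Nat.le_succ _))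
  refine ⟨t, m, ht, htb.trans_eq ?_, hm⟩
  rw [hg]
  simp [Polynomial.eval_comp]
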